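/- Let $b,b^*$ be the annihilation and creation operators of one boson mode on the Fock space $\mathcal H_C=\ell^2(\mathbb N)$, and let $a_k^*a_k$ be the occupation operator of the $k$-th two-level atom ($k\ge 1$) on $\mathbb C^2$. Let $\epsilon,E,\sigma,\tau>0$ and $\lambda\in\mathbb R$. While the $k$-th atom is in the cavity, i.e. for $t\in[(k-1)\tau,k\tau)$, the cavity and the atoms evolve under the master equation $$\dot\rho=L_{\sigma,k}(\rho)=-i[H_k,\rho]+\sigma\, b\rho b^*-\tfrac{\sigma}{2}\{b^*b,\rho\},\qquad H_k=\epsilon\, b^*b+\sum_{j} E\,a_j^*a_j+\lambda\,(b^*+b)\,a_k^*a_k ,$$ with initial state $\rho_C\otimes\bigotimes_k r$, where $\rho_C$ is a density operator on $\mathcal H_C$ and $r$ is a density matrix on $\mathbb C^2$ commuting with $a^*a$. Put $p=\mathrm{Tr}(a^*a\,r)$, $\mu=\frac{\sigma}{2}+i\epsilon$, and $W(\alpha)=e^{\alpha b-\bar\alpha b^*}$ for $\alpha\in\mathbb C$. Let $\rho_C(t)$ be the partial trace over the atoms of the state at time $t$, let $\omega^t_{C,\sigma}(A)=\mathrm{Tr}(A\,\rho_C(t))$,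 and let $\mathcal L_\sigma(\rho)=\mathrm{Tr}_{\mathbb C^2}\big(e^{\tau L_{\sigma,1}}(\rho\otimes r)\big)$ (for a single atom) be the discrete evolution of the cavity, with dual $\mathcal L_\sigma^*$ on the bounded operators of $\mathcal H_C$. Then: 1. For the cavity and any finite number of atoms, $L_{\sigma,k}$, defined on the linear span of the operators $|\varphi\rangle\langle\psi|$ with $\varphi,\psi$ having finitely many photons, is extended by the generator of exactly one strongly continuous contraction semigroup on the trace-class operators; and $\rho_C(t)$ is the same for all beams with more than $\lfloor t/\tau\rfloor$ atoms. 2. $\mathcal L_\sigma^*$ exists, and for all $n\ge 0$ and $\alpha\in\mathbb C$ $$(\mathcal L_\sigma^*)^n W(\alpha)=e^{-\frac{1}{2}(1-e^{-n\sigma\tau})|\alpha|^2}\ \prod_{k=0}^{n-1}f_k(\alpha)\ \ W(e^{-n\mu\tau}\alpha),$$ $$f_k(\alpha)=1-p+p\exp\Big(-\tfrac{i\lambda}{\mu}(1-e^{-\mu\tau})e^{-k\mu\tau}\alpha-\tfrac{i\lambda}{\bar\mu}(1-e^{-\bar\mu\tau})e^{-k\bar\mu\tau}\bar\alpha\Big).$$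 3. There is a density operator $\rho_\infty$ on $\mathcal H_C$ such that, for every initial density operator $\rho_C$ and every bounded operator $A$ on $\mathcal H_C$, $$\lim_{n\to\infty}\omega^{n\tau}_{C,\sigma}(A)=\omega_{C,\sigma}(A):=\mathrm{Tr}(A\,\rho_\infty).$$ So the limiting cavity state exists and is independent of $\rho_C$. For every $\alpha$ one has $\sum_{k}|f_k(\alpha)-1|<\infty$, the product $\prod_{k\ge 0} f_k(\alpha)$ converges, and $$\omega_{C,\sigma}(W(\alpha))=e^{-|\alpha|^2/2}\prod_{k=0}^{\infty}f_k(\alpha).$$ For continuous time, the cavity state started from $\rho_\infty$ is $\tau$-periodic in $t\ge 0$, and for every initial density operator $\rho_C$ and every bounded $A$ the difference of the values at $A$ of the cavity states at time $t$ started from $\rho_C$ and from $\rho_\infty$ tends to $0$ as $t\to\infty$ in $\mathbb R$. -/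

import Mathlib

open Filter Topology
open scoped ComplexConjugate NNReal ComplexOrder

noncomputable section

namespace Cavity

/-! ## Trace-class operators -/

section TraceClass

variable {H K : Type*} [NormedAddCommGroup H] [InnerProductSpace ℂ H] [CompleteSpace H]
  [NormedAddCommGroup K] [InnerProductSpace ℂ K] [CompleteSpace K]

/-- `(x, y)` is a nuclear decomposition of `A`: `A = ∑ₙ |xₙ⟩⟨yₙ|` with `∑ₙ ‖xₙ‖ ‖yₙ‖ < ∞`. -/
def IsNuclearDecomp (A : H →L[ℂ] H) (x y : ℕ → H) : Prop :=
  (Summable fun n => ‖x n‖ * ‖y n‖) ∧ HasSum (fun n => InnerProductSpace.rankOne ℂ (x n) (y n)) A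

theorem IsNuclearDecomp.add {A B : H →L[ℂ] H} {x y x' y' : ℕ → H}
    (h : IsNuclearDecomp A x y) (h' : IsNuclearDecomp B x' y') :
    IsNuclearDecomp (A + B) (fun n => if Even n then x (n / 2) else x' (n / 2))
      (fun n => if Even n then y (n / 2) else y' (n / 2)) := by
  have e1 : ∀ k : ℕ, (2 * k + 1) / 2 = k := fun k => by omega
  constructor
  · refine HasSum.summable (a := (∑' n, ‖x n‖ * ‖y n‖) + ∑' n, ‖x' n‖ * ‖y' n‖) ?_
    refine HasSum.even_add_odd ?_ ?_
    · simpa using h.1.hasSum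
    · simpa [e1, Nat.even_add_one] using h'.1.hasSum
  · refine HasSum.even_add_odd ?_ ?_
    · simpa using h.2
    · simpa [e1, Nat.even_add_one] using h'.2

theorem IsNuclearDecomp.sandwich {A : H →L[ℂ] H} {x y : ℕ → H} (h : IsNuclearDecomp A x y)
    (S : H →L[ℂ] K) (R : K →L[ℂ] H) :
    IsNuclearDecomp (S ∘L A ∘L R) (fun n => S (x n))
      (fun n => ContinuousLinearMap.adjoint R (y n)) := by
  constructor
  · refine Summable.of_nonneg_of_le (fun n => by positivity) (fun n => ?_)
      (h.1.mul_left (‖S‖ * ‖ContinuousLinearMap.adjoint R‖))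
    calc ‖S (x n)‖ * ‖ContinuousLinearMap.adjoint R (y n)‖
        ≤ (‖S‖ * ‖x n‖) * (‖ContinuousLinearMap.adjoint R‖ * ‖y n‖) := by
          gcongr <;> exact ContinuousLinearMap.le_opNorm _ _
      _ = _ := by ring
  · have h2 := (h.2.mapL (ContinuousLinearMap.precomp H R)).mapL
      (ContinuousLinearMap.postcomp K S)
    refine h2.congr_fun ?_
    intro n
    ext v
    simp [ContinuousLinearMap.adjoint_inner_left]

variable (H) in
/-- The trace-class operators on a Hilbert space (equivalently, the nuclear operators). -/
def traceClass : Submodule ℂ (H →L[ℂ] H) where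
  carrier := {A | ∃ x y, IsNuclearDecomp A x y}
  zero_mem' := ⟨0, 0, by simp [summable_zero], by simp [hasSum_zero]⟩
  add_mem' := by
    rintro A B ⟨x, y, h⟩ ⟨x', y', h'⟩
    exact ⟨_, _, h.add h'⟩
  smul_mem' := by
    rintro c A ⟨x, y, h⟩
    refine ⟨fun n => c • x n, y, ?_, ?_⟩
    · simpa [norm_smul, mul_assoc] using h.1.mul_left ‖c‖
    · simpa using h.2.const_smul c

/-- The trace norm of a trace-class operator (on Hilbert spaces it is the nuclear norm). -/
def traceNorm (A : H →L[ℂ] H) : ℝ :=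
  sInf {c : ℝ | ∃ x y, IsNuclearDecomp A x y ∧ c = ∑' n, ‖x n‖ * ‖y n‖}

theorem rankOne_mem_traceClass (x y : H) : InnerProductSpace.rankOne ℂ x y ∈ traceClass H := by
  refine ⟨Pi.single 0 x, Pi.single 0 y, ?_, ?_⟩
  · refine summable_of_ne_finset_zero (s := {0}) ?_
    intro n hn
    have : n ≠ 0 := by simpa using hn
    simp [this]
  · have h := hasSum_single (f := fun n : ℕ => InnerProductSpace.rankOne ℂ
      ((Pi.single 0 x : ℕ → H) n) ((Pi.single 0 y : ℕ → H) n)) 0 (by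
        intro n hn
        simp [hn])
    simpa using h

/-- The map `ρ ↦ S ρ R` between trace-class operators. -/
def sandwich (S : H →L[ℂ] K) (R : K →L[ℂ] H) : traceClass H →ₗ[ℂ] traceClass K where
  toFun ρ := ⟨S ∘L ρ.1 ∘L R, by
    obtain ⟨x, y, h⟩ := ρ.2
    exact ⟨_, _, h.sandwich S R⟩⟩
  map_add' ρ ρ' := by ext v; simp
  map_smul' c ρ := by ext v; simp

end TraceClass

/-! ## The cavity mode -/

/-- The one-mode bosonic Fock space `ℓ²(ℕ)`; `lp.single 2 n 1` is the `n`-photon state. -/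
abbrev Fock : Type := lp (fun _ : ℕ => ℂ) 2

/-- The vectors with finitely many photons. -/
abbrev FinVec : Type := ℕ →₀ ℂ

/-- The inclusion of the finite-photon vectors in the Fock space. -/
def toFock : FinVec →ₗ[ℂ] Fock :=
  Finsupp.linearCombination ℂ fun n => lp.single 2 n (1 : ℂ)

/-- The annihilation operator `b`: `b |n⟩ = √n |n-1⟩`. -/
def annih : FinVec →ₗ[ℂ] FinVec :=
  Finsupp.linearCombination ℂ fun n => Finsupp.single (n - 1) (Real.sqrt n : ℂ)

/-- The creation operator `b*`: `b* |n⟩ = √(n+1) |n+1⟩`. -/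
def creat : FinVec →ₗ[ℂ] FinVec :=
  Finsupp.linearCombination ℂ fun n => Finsupp.single (n + 1) (Real.sqrt (n + 1) : ℂ)

/-- The trace of an operator on the Fock space. -/
def trace (A : Fock →L[ℂ] Fock) : ℂ :=
  ∑' n : ℕ, A (lp.single 2 n (1 : ℂ)) n

/-- Density operators (normal states) of the cavity. -/
def IsDensity (ρ : traceClass Fock) : Prop :=
  ρ.1.IsPositive ∧ trace ρ.1 = 1

/-! ### Weyl operators -/

/-- The field operator `α b - ᾱ b*`. -/
def weylGen (α : ℂ) : FinVec →ₗ[ℂ] FinVec := α • annih - conj α • creat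

theorem toFock_single (n : ℕ) (c : ℂ) :
    toFock (Finsupp.single n c) = c • lp.single 2 n (1 : ℂ) := by
  simp [toFock]

theorem annih_single (n : ℕ) (c : ℂ) :
    annih (Finsupp.single n c) = Finsupp.single (n - 1) (c * (Real.sqrt n : ℂ)) := by
  simp [annih]

theorem creat_single (n : ℕ) (c : ℂ) :
    creat (Finsupp.single n c) = Finsupp.single (n + 1) (c * (Real.sqrt (n + 1) : ℂ)) := by
  simp [creat]

theorem inner_basis (m n : ℕ) :
    inner ℂ (lp.single 2 m (1 : ℂ) : Fock) (lp.single 2 n (1 : ℂ)) = if m = n then 1 else 0 := by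
  rw [lp.inner_single_left]
  by_cases h : m = n
  · subst h; simp
  · simp [h]

theorem inner_annih (φ ψ : FinVec) :
    inner ℂ (toFock (annih φ)) (toFock ψ) = inner ℂ (toFock φ) (toFock (creat ψ)) := by
  induction φ using Finsupp.induction_linear with
  | zero => simp
  | add f g hf hg => simp only [map_add, inner_add_left, hf, hg]
  | single m c =>
    induction ψ using Finsupp.induction_linear with
    | zero => simp
    | add f g hf hg => simp only [map_add, inner_add_right, hf, hg]
    | single n d =>
      rw [annih_single, creat_single]
      simp only [toFock_single, inner_smul_left, inner_smul_right, inner_basis]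
      rcases m with _ | m
      · simp
      · by_cases h : m = n
        · subst h
          simp
          ring
        · simp [h]

theorem inner_weylGen (α : ℂ) (φ ψ : FinVec) :
    inner ℂ (toFock (weylGen α φ)) (toFock ψ) = - inner ℂ (toFock φ) (toFock (weylGen α ψ)) := by
  have h : inner ℂ (toFock (creat φ)) (toFock ψ) = inner ℂ (toFock φ) (toFock (annih ψ)) := by
    rw [← inner_conj_symm, ← inner_annih, inner_conj_symm]
  simp only [weylGen, LinearMap.sub_apply, LinearMap.smul_apply, map_sub, map_smul,
    inner_sub_left, inner_sub_right, inner_smul_left, inner_smul_right, inner_annih, h,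
    Complex.conj_conj]
  ring

theorem inner_weylGen_pow (α : ℂ) (k : ℕ) (φ ψ : FinVec) :
    inner ℂ (toFock ((weylGen α ^ k) φ)) (toFock ψ) =
      (-1) ^ k * inner ℂ (toFock φ) (toFock ((weylGen α ^ k) ψ)) := by
  induction k generalizing ψ with
  | zero => simp
  | succ k ih =>
    rw [pow_succ', Module.End.mul_apply, inner_weylGen, ih]
    rw [← Module.End.mul_apply, ← pow_succ, pow_succ']
    ring

theorem norm_weylGen_pow_single (α : ℂ) (k m : ℕ) :
    ‖toFock ((weylGen α ^ k) (Finsupp.single m 1))‖ ≤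
      (2 * ‖α‖) ^ k * ∏ i ∈ Finset.range k, Real.sqrt (m + i + 1) := by
  induction k generalizing m with
  | zero => simp [toFock_single, lp.norm_single]
  | succ k ih =>
    have hA : weylGen α (Finsupp.single m 1) =
        (α * (Real.sqrt m : ℂ)) • Finsupp.single (m - 1) 1 -
          (conj α * (Real.sqrt (m + 1) : ℂ)) • Finsupp.single (m + 1) 1 := by
      simp [weylGen, annih_single, creat_single]
    rw [pow_succ, Module.End.mul_apply, hA, map_sub, map_sub, map_smul, map_smul, map_smul,
      map_smul]
    set P : ℝ := ∏ i ∈ Finset.range k, Real.sqrt ((m : ℝ) + 1 + i + 1) with hP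
    have hP0 : 0 ≤ P := Finset.prod_nonneg fun i _ => Real.sqrt_nonneg _
    have h1 := ih (m - 1)
    have h2 := ih (m + 1)
    push_cast at h2
    have h1' : ‖toFock ((weylGen α ^ k) (Finsupp.single (m - 1) 1))‖ ≤ (2 * ‖α‖) ^ k * P := by
      refine h1.trans (mul_le_mul_of_nonneg_left ?_ (by positivity))
      refine Finset.prod_le_prod (fun i _ => Real.sqrt_nonneg _) fun i _ => ?_
      refine Real.sqrt_le_sqrt ?_
      have : ((m - 1 : ℕ) : ℝ) ≤ m := by exact_mod_cast Nat.sub_le m 1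
      linarith
    have hs : Real.sqrt m ≤ Real.sqrt (m + 1) := Real.sqrt_le_sqrt (by linarith)
    rw [Finset.prod_range_succ']
    have e : ∏ i ∈ Finset.range k, Real.sqrt ((m : ℝ) + ((i + 1 : ℕ) : ℝ) + 1) = P := by
      rw [hP]
      refine Finset.prod_congr rfl fun i _ => ?_
      congr 1
      push_cast
      ring
    rw [e]
    calc _ ≤ ‖(α * (Real.sqrt m : ℂ)) • toFock ((weylGen α ^ k) (Finsupp.single (m - 1) 1))‖ +
          ‖(conj α * (Real.sqrt (m + 1) : ℂ)) •
            toFock ((weylGen α ^ k) (Finsupp.single (m + 1) 1))‖ := norm_sub_le _ _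
      _ = ‖α‖ * Real.sqrt m * ‖toFock ((weylGen α ^ k) (Finsupp.single (m - 1) 1))‖ +
          ‖α‖ * Real.sqrt (m + 1) * ‖toFock ((weylGen α ^ k) (Finsupp.single (m + 1) 1))‖ := by
          rw [norm_smul, norm_smul, norm_mul, norm_mul, Complex.norm_real, Complex.norm_real,
            RCLike.norm_conj, Real.norm_of_nonneg (Real.sqrt_nonneg _),
            Real.norm_of_nonneg (Real.sqrt_nonneg _)]
      _ ≤ ‖α‖ * Real.sqrt (m + 1) * ((2 * ‖α‖) ^ k * P) +
          ‖α‖ * Real.sqrt (m + 1) * ((2 * ‖α‖) ^ k * P) := by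
          gcongr
      _ = _ := by
          push_cast
          ring_nf

theorem summable_weylBound (a : ℝ) (ha : 0 ≤ a) (m : ℕ) :
    Summable fun k : ℕ =>
      (k.factorial : ℝ)⁻¹ * (a ^ k * ∏ i ∈ Finset.range k, Real.sqrt (m + i + 1)) := by
  refine summable_of_ratio_norm_eventually_le (r := 1 / 2) (by norm_num) ?_
  have hlim : Tendsto (fun k : ℕ => a * Real.sqrt (m + 1) / Real.sqrt ((k : ℝ) + 1)) atTop
      (𝓝 0) := by
    refine Tendsto.div_atTop tendsto_const_nhds ?_
    exact Real.tendsto_sqrt_atTop.comp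
      (tendsto_atTop_add_const_right _ _ tendsto_natCast_atTop_atTop)
  filter_upwards [hlim.eventually (ge_mem_nhds (show (0 : ℝ) < 1 / 2 by norm_num))] with k hk
  have hk1 : (0 : ℝ) < (k : ℝ) + 1 := by positivity
  have hs : Real.sqrt (m + k + 1) ≤ Real.sqrt (m + 1) * Real.sqrt (k + 1) := by
    rw [← Real.sqrt_mul (by positivity)]
    refine Real.sqrt_le_sqrt ?_
    have : (0 : ℝ) ≤ (m : ℝ) * k := by positivity
    nlinarith
  have hdiv : Real.sqrt ((k : ℝ) + 1) / ((k : ℝ) + 1) = 1 / Real.sqrt ((k : ℝ) + 1) := by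
    rw [Real.sqrt_div_self']
  have hq : a * Real.sqrt (m + k + 1) / ((k : ℝ) + 1) ≤ 1 / 2 := by
    calc a * Real.sqrt (m + k + 1) / ((k : ℝ) + 1)
        ≤ a * (Real.sqrt (m + 1) * Real.sqrt (k + 1)) / ((k : ℝ) + 1) := by gcongr
      _ = a * Real.sqrt (m + 1) * (Real.sqrt (k + 1) / ((k : ℝ) + 1)) := by ring
      _ = a * Real.sqrt (m + 1) / Real.sqrt ((k : ℝ) + 1) := by rw [hdiv]; ring
      _ ≤ 1 / 2 := hk
  set F : ℝ := (k.factorial : ℝ)⁻¹ *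
    (a ^ k * ∏ i ∈ Finset.range k, Real.sqrt ((m : ℝ) + i + 1)) with hF
  have hF0 : 0 ≤ F := by positivity
  have e : ((k + 1).factorial : ℝ)⁻¹ *
      (a ^ (k + 1) * ∏ i ∈ Finset.range (k + 1), Real.sqrt ((m : ℝ) + i + 1)) =
      a * Real.sqrt (m + k + 1) / ((k : ℝ) + 1) * F := by
    rw [Nat.factorial_succ, Finset.prod_range_succ, hF]
    push_cast
    field_simp
    ring
  rw [e, Real.norm_of_nonneg (by positivity), Real.norm_of_nonneg hF0]
  gcongr

/-- The finite-photon vectors are analytic vectors of the field operators. -/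
theorem summable_weyl (α : ℂ) (φ : FinVec) :
    Summable fun k : ℕ => ‖(k.factorial : ℂ)⁻¹ • toFock ((weylGen α ^ k) φ)‖ := by
  induction φ using Finsupp.induction_linear with
  | zero => simp
  | add f g hf hg =>
    refine Summable.of_nonneg_of_le (fun k => norm_nonneg _) (fun k => ?_) (hf.add hg)
    rw [map_add, map_add, smul_add]
    exact norm_add_le _ _
  | single m c =>
    refine Summable.of_nonneg_of_le (fun k => norm_nonneg _) (fun k => ?_)
      ((summable_weylBound (2 * ‖α‖) (by positivity) m).mul_left ‖c‖)
    have : Finsupp.single m c = c • Finsupp.single m (1 : ℂ) := by simp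
    rw [this, map_smul, map_smul, norm_smul, norm_smul, norm_inv, Complex.norm_natCast]
    have := norm_weylGen_pow_single α k m
    calc _ = ‖c‖ * ((k.factorial : ℝ)⁻¹ *
          ‖toFock ((weylGen α ^ k) (Finsupp.single m 1))‖) := by ring
      _ ≤ _ := by gcongr

/-- The exponential series `∑ₖ (α b - ᾱ b*)ᵏ φ / k!` on the finite-photon vectors. -/
def weylSeries (α : ℂ) : FinVec →ₗ[ℂ] Fock where
  toFun φ := ∑' k : ℕ, (k.factorial : ℂ)⁻¹ • toFock ((weylGen α ^ k) φ)
  map_add' φ ψ := by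
    rw [← (summable_weyl α φ).of_norm.tsum_add (summable_weyl α ψ).of_norm]
    simp
  map_smul' c φ := by
    rw [RingHom.id_apply, ← (summable_weyl α φ).of_norm.tsum_const_smul c]
    refine tsum_congr fun k => ?_
    rw [map_smul, map_smul, smul_comm]

theorem sum_antidiagonal_alternating (n : ℕ) :
    ∑ kl ∈ Finset.HasAntidiagonal.antidiagonal n,
      ((kl.1.factorial : ℂ)⁻¹ * (kl.2.factorial : ℂ)⁻¹ * (-1) ^ kl.1) = if n = 0 then 1 else 0 := by
  have h := (Commute.all (-1 : ℂ) 1).add_pow' n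
  have hn : (n.factorial : ℂ) ≠ 0 := by exact_mod_cast n.factorial_ne_zero
  have h2 : ∑ kl ∈ Finset.HasAntidiagonal.antidiagonal n,
      ((kl.1.factorial : ℂ)⁻¹ * (kl.2.factorial : ℂ)⁻¹ * (-1) ^ kl.1) =
      (n.factorial : ℂ)⁻¹ * (-1 + 1) ^ n := by
    rw [h, Finset.mul_sum]
    refine Finset.sum_congr rfl fun kl hkl => ?_
    have hk : kl.1 + kl.2 = n := Finset.HasAntidiagonal.mem_antidiagonal.1 hkl
    have h1 : (kl.1.factorial : ℂ) ≠ 0 := by exact_mod_cast kl.1.factorial_ne_zero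
    have h3 : (kl.2.factorial : ℂ) ≠ 0 := by exact_mod_cast kl.2.factorial_ne_zero
    have h4 : (n.choose kl.1 : ℂ) * kl.1.factorial * kl.2.factorial = n.factorial := by
      subst hk
      rw [Nat.choose_symm_add]
      exact_mod_cast Nat.add_choose_mul_factorial_mul_factorial kl.1 kl.2
    rw [nsmul_eq_mul, ← h4]
    have h5 : (n.choose kl.1 : ℂ) ≠ 0 := by
      intro h0
      rw [h0] at h4
      simp at h4
      exact hn h4.symm
    field_simp
    simp
  rw [h2]
  by_cases h0 : n = 0
  · subst h0; simp
  · simp [h0]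

theorem norm_weylSeries (α : ℂ) (φ : FinVec) : ‖weylSeries α φ‖ = ‖toFock φ‖ := by
  set u : ℕ → Fock := fun k => (k.factorial : ℂ)⁻¹ • toFock ((weylGen α ^ k) φ) with hu
  have hs : Summable fun k => ‖u k‖ := summable_weyl α φ
  have hprod : Summable fun kl : ℕ × ℕ => ‖u kl.1‖ * ‖u kl.2‖ :=
    hs.mul_of_nonneg hs (fun _ => norm_nonneg _) (fun _ => norm_nonneg _)
  have hin : Summable fun kl : ℕ × ℕ => inner ℂ (u kl.1) (u kl.2) :=
    Summable.of_norm_bounded hprod fun kl => norm_inner_le_norm _ _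
  have e1 : inner ℂ (weylSeries α φ) (weylSeries α φ) =
      ∑' kl : ℕ × ℕ, inner ℂ (u kl.1) (u kl.2) := by
    rw [hin.tsum_prod]
    have hw : weylSeries α φ = ∑' k, u k := rfl
    have hl : ∀ v : Fock, inner ℂ v (∑' k, u k) = ∑' k, inner ℂ v (u k) := fun v =>
      (innerSL ℂ v).map_tsum hs.of_norm
    have hr : ∀ v : Fock, inner ℂ (∑' k, u k) v = ∑' k, inner ℂ (u k) v := fun v => by
      rw [← inner_conj_symm, hl, Complex.conj_tsum]
      exact tsum_congr fun k => inner_conj_symm _ _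
    rw [hw, hr]
    exact tsum_congr fun k => hl _
  have e2 : ∀ kl : ℕ × ℕ, inner ℂ (u kl.1) (u kl.2) =
      ((kl.1.factorial : ℂ)⁻¹ * (kl.2.factorial : ℂ)⁻¹ * (-1) ^ kl.1) *
        inner ℂ (toFock φ) (toFock ((weylGen α ^ (kl.1 + kl.2)) φ)) := by
    intro kl
    simp only [hu, inner_smul_left, inner_smul_right, inner_weylGen_pow, pow_add,
      Module.End.mul_apply, map_inv₀, Complex.conj_natCast]
    ring
  have e3 : ∑' kl : ℕ × ℕ, inner ℂ (u kl.1) (u kl.2) = inner ℂ (toFock φ) (toFock φ) := by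
    have hin' := (Finset.HasAntidiagonal.sigmaAntidiagonalEquivProd (A := ℕ)).summable_iff.2 hin
    simp only [Function.comp_def] at hin'
    rw [← (Finset.HasAntidiagonal.sigmaAntidiagonalEquivProd (A := ℕ)).tsum_eq]
    rw [hin'.tsum_sigma' fun n => (hasSum_fintype _).summable]
    have : ∀ n : ℕ, ∑' kl : Finset.HasAntidiagonal.antidiagonal n,
        inner ℂ (u ((Finset.HasAntidiagonal.sigmaAntidiagonalEquivProd (A := ℕ)) ⟨n, kl⟩).1)
          (u ((Finset.HasAntidiagonal.sigmaAntidiagonalEquivProd (A := ℕ)) ⟨n, kl⟩).2) =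
        (if n = 0 then 1 else 0) * inner ℂ (toFock φ) (toFock ((weylGen α ^ n) φ)) := by
      intro n
      rw [tsum_fintype, ← sum_antidiagonal_alternating n, Finset.sum_mul,
        ← Finset.sum_coe_sort (Finset.HasAntidiagonal.antidiagonal n)]
      refine Finset.sum_congr rfl fun kl _ => ?_
      have hk : kl.1.1 + kl.1.2 = n := Finset.HasAntidiagonal.mem_antidiagonal.1 kl.2
      simp only [Finset.HasAntidiagonal.sigmaAntidiagonalEquivProd_apply]
      rw [e2, hk]
    rw [tsum_congr this, tsum_eq_single 0 (fun n hn => by simp [hn])]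
    simp
  have e4 : ((‖weylSeries α φ‖ : ℂ)) ^ 2 = ((‖toFock φ‖ : ℂ)) ^ 2 := by
    have := e1.trans e3
    rw [inner_self_eq_norm_sq_to_K, inner_self_eq_norm_sq_to_K] at this
    exact this
  have e5 : ‖weylSeries α φ‖ ^ 2 = ‖toFock φ‖ ^ 2 := by exact_mod_cast e4
  exact (sq_eq_sq₀ (norm_nonneg _) (norm_nonneg _)).1 e5

theorem denseRange_toFock : DenseRange toFock := by
  intro f
  have h := lp.hasSum_single (p := 2) (by norm_num) f
  refine mem_closure_of_tendsto h (Eventually.of_forall fun s => ?_)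
  refine ⟨∑ n ∈ s, Finsupp.single n (f n), ?_⟩
  rw [map_sum]
  refine Finset.sum_congr rfl fun n _ => ?_
  rw [toFock_single, ← lp.single_smul]
  simp

/-- The Weyl operator `W(α) = exp(α b - ᾱ b*)`: the bounded extension of the exponential series
from the finite-photon vectors to the Fock space. -/
def weyl (α : ℂ) : Fock →L[ℂ] Fock := (weylSeries α).extendOfNorm toFock

theorem weyl_toFock (α : ℂ) (φ : FinVec) :
    weyl α (toFock φ) = ∑' k : ℕ, (k.factorial : ℂ)⁻¹ • toFock ((weylGen α ^ k) φ) :=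
  LinearMap.extendOfNorm_eq denseRange_toFock
    ⟨1, fun ψ => by rw [norm_weylSeries, one_mul]⟩ φ

/-! ## The cavity together with finitely many atoms -/

/-- Basis states of `N` two-level atoms: `0` is the ground state, `1` the excited state. -/
abbrev Config (N : ℕ) : Type := Fin N → Fin 2

/-- The Hilbert space `ℋ_C ⊗ (ℂ²)^{⊗ N}` of the cavity and `N` atoms, written as the Hilbert sum,
over the basis states of the atoms, of copies of the Fock space. -/
abbrev Space (N : ℕ) : Type := PiLp 2 (fun _ : Config N => Fock)

/-- The algebraic tensor product of the finite-photon vectors with the atomic space. -/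
abbrev Core (N : ℕ) : Type := Config N → FinVec

/-- The inclusion of `Core N` in the Hilbert space. -/
def toSpace (N : ℕ) (φ : Core N) : Space N := WithLp.toLp 2 fun s => toFock (φ s)

/-- The map `f ↦ f ⊗ |s⟩`. -/
def incl {N : ℕ} (s : Config N) : Fock →L[ℂ] Space N :=
  (PiLp.continuousLinearEquiv 2 ℂ (fun _ : Config N => Fock)).symm.toContinuousLinearMap ∘L
    ContinuousLinearMap.single ℂ (fun _ : Config N => Fock) s

/-- The map `id ⊗ ⟨s|`. -/
def comps {N : ℕ} (s : Config N) : Space N →L[ℂ] Fock :=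
  PiLp.proj 2 (fun _ : Config N => Fock) s

/-- `ρ ↦ ρ ⊗ R` for a matrix `R` on the space of the `N` atoms. -/
def tensorAtoms {N : ℕ} (R : Matrix (Config N) (Config N) ℂ) :
    traceClass Fock →ₗ[ℂ] traceClass (Space N) :=
  ∑ s, ∑ s', R s s' • sandwich (incl s) (comps s')

/-- The partial trace over the atoms. -/
def traceAtoms (N : ℕ) : traceClass (Space N) →ₗ[ℂ] traceClass Fock :=
  ∑ s, sandwich (comps s) (incl s)

/-- The annihilation operator `b ⊗ 1`. -/
def annihS (N : ℕ) : Core N →ₗ[ℂ] Core N := annih.compLeft (Config N)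

/-- The creation operator `b* ⊗ 1`. -/
def creatS (N : ℕ) : Core N →ₗ[ℂ] Core N := creat.compLeft (Config N)

/-- The operator that acts as the matrix `A` on the `j`-th atom. -/
def atomOp {N : ℕ} (j : Fin N) (A : Matrix (Fin 2) (Fin 2) ℂ) : Core N →ₗ[ℂ] Core N where
  toFun φ s := ∑ i, A (s j) i • φ (Function.update s j i)
  map_add' φ ψ := by
    funext s
    simp only [Pi.add_apply, smul_add, Finset.sum_add_distrib]
  map_smul' c φ := by
    funext s
    simp only [Pi.smul_apply, RingHom.id_apply, Finset.smul_sum]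
    exact Finset.sum_congr rfl fun i _ => smul_comm _ _ _

/-- The one-point fermion annihilation operator `a` on `ℂ²`. -/
def atomAnnih : Matrix (Fin 2) (Fin 2) ℂ := !![0, 1; 0, 0]

/-- The atomic occupation operator `a* a` on `ℂ²`. -/
def atomNumber : Matrix (Fin 2) (Fin 2) ℂ := atomAnnih.conjTranspose * atomAnnih

/-- The data of the model: photon energy `ε`, atomic energy `E`, coupling `lam`, leaking rate `σ`,
passage time `τ`, and the common initial state `r` of the atoms, which is gauge invariant. -/
structure Model where
  ε : ℝ
  E : ℝ
  lam : ℝ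
  σ : ℝ
  τ : ℝ
  r : Matrix (Fin 2) (Fin 2) ℂ
  ε_pos : 0 < ε
  E_pos : 0 < E
  σ_pos : 0 < σ
  τ_pos : 0 < τ
  r_posSemidef : r.PosSemidef
  r_trace : r.trace = 1
  r_gauge : Commute r atomNumber

namespace Model

variable (M : Model)

/-- The probability `p = Tr(a* a r)` that an atom is excited. -/
def p : ℝ := (atomNumber * M.r).trace.re

/-- `μ = σ/2 + iε`. -/
def μ : ℂ := (M.σ : ℂ) / 2 + Complex.I * M.ε

/-- The Hamiltonian of the cavity and `N` atoms while the atom with index `k` is in the cavity, that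
is, for `kτ ≤ t < (k+1)τ` (the atoms are numbered from `0`). -/
def hamiltonian (N k : ℕ) : Core N →ₗ[ℂ] Core N :=
  (M.ε : ℂ) • (creatS N ∘ₗ annihS N) + ∑ j : Fin N, (M.E : ℂ) • atomOp j atomNumber +
    ∑ j : Fin N, if (j : ℕ) = k then
      (M.lam : ℂ) • ((creatS N + annihS N) ∘ₗ atomOp j atomNumber) else 0

/-- The dyad `|φ⟩⟨ψ|`, for `φ`, `ψ` in the core. -/
def dyad {N : ℕ} (φ ψ : Core N) : Space N →L[ℂ] Space N :=
  InnerProductSpace.rankOne ℂ (toSpace N φ) (toSpace N ψ)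

/-- The Kossakowski-Lindblad generator
`L ρ = -i [H, ρ] + σ b ρ b* - (σ/2) {b* b, ρ}`, evaluated at `ρ = |φ⟩⟨ψ|`. -/
def lindblad (N k : ℕ) (φ ψ : Core N) : Space N →L[ℂ] Space N :=
  (-Complex.I) • (dyad (M.hamiltonian N k φ) ψ - dyad φ (M.hamiltonian N k ψ)) +
    (M.σ : ℂ) • dyad (annihS N φ) (annihS N ψ) -
    ((M.σ : ℂ) / 2) • (dyad (creatS N (annihS N φ)) ψ + dyad φ (creatS N (annihS N ψ)))

/-- `T` is a strongly continuous contraction semigroup on the trace-class operators whose generator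
extends the Kossakowski-Lindblad generator from the span of the dyads of finite-photon vectors. -/
structure IsLindbladSemigroup (N k : ℕ)
    (T : ℝ≥0 → (traceClass (Space N) →ₗ[ℂ] traceClass (Space N))) : Prop where
  zero : T 0 = LinearMap.id
  add : ∀ s t, T (s + t) = T s ∘ₗ T t
  contraction : ∀ t ρ, traceNorm (T t ρ).1 ≤ traceNorm ρ.1
  continuous : ∀ ρ, Tendsto (fun t => traceNorm ((T t ρ).1 - ρ.1)) (𝓝 0) (𝓝 0)
  generator : ∀ φ ψ : Core N, Tendsto
    (fun t : ℝ≥0 => traceNorm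
      (((t : ℝ) : ℂ)⁻¹ • ((T t ⟨dyad φ ψ, rankOne_mem_traceClass _ _⟩).1 - dyad φ ψ) -
        M.lindblad N k φ ψ))
    (𝓝[>] 0) (𝓝 0)

/-- The semigroup `t ↦ exp(t L)`, where `L` is the generator while atom `k` is in the cavity. -/
def semigroup (N k : ℕ) : ℝ≥0 → (traceClass (Space N) →ₗ[ℂ] traceClass (Space N)) :=
  Classical.epsilon (M.IsLindbladSemigroup N k)

/-- The initial state `r ⊗ ⋯ ⊗ r` of `N` atoms. -/
def beam (N : ℕ) : Matrix (Config N) (Config N) ℂ := fun s s' => ∏ j, M.r (s j) (s' j)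

/-- The state of the cavity and `N` atoms at time `k τ`. -/
def stateAtStep (N : ℕ) (ρ : traceClass Fock) : ℕ → traceClass (Space N)
  | 0 => tensorAtoms (M.beam N) ρ
  | k + 1 => M.semigroup N k M.τ.toNNReal (stateAtStep N ρ k)

/-- The state of the cavity and `N` atoms at time `t ≥ 0`: with `n = ⌊t/τ⌋` and `ν = t - nτ` it is
`exp(ν L_{n}) exp(τ L_{n-1}) ⋯ exp(τ L_0) (ρ ⊗ r ⊗ ⋯ ⊗ r)`. -/
def state (N : ℕ) (t : ℝ) (ρ : traceClass Fock) : traceClass (Space N) :=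
  M.semigroup N ⌊t / M.τ⌋₊ (t - ⌊t / M.τ⌋₊ * M.τ).toNNReal (M.stateAtStep N ρ ⌊t / M.τ⌋₊)

/-- The state of the cavity at time `t`, for a beam of `N` atoms and initial cavity state `ρ`. -/
def cavityStateOf (N : ℕ) (t : ℝ) (ρ : traceClass Fock) : traceClass Fock :=
  traceAtoms N (M.state N t ρ)

/-- The state of the cavity at time `t`. Only the first `⌊t/τ⌋ + 1` atoms of the infinite beam have
entered the cavity by that time; the remaining ones have not interacted with anything. -/
def cavityState (t : ℝ) (ρ : traceClass Fock) : traceClass Fock :=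
  M.cavityStateOf (⌊t / M.τ⌋₊ + 1) t ρ

/-- The functional `ω^t(A) = Tr(A ρ(t))` on the bounded operators of the cavity. -/
def omega (t : ℝ) (ρ : traceClass Fock) (A : Fock →L[ℂ] Fock) : ℂ :=
  trace (A ∘L (M.cavityState t ρ).1)

/-- The discrete evolution operator `𝓛 ρ = Tr_atom (exp(τ L) (ρ ⊗ r))` of the cavity. -/
def discreteEvolution : traceClass Fock →ₗ[ℂ] traceClass Fock :=
  traceAtoms 1 ∘ₗ M.semigroup 1 0 M.τ.toNNReal ∘ₗ tensorAtoms (M.beam 1)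

/-- The `k`-th factor of the characteristic function. -/
def factor (k : ℕ) (α : ℂ) : ℂ :=
  1 - M.p + M.p * Complex.exp (
    -(Complex.I * M.lam / M.μ) * (1 - Complex.exp (-M.μ * M.τ)) *
        Complex.exp (-k * M.μ * M.τ) * α -
      (Complex.I * M.lam / conj M.μ) * (1 - Complex.exp (-conj M.μ * M.τ)) *
        Complex.exp (-k * conj M.μ * M.τ) * conj α)

end Model

/-- `Ψ`, acting on bounded operators, is the dual of the map `Φ` on trace-class operators. -/
def IsDual (Φ : traceClass Fock →ₗ[ℂ] traceClass Fock)
    (Ψ : (Fock →L[ℂ] Fock) → (Fock →L[ℂ] Fock)) : Prop :=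
  ∀ (B : Fock →L[ℂ] Fock) (ρ : traceClass Fock), trace (Ψ B ∘L ρ.1) = trace (B ∘L (Φ ρ).1)

end Cavity

end

open Cavity

/-! The generator sends |φ⟩⟨ψ| to |Gφ⟩⟨ψ| + |φ⟩⟨Gψ| + |Kφ⟩⟨Kψ| with G = -iH - (σ/2) b*b and K = √σ
b, and 2 Re⟨φ, Gφ⟩ + ‖Kφ‖² = 0. Writing a finite-rank operator in its singular value decomposition
and testing against the partial isometry that attains its trace norm shows that such a generator is
dissipative for the trace norm (`norm_sum_dyadForm_le`).

In a fixed configuration s of the atoms the coupling is a scalar drive l of the cavity. The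
exponential vectors e(z) satisfy b e(z) = z e(z) and e'(z) = b* e(z), so the dyads |e(z), s⟩⟨e(w),
s'| solve the master equation up to a scalar weight once the amplitudes follow z' = -μz - il
(`hasDerivAt_cohDyad`). Dissipativity makes this motion contractive on their span, which is dense,
and the extension is the semigroup `evol`. Number-state dyads are Taylor coefficients of coherent
dyads, and coherent dyads are convergent sums of number-state dyads, in both cases together with the
values of the generator. As the graph of a generator is closed, each family determines the generator
on the other: one direction gives existence, the other uniqueness
(`existsUnique_isLindbladSemigroup`).

Gauge invariance makes r diagonal, so the beam is a classical mixture of configurations with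
independent atoms, and the cavity evolves by iterating one averaged map `step` (`cavityStateOf_eq`).
On the trace-one dyads `normDyad z w` this map only moves the labels, by a random affine contraction
of ratio exp(-στ/2) per atom.

Everything else is read off these dyads. The trace of W(α) against `normDyad z w` is the exponential
of an affine function of z and w̄, so the dual of `step` multiplies Weyl operators by explicit
factors (`dual_step_weyl`). Any two dyads merge geometrically under repeated passages
(`exists_pass_contraction`); contractivity and density extend this to all trace-class operators
(`tendsto_pass_pow`). The characteristic function of the limit is obtained along the orbit of the
vacuum. -/

noncomputable section

set_option linter.unusedSectionVars false

namespace Cavity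

local notation "⟪" x ", " y "⟫" => inner ℂ x y

/-! ### The Banach space of trace-class operators with the trace norm. -/

section TraceNorm

variable {H K : Type*} [NormedAddCommGroup H] [InnerProductSpace ℂ H] [CompleteSpace H]
  [NormedAddCommGroup K] [InnerProductSpace ℂ K] [CompleteSpace K]

theorem norm_rankOne_eq (x y : H) : ‖InnerProductSpace.rankOne ℂ x y‖ = ‖x‖ * ‖y‖ := by
  simp

theorem traceNorm_nonneg (A : H →L[ℂ] H) : 0 ≤ traceNorm A := by
  refine Real.sInf_nonneg ?_
  rintro c ⟨x, y, -, rfl⟩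
  exact tsum_nonneg fun n => by positivity

theorem IsNuclearDecomp.traceNorm_le {A : H →L[ℂ] H} {x y : ℕ → H} (h : IsNuclearDecomp A x y) :
    traceNorm A ≤ ∑' n, ‖x n‖ * ‖y n‖ := by
  refine csInf_le ⟨0, ?_⟩ ⟨x, y, h, rfl⟩
  rintro c ⟨x, y, -, rfl⟩
  exact tsum_nonneg fun n => by positivity

theorem exists_isNuclearDecomp_lt {A : H →L[ℂ] H} (hA : A ∈ traceClass H) {c : ℝ}
    (hc : traceNorm A < c) :
    ∃ x y, IsNuclearDecomp A x y ∧ ∑' n, ‖x n‖ * ‖y n‖ < c := by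
  obtain ⟨x, y, h⟩ := hA
  obtain ⟨d, ⟨x', y', h', rfl⟩, hd⟩ := exists_lt_of_csInf_lt (s := {c : ℝ | ∃ x y,
    IsNuclearDecomp A x y ∧ c = ∑' n, ‖x n‖ * ‖y n‖}) ⟨_, x, y, h, rfl⟩ hc
  exact ⟨x', y', h', hd⟩

/-- A lower bound for the trace norm is established on nuclear decompositions. -/
theorem le_traceNorm {A : H →L[ℂ] H} (hA : A ∈ traceClass H) {c : ℝ}
    (hc : ∀ x y, IsNuclearDecomp A x y → c ≤ ∑' n, ‖x n‖ * ‖y n‖) : c ≤ traceNorm A := by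
  by_contra! h
  obtain ⟨x, y, hd, hlt⟩ := exists_isNuclearDecomp_lt hA h
  exact absurd (hc x y hd) (not_le.2 hlt)

theorem opNorm_le_traceNorm {A : H →L[ℂ] H} (hA : A ∈ traceClass H) : ‖A‖ ≤ traceNorm A := by
  refine le_traceNorm hA fun x y h => ?_
  have hs : Summable fun n => ‖InnerProductSpace.rankOne ℂ (x n) (y n)‖ := by
    simpa only [norm_rankOne_eq] using h.1
  rw [← h.2.tsum_eq]
  refine (norm_tsum_le_tsum_norm hs).trans (le_of_eq ?_)
  simp only [norm_rankOne_eq]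

theorem traceNorm_add_le {A B : H →L[ℂ] H} (hA : A ∈ traceClass H) (hB : B ∈ traceClass H) :
    traceNorm (A + B) ≤ traceNorm A + traceNorm B := by
  refine le_of_forall_pos_le_add fun ε hε => ?_
  obtain ⟨x, y, h, hlt⟩ := exists_isNuclearDecomp_lt hA (lt_add_of_pos_right _ (half_pos hε))
  obtain ⟨x', y', h', hlt'⟩ := exists_isNuclearDecomp_lt hB (lt_add_of_pos_right _ (half_pos hε))
  have e1 : ∀ k : ℕ, (2 * k + 1) / 2 = k := fun k => by omega
  have e : HasSum (fun n => ‖if Even n then x (n / 2) else x' (n / 2)‖ *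
      ‖if Even n then y (n / 2) else y' (n / 2)‖)
      ((∑' n, ‖x n‖ * ‖y n‖) + ∑' n, ‖x' n‖ * ‖y' n‖) := by
    refine HasSum.even_add_odd ?_ ?_
    · simpa using h.1.hasSum
    · simpa [e1, Nat.even_add_one] using h'.1.hasSum
  have := (h.add h').traceNorm_le
  rw [e.tsum_eq] at this
  linarith

theorem IsNuclearDecomp.smul {A : H →L[ℂ] H} {x y : ℕ → H} (h : IsNuclearDecomp A x y) (c : ℂ) :
    IsNuclearDecomp (c • A) (fun n => c • x n) y := by
  refine ⟨?_, ?_⟩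
  · simpa [norm_smul, mul_assoc] using h.1.mul_left ‖c‖
  · simpa using h.2.const_smul c

theorem traceNorm_zero : traceNorm (0 : H →L[ℂ] H) = 0 := by
  refine le_antisymm ?_ (traceNorm_nonneg _)
  have h : IsNuclearDecomp (0 : H →L[ℂ] H) 0 0 := ⟨by simp [summable_zero], by simp [hasSum_zero]⟩
  simpa using h.traceNorm_le

theorem traceNorm_smul_le {A : H →L[ℂ] H} (hA : A ∈ traceClass H) (c : ℂ) :
    traceNorm (c • A) ≤ ‖c‖ * traceNorm A := by
  rcases eq_or_ne c 0 with rfl | hc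
  · simp [traceNorm_zero]
  rw [← div_le_iff₀' (norm_pos_iff.2 hc)]
  refine le_traceNorm hA fun x y h => ?_
  rw [div_le_iff₀' (norm_pos_iff.2 hc)]
  refine (h.smul c).traceNorm_le.trans (le_of_eq ?_)
  rw [← tsum_mul_left]
  exact tsum_congr fun n => by rw [norm_smul, mul_assoc]

theorem traceNorm_smul {A : H →L[ℂ] H} (hA : A ∈ traceClass H) (c : ℂ) :
    traceNorm (c • A) = ‖c‖ * traceNorm A := by
  refine le_antisymm (traceNorm_smul_le hA c) ?_
  rcases eq_or_ne c 0 with rfl | hc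
  · simp [traceNorm_zero]
  have h := traceNorm_smul_le ((traceClass H).smul_mem c hA) c⁻¹
  rw [inv_smul_smul₀ hc, norm_inv] at h
  rwa [← le_inv_mul_iff₀ (norm_pos_iff.2 hc)]

variable (H) in
/-- The Banach space of trace-class operators, with the trace norm. -/
def TC : Type _ := traceClass H

namespace TC

/-- Only the algebraic structure is transported: the submodule `traceClass H` already carries the
operator norm, and the synonym `TC H` keeps the trace norm apart from it. -/
instance : AddCommGroup (TC H) := inferInstanceAs (AddCommGroup (traceClass H))
instance : Module ℂ (TC H) := inferInstanceAs (Module ℂ (traceClass H))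
instance : Norm (TC H) := ⟨fun A => traceNorm (Subtype.val (p := (· ∈ traceClass H)) A)⟩

/-- The underlying bounded operator. -/
def op : TC H →ₗ[ℂ] (H →L[ℂ] H) := (traceClass H).subtype

/-- A trace-class operator as an element of the Banach space `TC H`. -/
def ofMem (A : H →L[ℂ] H) (hA : A ∈ traceClass H) : TC H := ⟨A, hA⟩

@[simp] theorem op_ofMem (A : H →L[ℂ] H) (hA : A ∈ traceClass H) : op (ofMem A hA) = A := rfl

theorem op_injective : Function.Injective (op : TC H → (H →L[ℂ] H)) := Subtype.val_injective

theorem norm_def (A : TC H) : ‖A‖ = traceNorm (op A) := rfl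

theorem core : NormedSpace.Core ℂ (TC H) where
  norm_nonneg _ := traceNorm_nonneg _
  norm_smul c A := traceNorm_smul A.2 c
  norm_triangle A B := traceNorm_add_le A.2 B.2
  norm_eq_zero_iff A := by
    refine ⟨fun h => op_injective ?_, ?_⟩
    · have := opNorm_le_traceNorm A.2
      rw [map_zero, ← norm_le_zero_iff]
      exact this.trans (le_of_eq h)
    · rintro rfl
      exact traceNorm_zero

instance : NormedAddCommGroup (TC H) := NormedAddCommGroup.ofCore (𝕜 := ℂ) core
instance : NormedSpace ℂ (TC H) := NormedSpace.ofCore core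

/-- The inclusion of the trace-class operators in the bounded operators. -/
def opL : TC H →L[ℂ] (H →L[ℂ] H) :=
  (op : TC H →ₗ[ℂ] (H →L[ℂ] H)).mkContinuous 1 fun A => by
    rw [one_mul]; exact opNorm_le_traceNorm A.2

/-- Sums of nuclear operators. -/
theorem exists_hasSum_op {u : ℕ → H →L[ℂ] H} {x y : ℕ → ℕ → H}
    (hd : ∀ n, IsNuclearDecomp (u n) (x n) (y n))
    (hs : Summable fun n => ∑' k, ‖x n k‖ * ‖y n k‖) :
    ∃ A ∈ traceClass H, HasSum u A ∧ traceNorm A ≤ ∑' n, ∑' k, ‖x n k‖ * ‖y n k‖ := by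
  have h2 : Summable fun p : ℕ × ℕ => ‖x p.1 p.2‖ * ‖y p.1 p.2‖ :=
    (summable_prod_of_nonneg fun p => by positivity).2 ⟨fun n => (hd n).1, hs⟩
  have h3 : Summable fun p : ℕ × ℕ => InnerProductSpace.rankOne ℂ (x p.1 p.2) (y p.1 p.2) :=
    Summable.of_norm (by simpa only [norm_rankOne_eq] using h2)
  obtain ⟨A, hA⟩ := h3
  -- A doubly indexed family of rank-one terms becomes a single decomposition through the pairing of
  -- ℕ × ℕ with ℕ.
  have h4 : IsNuclearDecomp A (fun n => x n.unpair.1 n.unpair.2) (fun n => y n.unpair.1 n.unpair.2) :=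
    ⟨(Nat.pairEquiv.symm.summable_iff (f := fun p : ℕ × ℕ => ‖x p.1 p.2‖ * ‖y p.1 p.2‖)).2 h2,
      (Nat.pairEquiv.symm.hasSum_iff
        (f := fun p : ℕ × ℕ => InnerProductSpace.rankOne ℂ (x p.1 p.2) (y p.1 p.2))).2 hA⟩
  refine ⟨A, ⟨_, _, h4⟩, hA.prod_fiberwise fun n => (hd n).2, ?_⟩
  refine h4.traceNorm_le.trans (le_of_eq ?_)
  rw [← h2.tsum_prod]
  exact Nat.pairEquiv.symm.tsum_eq (fun p : ℕ × ℕ => ‖x p.1 p.2‖ * ‖y p.1 p.2‖)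

/-- It suffices to sum absolutely convergent series. Near-optimal decompositions of the terms are
merged into one decomposition of the operator-norm sum; the same merging for the shifted series
bounds the trace norm of the remainders. -/
instance : CompleteSpace (TC H) := by
  refine NormedAddCommGroup.completeSpace_of_summable_imp_tendsto fun u hu => ?_
  -- The infimum need not be attained; a slack of 2⁻ⁿ in the n-th term keeps the total cost finite.
  have hlt : ∀ n, traceNorm (op (u n)) < ‖u n‖ + (1 / 2) ^ n := fun n =>
    lt_add_of_pos_right _ (by positivity)
  choose x y hd hxy using fun n => exists_isNuclearDecomp_lt (u n).2 (hlt n)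
  have hb : Summable fun n => ‖u n‖ + (1 / 2 : ℝ) ^ n := hu.add summable_geometric_two
  have hs : Summable fun n => ∑' k, ‖x n k‖ * ‖y n k‖ :=
    Summable.of_nonneg_of_le (fun n => tsum_nonneg fun k => by positivity)
      (fun n => (hxy n).le) hb
  obtain ⟨A, hA, hsum, -⟩ := exists_hasSum_op hd hs
  refine ⟨ofMem A hA, ?_⟩
  rw [tendsto_iff_norm_sub_tendsto_zero]
  refine squeeze_zero (fun _ => norm_nonneg _) (fun N => ?_) (tendsto_sum_nat_add fun n =>
    ∑' k, ‖x n k‖ * ‖y n k‖)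
  obtain ⟨B, hB, hBs, hBn⟩ := exists_hasSum_op (u := fun n => op (u (n + N))) (fun n => hd (n + N))
    ((summable_nat_add_iff N).2 hs)
  have hB2 : op (ofMem A hA - ∑ i ∈ Finset.range N, u i) = B := by
    have h1 := (hasSum_nat_add_iff' N).2 hsum
    rw [map_sub, map_sum]
    exact h1.unique hBs
  rw [norm_sub_rev, norm_def, hB2]
  exact hBn

/-- The rank-one operator `|x⟩⟨y|`. -/
def rankOne (x y : H) : TC H := ⟨InnerProductSpace.rankOne ℂ x y, rankOne_mem_traceClass x y⟩

@[simp] theorem op_rankOne (x y : H) : op (rankOne x y) = InnerProductSpace.rankOne ℂ x y := rfl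

theorem norm_rankOne_le (x y : H) : ‖rankOne x y‖ ≤ ‖x‖ * ‖y‖ := by
  have h : IsNuclearDecomp (op (rankOne x y)) (Pi.single 0 x) (Pi.single 0 y) := by
    constructor
    · refine summable_of_ne_finset_zero (s := {0}) ?_
      intro n hn
      have : n ≠ 0 := by simpa using hn
      simp [this]
    · have h := hasSum_single (f := fun n : ℕ => InnerProductSpace.rankOne ℂ
        ((Pi.single 0 x : ℕ → H) n) ((Pi.single 0 y : ℕ → H) n)) 0 (by
          intro n hn
          simp [hn])
      simpa using h
  refine h.traceNorm_le.trans (le_of_eq ?_)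
  rw [tsum_eq_single 0 (fun n hn => by simp [hn])]
  simp

theorem rankOne_add_left (x x' y : H) : rankOne (x + x') y = rankOne x y + rankOne x' y :=
  op_injective (by simp)

theorem rankOne_add_right (x y y' : H) : rankOne x (y + y') = rankOne x y + rankOne x y' :=
  op_injective (by simp)

theorem rankOne_smul_left (c : ℂ) (x y : H) : rankOne (c • x) y = c • rankOne x y :=
  op_injective (by simp)

theorem rankOne_smul_right (c : ℂ) (x y : H) : rankOne x (c • y) = conj c • rankOne x y :=
  op_injective (by simp)

/-- `|x⟩⟨y|` as a bounded real-bilinear map. -/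
def rankOneL : H →L[ℝ] H →L[ℝ] TC H :=
  LinearMap.mkContinuous₂ (LinearMap.mk₂ ℝ rankOne rankOne_add_left
    (fun c x y => by
      rw [← Complex.coe_smul, rankOne_smul_left, Complex.coe_smul]) rankOne_add_right
    (fun c x y => by
      rw [← Complex.coe_smul, rankOne_smul_right, Complex.conj_ofReal, Complex.coe_smul])) 1
    fun x y => by
      rw [one_mul]
      exact norm_rankOne_le x y

@[simp] theorem rankOneL_apply (x y : H) : rankOneL x y = rankOne x y := rfl

/-- A nuclear decomposition converges in the trace norm. -/
theorem hasSum_rankOne {A : TC H} {x y : ℕ → H} (h : IsNuclearDecomp (op A) x y) :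
    HasSum (fun n => rankOne (x n) (y n)) A := by
  have hs : Summable fun n => rankOne (x n) (y n) :=
    Summable.of_norm (Summable.of_nonneg_of_le (fun _ => norm_nonneg _)
      (fun n => norm_rankOne_le _ _) h.1)
  have h2 := hs.hasSum.mapL opL
  have h3 : op (∑' n, rankOne (x n) (y n)) = op A := h2.unique h.2
  rw [← op_injective h3]
  exact hs.hasSum

/-- Operators of rank one on a dense set of vectors span a dense subspace. -/
theorem dense_span_rankOne {D : Set H} (hD : Dense D) :
    Dense (Submodule.span ℂ {A : TC H | ∃ x ∈ D, ∃ y ∈ D, A = rankOne x y} : Set (TC H)) := by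
  set S := Submodule.span ℂ {A : TC H | ∃ x ∈ D, ∃ y ∈ D, A = rankOne x y}
  have h1 : ∀ x y : H, rankOne x y ∈ S.topologicalClosure := by
    intro x y
    have hc : Continuous fun p : H × H => rankOne p.1 p.2 := rankOneL.continuous₂
    have hm : (x, y) ∈ closure (D ×ˢ D) := by
      rw [closure_prod_eq]
      exact ⟨hD x, hD y⟩
    have := map_mem_closure hc hm (t := (S : Set (TC H))) (by
      rintro ⟨a, b⟩ ⟨ha, hb⟩
      exact Submodule.subset_span ⟨a, ha, b, hb, rfl⟩)
    exact this
  intro A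
  obtain ⟨x, y, h⟩ := A.2
  have hs := hasSum_rankOne (A := A) h
  have hcl : IsClosed (S.topologicalClosure : Set (TC H)) := S.isClosed_topologicalClosure
  exact hcl.mem_of_tendsto hs (Eventually.of_forall fun s =>
    S.topologicalClosure.sum_mem fun n _ => h1 _ _)

/-- The Ky Fan bound: the trace norm dominates sums of matrix elements between orthonormal
families. -/
theorem sum_norm_inner_le {ι : Type*} {u v : ι → H} (hu : Orthonormal ℂ u) (hv : Orthonormal ℂ v)
    (S : Finset ι) (A : TC H) : ∑ b ∈ S, ‖⟪u b, op A (v b)⟫‖ ≤ ‖A‖ := by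
  refine le_traceNorm A.2 fun x y h => ?_
  -- Cauchy-Schwarz over `S` and then Bessel for each orthonormal family bound every term of the
  -- decomposition, uniformly in `S`.
  have hb : ∀ n, ∑ b ∈ S, ‖⟪u b, x n⟫‖ * ‖⟪y n, v b⟫‖ ≤ ‖x n‖ * ‖y n‖ := by
    intro n
    have h1 := hu.sum_inner_products_le (s := S) (x n)
    have h2 := hv.sum_inner_products_le (s := S) (y n)
    have h3 := Finset.sum_mul_sq_le_sq_mul_sq S (fun b => ‖⟪u b, x n⟫‖) fun b => ‖⟪y n, v b⟫‖
    refine abs_le_of_sq_le_sq' ?_ (by positivity) |>.2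
    refine h3.trans ?_
    rw [mul_pow]
    refine mul_le_mul h1 ?_ (by positivity) (by positivity)
    simpa only [norm_inner_symm (y n)] using h2
  have hs : ∀ b, HasSum (fun n => ⟪u b, x n⟫ * ⟪y n, v b⟫) ⟪u b, op A (v b)⟫ := by
    intro b
    have h1 := (h.2.mapL (ContinuousLinearMap.apply ℂ H (v b))).mapL (innerSL ℂ (u b))
    refine h1.congr_fun fun n => ?_
    simp [mul_comm]
  have hsn : ∀ b ∈ S, Summable fun n => ‖⟪u b, x n⟫‖ * ‖⟪y n, v b⟫‖ := by
    intro b hbS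
    refine Summable.of_nonneg_of_le (fun _ => by positivity) (fun n => ?_) h.1
    exact (Finset.single_le_sum (f := fun b => ‖⟪u b, x n⟫‖ * ‖⟪y n, v b⟫‖)
      (fun _ _ => by positivity) hbS).trans (hb n)
  calc ∑ b ∈ S, ‖⟪u b, op A (v b)⟫‖ ≤ ∑ b ∈ S, ∑' n, ‖⟪u b, x n⟫‖ * ‖⟪y n, v b⟫‖ := by
        refine Finset.sum_le_sum fun b hbS => ?_
        rw [← (hs b).tsum_eq]
        refine (norm_tsum_le_tsum_norm ?_).trans (le_of_eq ?_)
        · simpa only [norm_mul] using hsn b hbS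
        · simp only [norm_mul]
    _ = ∑' n, ∑ b ∈ S, ‖⟪u b, x n⟫‖ * ‖⟪y n, v b⟫‖ := (Summable.tsum_finsetSum hsn).symm
    _ ≤ ∑' n, ‖x n‖ * ‖y n‖ := (summable_sum hsn).tsum_le_tsum hb h.1

theorem norm_sandwich_le (S : H →L[ℂ] K) (R : K →L[ℂ] H) (A : TC H) :
    ‖(show TC K from sandwich S R A)‖ ≤ ‖S‖ * ‖R‖ * ‖A‖ := by
  have hb : ∀ x y, IsNuclearDecomp (op A) x y →
      traceNorm (op (show TC K from sandwich S R A)) ≤ ‖S‖ * ‖R‖ * ∑' n, ‖x n‖ * ‖y n‖ := by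
    intro x y h
    refine (h.sandwich S R).traceNorm_le.trans ?_
    rw [← tsum_mul_left]
    refine (h.sandwich S R).1.tsum_le_tsum (fun n => ?_) (h.1.mul_left _)
    calc ‖S (x n)‖ * ‖ContinuousLinearMap.adjoint R (y n)‖
        ≤ (‖S‖ * ‖x n‖) * (‖ContinuousLinearMap.adjoint R‖ * ‖y n‖) := by
          gcongr <;> exact ContinuousLinearMap.le_opNorm _ _
      _ = _ := by rw [LinearIsometryEquiv.norm_map]; ring
  rw [norm_def]
  rcases (mul_nonneg (norm_nonneg S) (norm_nonneg R)).eq_or_lt with h0 | h0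
  · obtain ⟨x, y, h⟩ := A.2
    have := hb x y h
    rw [← h0] at this ⊢
    simpa using this
  · rw [← div_le_iff₀' h0]
    refine le_traceNorm A.2 fun x y h => ?_
    rw [div_le_iff₀' h0]
    exact hb x y h

/-- The bounded map `ρ ↦ S ρ R` between trace-class operators. -/
def sandwichL (S : H →L[ℂ] K) (R : K →L[ℂ] H) : TC H →L[ℂ] TC K :=
  LinearMap.mkContinuous (show TC H →ₗ[ℂ] TC K from sandwich S R) (‖S‖ * ‖R‖)
    (norm_sandwich_le S R)

@[simp] theorem op_sandwichL (S : H →L[ℂ] K) (R : K →L[ℂ] H) (A : TC H) :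
    op (sandwichL S R A) = S ∘L op A ∘L R := rfl

theorem sandwichL_rankOne (S : H →L[ℂ] K) (R : K →L[ℂ] H) (x y : H) :
    sandwichL S R (rankOne x y) = rankOne (S x) (ContinuousLinearMap.adjoint R y) := by
  refine op_injective ?_
  ext v
  simp [ContinuousLinearMap.adjoint_inner_left]

end TC

/-! ### The trace as a bounded functional on the trace-class operators of the Fock space. -/

theorem orthonormal_basis_fock : Orthonormal ℂ fun n : ℕ => (lp.single 2 n (1 : ℂ) : Fock) := by
  rw [orthonormal_iff_ite]
  exact inner_basis

namespace TC

theorem apply_basis_eq_inner (A : Fock →L[ℂ] Fock) (n : ℕ) :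
    A (lp.single 2 n (1 : ℂ)) n = ⟪(lp.single 2 n (1 : ℂ) : Fock), A (lp.single 2 n (1 : ℂ))⟫ := by
  rw [lp.inner_single_left]
  simp

theorem sum_norm_diag_le (A : TC Fock) (S : Finset ℕ) :
    ∑ n ∈ S, ‖op A (lp.single 2 n (1 : ℂ)) n‖ ≤ ‖A‖ := by
  simp only [apply_basis_eq_inner]
  exact sum_norm_inner_le orthonormal_basis_fock orthonormal_basis_fock S A

theorem summable_norm_diag (A : TC Fock) :
    Summable fun n => ‖op A (lp.single 2 n (1 : ℂ)) n‖ :=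
  summable_of_sum_le (fun _ => norm_nonneg _) (sum_norm_diag_le A)

/-- The trace as a bounded functional. -/
def traceL : TC Fock →L[ℂ] ℂ :=
  LinearMap.mkContinuous
    { toFun := fun A => trace (op A)
      map_add' := fun A B => by
        simp only [trace]
        rw [← (summable_norm_diag A).of_norm.tsum_add (summable_norm_diag B).of_norm]
        simp
      map_smul' := fun c A => by
        simp only [trace, RingHom.id_apply]
        rw [← (summable_norm_diag A).of_norm.tsum_const_smul c]
        simp } 1 fun A => by
    rw [one_mul]
    refine (norm_tsum_le_tsum_norm (summable_norm_diag A)).trans ?_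
    exact (summable_norm_diag A).tsum_le_of_sum_le (sum_norm_diag_le A)

theorem traceL_apply (A : TC Fock) : traceL A = trace (op A) := rfl

theorem traceL_rankOne (x y : Fock) : traceL (rankOne x y) = ⟪y, x⟫ := by
  rw [traceL_apply, ← (lp.hasSum_inner y x).tsum_eq, trace]
  refine tsum_congr fun n => ?_
  simp [lp.inner_single_right, mul_comm]

/-- `ρ ↦ B ρ`. -/
def mulL (B : Fock →L[ℂ] Fock) : TC Fock →L[ℂ] TC Fock :=
  sandwichL B (ContinuousLinearMap.id ℂ Fock)

theorem op_mulL (B : Fock →L[ℂ] Fock) (A : TC Fock) : op (mulL B A) = B ∘L op A := rfl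

theorem mulL_rankOne (B : Fock →L[ℂ] Fock) (x y : Fock) :
    mulL B (rankOne x y) = rankOne (B x) y := by
  refine op_injective ?_
  ext v
  simp [op_mulL]

theorem norm_traceL_mulL_le (B : Fock →L[ℂ] Fock) (A : TC Fock) :
    ‖traceL (mulL B A)‖ ≤ ‖B‖ * ‖A‖ := by
  have h1 : ‖traceL (mulL B A)‖ ≤ 1 * ‖mulL B A‖ :=
    traceL.le_of_opNorm_le (LinearMap.mkContinuous_norm_le _ zero_le_one _) _
  have h2 : ‖mulL B A‖ ≤ ‖B‖ * ‖ContinuousLinearMap.id ℂ Fock‖ * ‖A‖ := norm_sandwich_le _ _ A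
  have h3 : ‖ContinuousLinearMap.id ℂ Fock‖ ≤ 1 := ContinuousLinearMap.norm_id_le
  rw [one_mul] at h1
  refine h1.trans (h2.trans ?_)
  gcongr
  exact mul_le_of_le_one_right (norm_nonneg _) h3

end TC

end TraceNorm

/-! ### Dissipativity of Lindblad generators for the trace norm. -/

section Dissipative

variable {H : Type*} [NormedAddCommGroup H] [InnerProductSpace ℂ H] [CompleteSpace H]
variable {V : Type*} [AddCommGroup V] [Module ℂ V]

/-- The sesquilinear map `(φ, ψ) ↦ |ι φ⟩⟨ι ψ|`. -/
def dyadForm (ι : V →ₗ[ℂ] H) : V →ₗ[ℂ] V →ₗ⋆[ℂ] TC H :=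
  LinearMap.mk₂'ₛₗ (RingHom.id ℂ) (starRingEnd ℂ) (fun φ ψ => TC.rankOne (ι φ) (ι ψ))
    (fun φ φ' ψ => by rw [map_add, TC.rankOne_add_left])
    (fun c φ ψ => by rw [map_smul, TC.rankOne_smul_left]; rfl)
    (fun φ ψ ψ' => by rw [map_add, TC.rankOne_add_right])
    (fun c φ ψ => by rw [map_smul, TC.rankOne_smul_right])

@[simp] theorem dyadForm_apply (ι : V →ₗ[ℂ] H) (φ ψ : V) :
    dyadForm ι φ ψ = TC.rankOne (ι φ) (ι ψ) := rfl

/-- The sesquilinear map `(φ, ψ) ↦ |G φ⟩⟨ψ| + |φ⟩⟨G ψ| + |K φ⟩⟨K ψ|`. -/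
def lindForm (ι G K : V →ₗ[ℂ] H) : V →ₗ[ℂ] V →ₗ⋆[ℂ] TC H :=
  LinearMap.mk₂'ₛₗ (RingHom.id ℂ) (starRingEnd ℂ)
    (fun φ ψ => TC.rankOne (G φ) (ι ψ) + TC.rankOne (ι φ) (G ψ) + TC.rankOne (K φ) (K ψ))
    (fun φ φ' ψ => by simp only [map_add, TC.rankOne_add_left]; abel)
    (fun c φ ψ => by simp only [map_smul, TC.rankOne_smul_left, smul_add]; rfl)
    (fun φ ψ ψ' => by simp only [map_add, TC.rankOne_add_right]; abel)
    (fun c φ ψ => by simp only [map_smul, TC.rankOne_smul_right, smul_add])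

theorem lindForm_apply (ι G K : V →ₗ[ℂ] H) (φ ψ : V) : lindForm ι G K φ ψ =
    TC.rankOne (G φ) (ι ψ) + TC.rankOne (ι φ) (G ψ) + TC.rankOne (K φ) (K ψ) := rfl

/-- The pairing of an operator with the partial isometry `∑ |v b⟩⟨u b|`. -/
def pairing {J : Type*} [Fintype J] (u v : J → H) : TC H →ₗ[ℂ] ℂ where
  toFun X := ∑ a, ⟪u a, TC.op X (v a)⟫
  map_add' X Y := by simp [Finset.sum_add_distrib]
  map_smul' c X := by simp [Finset.mul_sum]

theorem norm_pairing_le {J : Type*} [Fintype J] {u v : J → H} (hu : Orthonormal ℂ u)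
    (hv : Orthonormal ℂ v) (X : TC H) : ‖pairing u v X‖ ≤ ‖X‖ :=
  (norm_sum_le _ _).trans (TC.sum_norm_inner_le hu hv Finset.univ X)

theorem pairing_rankOne {J : Type*} [Fintype J] (u v : J → H) (x y : H) :
    pairing u v (TC.rankOne x y) = ∑ a, ⟪u a, x⟫ * ⟪y, v a⟫ := by
  simp [pairing, mul_comm]

theorem pairing_rankOne_right {J : Type*} [Fintype J] {u v : J → H} (hv : Orthonormal ℂ v)
    (x : H) (b : J) : pairing u v (TC.rankOne x (v b)) = ⟪u b, x⟫ := by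
  classical
  rw [pairing_rankOne]
  simp [orthonormal_iff_ite.1 hv]

theorem pairing_rankOne_left {J : Type*} [Fintype J] {u v : J → H} (hu : Orthonormal ℂ u)
    (y : H) (b : J) : pairing u v (TC.rankOne (u b) y) = ⟪y, v b⟫ := by
  classical
  rw [pairing_rankOne]
  simp [orthonormal_iff_ite.1 hu]

/-- The sum X = ∑ s_b |u_b⟩⟨v_b| is in singular value form. The pairing is a functional of norm at
most one that takes the value ∑ s_b, hence at least ‖X‖, at X, while its real part on the image of X
under the generator is nonpositive; subtracting h times that image cannot lower the pairing. -/
theorem norm_le_of_orthonormal {ι G K : V →ₗ[ℂ] H}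
    (hd : ∀ v, 2 * (⟪ι v, G v⟫).re + ‖K v‖ ^ 2 ≤ 0) {J : Type*} [Fintype J] {u v : J → V}
    (hu : Orthonormal ℂ (ι ∘ u)) (hv : Orthonormal ℂ (ι ∘ v)) {s : J → ℝ} (hs : ∀ b, 0 ≤ s b)
    {h : ℝ} (hh : 0 ≤ h) :
    ‖∑ b, (s b : ℂ) • dyadForm ι (u b) (v b)‖ ≤
      ‖∑ b, (s b : ℂ) • dyadForm ι (u b) (v b) -
        (h : ℂ) • ∑ b, (s b : ℂ) • lindForm ι G K (u b) (v b)‖ := by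
  have h1 : ‖∑ b, (s b : ℂ) • dyadForm ι (u b) (v b)‖ ≤ ∑ b, s b := by
    refine (norm_sum_le _ _).trans (Finset.sum_le_sum fun b _ => ?_)
    rw [norm_smul, Complex.norm_real, Real.norm_of_nonneg (hs b)]
    refine mul_le_of_le_one_right (hs b) ((TC.norm_rankOne_le _ _).trans (le_of_eq ?_))
    have e1 : ‖ι (u b)‖ = 1 := hu.1 b
    have e2 : ‖ι (v b)‖ = 1 := hv.1 b
    rw [e1, e2, one_mul]
  refine h1.trans (le_trans ?_ (norm_pairing_le hu hv _))
  refine le_trans ?_ (Complex.re_le_norm _)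
  have e1 : ∀ b, pairing (ι ∘ u) (ι ∘ v) (dyadForm ι (u b) (v b)) = 1 := fun b => by
    rw [dyadForm_apply]
    refine (pairing_rankOne_right hv (ι (u b)) b).trans ?_
    have e1 : ‖ι (u b)‖ = 1 := hu.1 b
    simp [inner_self_eq_norm_sq_to_K, e1]
  -- The drift terms give Re⟨u, Gu⟩ + Re⟨v, Gv⟩ ≤ -(‖Ku‖² + ‖Kv‖²)/2, and the jump term contributes
  -- at most ‖Ku‖ ‖Kv‖; the sum is at most -(‖Ku‖ - ‖Kv‖)²/2.
  have e2 : ∀ b, (pairing (ι ∘ u) (ι ∘ v) (lindForm ι G K (u b) (v b))).re ≤ 0 := fun b => by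
    rw [lindForm_apply, map_add, map_add, Complex.add_re, Complex.add_re]
    have a1 := pairing_rankOne_right (u := ι ∘ u) hv (G (u b)) b
    have a2 := pairing_rankOne_left (v := ι ∘ v) hu (G (v b)) b
    have a3 := (Complex.re_le_norm _).trans ((norm_pairing_le hu hv _).trans
      (TC.norm_rankOne_le (K (u b)) (K (v b))))
    simp only [Function.comp_apply] at a1 a2
    rw [a1, a2]
    have a4 : (⟪G (v b), ι (v b)⟫).re = (⟪ι (v b), G (v b)⟫).re := inner_re_symm (𝕜 := ℂ) _ _
    have a5 := hd (u b)
    have a6 := hd (v b)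
    nlinarith [sq_nonneg (‖K (u b)‖ - ‖K (v b)‖)]
  simp only [map_sub, map_sum, map_smul, e1, smul_eq_mul, mul_one, Complex.sub_re, Complex.re_sum,
    Complex.ofReal_re, Complex.re_ofReal_mul]
  have : ∑ b, s b * (pairing (ι ∘ u) (ι ∘ v) (lindForm ι G K (u b) (v b))).re ≤ 0 :=
    Finset.sum_nonpos fun b _ => mul_nonpos_of_nonneg_of_nonpos (hs b) (e2 b)
  nlinarith

/-- The Lindblad generator is dissipative for the trace norm. -/
theorem norm_sum_dyadForm_le {ι G K : V →ₗ[ℂ] H} (hι : Function.Injective ι)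
    (hd : ∀ v, 2 * (⟪ι v, G v⟫).re + ‖K v‖ ^ 2 ≤ 0) {I : Type*} (S : Finset I) (φ ψ : I → V)
    {h : ℝ} (hh : 0 ≤ h) :
    ‖∑ i ∈ S, dyadForm ι (φ i) (ψ i)‖ ≤
      ‖∑ i ∈ S, dyadForm ι (φ i) (ψ i) - (h : ℂ) • ∑ i ∈ S, lindForm ι G K (φ i) (ψ i)‖ := by
  classical
  set F : Submodule ℂ H := Submodule.span ℂ ((S.image fun i => ι (ψ i) : Finset H) : Set H) with hF
  have hFι : F ≤ LinearMap.range ι := by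
    rw [hF, Submodule.span_le]
    intro x hx
    obtain ⟨i, -, rfl⟩ := Finset.mem_image.1 (Finset.mem_coe.1 hx)
    exact ⟨_, rfl⟩
  have hψF : ∀ i ∈ S, ι (ψ i) ∈ F := fun i hi =>
    Submodule.subset_span (Finset.mem_coe.2 (Finset.mem_image_of_mem _ hi))
  have : FiniteDimensional ℂ F := FiniteDimensional.span_finset ℂ _
  have : CompleteSpace F := FiniteDimensional.complete ℂ F
  -- Singular value decomposition of X, restricted to the finite-dimensional span `F` of the right
  -- vectors: the eigenvectors of R*R are the right singular vectors, and their images under R are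
  -- orthogonal. Both families come from vectors of `V`, where `G` and `K` are defined.
  set R : F →L[ℂ] H := TC.op (∑ i ∈ S, dyadForm ι (φ i) (ψ i)) ∘L F.subtypeL with hR
  set T : F →L[ℂ] F := ContinuousLinearMap.adjoint R ∘L R with hT
  have hsym : (T : F →ₗ[ℂ] F).IsSymmetric := fun x y => by
    change ⟪ContinuousLinearMap.adjoint R (R x), y⟫ = ⟪x, ContinuousLinearMap.adjoint R (R y)⟫
    rw [ContinuousLinearMap.adjoint_inner_left, ContinuousLinearMap.adjoint_inner_right]
  set n := Module.finrank ℂ F with hn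
  set v := hsym.eigenvectorBasis (n := n) rfl with hv
  choose ν hν using fun b => hFι (v b).2
  set η : Fin n → V := fun b => ∑ i ∈ S, ⟪ι (ψ i), (v b : H)⟫ • φ i with hη
  have hιη : ∀ b, ι (η b) = R (v b) := fun b => by
    simp [hη, hR]
  have horth : ∀ a b, a ≠ b → ⟪ι (η a), ι (η b)⟫ = 0 := fun a b hab => by
    rw [hιη, hιη, ← ContinuousLinearMap.adjoint_inner_right]
    have h1 : ContinuousLinearMap.adjoint R (R (v b)) = (hsym.eigenvalues rfl b : ℂ) • v b :=
      hsym.apply_eigenvectorBasis rfl b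
    rw [h1, inner_smul_right, v.orthonormal.2 hab, mul_zero]
  have hexp : ∀ i ∈ S, ψ i = ∑ b, ⟪(v b : H), ι (ψ i)⟫ • ν b := fun i hi => by
    apply hι
    have h1 := congrArg (F.subtype) (v.sum_repr' ⟨ι (ψ i), hψF i hi⟩)
    rw [map_sum] at h1
    rw [map_sum]
    simp only [map_smul, hν] at h1 ⊢
    exact h1.symm
  -- The rewriting is done in `V` and for every sesquilinear form, so that it applies to X and to
  -- its image under the generator alike.
  have key : ∀ B : V →ₗ[ℂ] V →ₗ⋆[ℂ] TC H, ∑ i ∈ S, B (φ i) (ψ i) = ∑ b, B (η b) (ν b) := by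
    intro B
    have h1 : ∀ i ∈ S, B (φ i) (ψ i) = ∑ b, ⟪ι (ψ i), (v b : H)⟫ • B (φ i) (ν b) := fun i hi => by
      conv_lhs => rw [hexp i hi]
      rw [map_sum]
      refine Finset.sum_congr rfl fun b _ => ?_
      rw [LinearMap.map_smulₛₗ]
      congr 1
      exact inner_conj_symm _ _
    rw [Finset.sum_congr rfl h1, Finset.sum_comm]
    refine Finset.sum_congr rfl fun b _ => ?_
    simp [hη, map_sum, LinearMap.sum_apply]
  -- Zero singular values are dropped so that the left vectors can be normalized; `s` lists the
  -- others.
  set J := {b : Fin n // η b ≠ 0}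
  set s : J → ℝ := fun b => ‖ι (η b.1)‖ with hs
  have hs0 : ∀ b : J, s b ≠ 0 := fun b => by
    rw [hs, Ne, norm_eq_zero, ← map_zero ι]
    exact fun h0 => b.2 (hι h0)
  set u : J → V := fun b => ((s b : ℂ))⁻¹ • η b.1 with hu
  have key2 : ∀ B : V →ₗ[ℂ] V →ₗ⋆[ℂ] TC H,
      ∑ i ∈ S, B (φ i) (ψ i) = ∑ b : J, (s b : ℂ) • B (u b) (ν b.1) := by
    intro B
    rw [key B]
    have h1 : ∑ b, B (η b) (ν b) = ∑ b : J, B (η b.1) (ν b.1) := by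
      rw [← Finset.sum_subtype (Finset.univ.filter fun b => η b ≠ 0) (by simp)
        (fun b => B (η b) (ν b)), Finset.sum_filter_of_ne]
      intro b _ hb h0
      exact hb (by simp [h0])
    rw [h1]
    refine Finset.sum_congr rfl fun b _ => ?_
    have h2 : η b.1 = (s b : ℂ) • u b := by
      rw [hu, smul_inv_smul₀]
      exact_mod_cast hs0 b
    conv_lhs => rw [h2]
    simp
  have hou : Orthonormal ℂ (ι ∘ u) := by
    constructor
    · intro b
      simp only [Function.comp_apply, hu, map_smul, norm_smul, norm_inv, Complex.norm_real]
      rw [Real.norm_of_nonneg (norm_nonneg _)]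
      exact inv_mul_cancel₀ (hs0 b)
    · intro a b hab
      simp only [Function.comp_apply, hu, map_smul, inner_smul_left, inner_smul_right]
      rw [horth a.1 b.1 (fun h => hab (Subtype.ext h)), mul_zero, mul_zero]
  have hov : Orthonormal ℂ (ι ∘ fun b : J => ν b.1) := by
    have h1 : (ι ∘ fun b : J => ν b.1) = fun b : J => F.subtypeₗᵢ (v b.1) := by
      funext b
      exact hν b.1
    rw [h1]
    exact (v.orthonormal.comp_linearIsometry F.subtypeₗᵢ).comp _ Subtype.val_injective
  rw [key2, key2]
  exact norm_le_of_orthonormal hd hou hov (fun b => norm_nonneg _) hh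

end Dissipative

/-- A solution of `u' = L u` with dissipative `L` has nonincreasing norm. -/
theorem norm_le_of_dissipative {E : Type*} [NormedAddCommGroup E] [NormedSpace ℝ E]
    {u u' : ℝ → E} {T : ℝ} (hT : 0 ≤ T) (hu : ∀ t, HasDerivAt u (u' t) t)
    (hd : ∀ t, ∀ h : ℝ, 0 ≤ h → ‖u t‖ ≤ ‖u t - h • u' t‖) : ‖u T‖ ≤ ‖u 0‖ := by
  have hc : Continuous u := continuous_iff_continuousAt.2 fun t => (hu t).continuousAt
  -- Dissipativity compares u(t) with u(t) - h u'(t), which is u(t - h) up to o(h): a backward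
  -- difference. Reversing time turns it into the bound on right-hand slopes that the comparison
  -- theorem needs.
  have key := image_le_of_liminf_slope_right_le_deriv_boundary (f := fun s => -‖u (T - s)‖)
    (a := 0) (b := T) (B := fun _ => -‖u T‖) (B' := fun _ => 0)
    (by fun_prop) (by simp) (by fun_prop) (fun x _ => hasDerivWithinAt_const _ _ _) ?_
    (Set.right_mem_Icc.2 hT)
  · simpa using key
  intro x _ r hr
  refine Eventually.frequently ?_
  have h1 := (hu (T - x)).isLittleO.def (half_pos hr)
  have h2 : Tendsto (fun z : ℝ => T - z) (𝓝[>] x) (𝓝 (T - x)) :=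
    ((continuous_const.sub continuous_id).tendsto x).mono_left nhdsWithin_le_nhds
  filter_upwards [h2.eventually h1, self_mem_nhdsWithin] with z hz hzx
  have hzx' : 0 < z - x := sub_pos.2 hzx
  rw [slope_def_field, div_lt_iff₀ hzx']
  have h3 := hd (T - x) (z - x) hzx'.le
  have e1 : T - z - (T - x) = -(z - x) := by ring
  rw [e1, norm_neg, Real.norm_of_nonneg hzx'.le, neg_smul] at hz
  have h4 : ‖u (T - x) - (z - x) • u' (T - x)‖ ≤ ‖u (T - z)‖ + r / 2 * (z - x) := by
    have e2 : u (T - x) - (z - x) • u' (T - x) =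
        u (T - z) - (u (T - z) - u (T - x) - -((z - x) • u' (T - x))) := by abel
    rw [e2]
    exact (norm_sub_le _ _).trans (by linarith)
  nlinarith

/-! ## The domain of the photon number operator -/

theorem memℓp_two_iff {f : ℕ → ℂ} : Memℓp f 2 ↔ Summable fun n => ‖f n‖ ^ 2 := by
  rw [memℓp_gen_iff (by norm_num)]
  simp

theorem summable_norm_sq (f : Fock) : Summable fun n => ‖f n‖ ^ 2 := memℓp_two_iff.1 (lp.memℓp f)

theorem hasSum_norm_sq (f : Fock) : HasSum (fun n => ‖f n‖ ^ 2) (‖f‖ ^ 2) := by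
  have := lp.hasSum_norm (p := 2) (by norm_num) f
  simpa using this

/-- The domain of the photon number operator. -/
def numberDomain : Submodule ℂ Fock where
  carrier := {f | Memℓp (fun n : ℕ => (n : ℂ) * f n) 2}
  zero_mem' := by
    refine (congrArg (fun h => Memℓp h 2) ?_).mp (zero_memℓp (E := fun _ : ℕ => ℂ) (p := 2))
    funext n
    simp
  add_mem' := by
    intro f g hf hg
    have := Memℓp.add hf hg
    refine (congrArg (fun h => Memℓp h 2) ?_).mp this
    funext n
    simp [mul_add]
  smul_mem' := by
    intro c f hf
    have := Memℓp.const_smul hf c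
    refine (congrArg (fun h => Memℓp h 2) ?_).mp this
    funext n
    simp
    ring

namespace numberDomain

theorem summable_number (f : numberDomain) : Summable fun n : ℕ => ‖(n : ℂ) * f.1 n‖ ^ 2 :=
  memℓp_two_iff.1 f.2

theorem sqrt_factor_sq (n : ℕ) (c : ℂ) : ‖(Real.sqrt n : ℂ) * c‖ ^ 2 = n * ‖c‖ ^ 2 := by
  rw [norm_mul, mul_pow, Complex.norm_real, Real.norm_of_nonneg (Real.sqrt_nonneg _),
    Real.sq_sqrt (Nat.cast_nonneg n)]

theorem summable_nat_mul (f : numberDomain) : Summable fun n : ℕ => (n : ℝ) * ‖f.1 n‖ ^ 2 := by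
  refine Summable.of_nonneg_of_le (fun n => by positivity) (fun n => ?_) (summable_number f)
  rw [norm_mul, mul_pow, Complex.norm_natCast]
  gcongr
  rcases n with _ | n
  · simp
  · rw [sq]
    refine le_mul_of_one_le_left (by positivity) ?_
    push_cast
    linarith [(Nat.cast_nonneg n : (0 : ℝ) ≤ n)]

theorem memℓp_annih (f : numberDomain) :
    Memℓp (fun n : ℕ => (Real.sqrt ((n + 1 : ℕ) : ℝ) : ℂ) * f.1 (n + 1)) 2 := by
  rw [memℓp_two_iff]
  simp only [sqrt_factor_sq]
  exact (summable_nat_add_iff 1).2 (summable_nat_mul f)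

theorem memℓp_creat (f : numberDomain) :
    Memℓp (fun n : ℕ => (Real.sqrt n : ℂ) * f.1 (n - 1)) 2 := by
  rw [memℓp_two_iff]
  simp only [sqrt_factor_sq]
  rw [← summable_nat_add_iff 1]
  simpa [add_mul] using (summable_nat_mul f).add (summable_norm_sq f.1)

/-- The photon number operator. -/
def num : numberDomain →ₗ[ℂ] Fock where
  toFun f := ⟨fun n : ℕ => (n : ℂ) * f.1 n, f.2⟩
  map_add' _ _ := lp.ext (funext fun _ => mul_add _ _ _)
  map_smul' _ _ := lp.ext (funext fun _ => mul_left_comm _ _ _)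

/-- The annihilation operator on the domain of the number operator. -/
def ann : numberDomain →ₗ[ℂ] Fock where
  toFun f := ⟨fun n : ℕ => (Real.sqrt ((n + 1 : ℕ) : ℝ) : ℂ) * f.1 (n + 1), memℓp_annih f⟩
  map_add' _ _ := lp.ext (funext fun _ => mul_add _ _ _)
  map_smul' _ _ := lp.ext (funext fun _ => mul_left_comm _ _ _)

/-- The creation operator on the domain of the number operator. -/
def cre : numberDomain →ₗ[ℂ] Fock where
  toFun f := ⟨fun n : ℕ => (Real.sqrt n : ℂ) * f.1 (n - 1), memℓp_creat f⟩
  map_add' _ _ := lp.ext (funext fun _ => mul_add _ _ _)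
  map_smul' _ _ := lp.ext (funext fun _ => mul_left_comm _ _ _)

theorem num_apply (f : numberDomain) (n : ℕ) : num f n = (n : ℂ) * f.1 n := rfl

theorem ann_apply (f : numberDomain) (n : ℕ) :
    ann f n = (Real.sqrt ((n + 1 : ℕ) : ℝ) : ℂ) * f.1 (n + 1) := rfl

theorem cre_apply (f : numberDomain) (n : ℕ) : cre f n = (Real.sqrt n : ℂ) * f.1 (n - 1) := rfl

theorem hasSum_norm_ann (f : numberDomain) :
    HasSum (fun n : ℕ => (n : ℝ) * ‖f.1 n‖ ^ 2) (‖ann f‖ ^ 2) := by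
  have h := hasSum_norm_sq (ann f)
  simp only [ann_apply, sqrt_factor_sq] at h
  have h2 := (hasSum_nat_add_iff (f := fun n : ℕ => (n : ℝ) * ‖f.1 n‖ ^ 2) 1).1 h
  simpa using h2

theorem hasSum_inner' (f g : Fock) : HasSum (fun n => conj (f n) * g n) ⟪f, g⟫ := by
  have h := lp.hasSum_inner (𝕜 := ℂ) f g
  refine h.congr_fun fun n => ?_
  simp [mul_comm]

theorem inner_num (f : numberDomain) : ⟪f.1, num f⟫ = ((‖ann f‖ ^ 2 : ℝ) : ℂ) := by
  refine (hasSum_inner' f.1 (num f)).unique ?_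
  have h2 := (hasSum_norm_ann f).mapL Complex.ofRealCLM
  refine h2.congr_fun fun n => ?_
  simp [num_apply, ← Complex.conj_mul']
  ring

theorem inner_cre (f g : numberDomain) : ⟪f.1, cre g⟫ = ⟪ann f, g.1⟫ := by
  have h := hasSum_inner' (ann f) g.1
  refine (hasSum_inner' f.1 (cre g)).unique ?_
  rw [← hasSum_nat_add_iff' 1]
  simp only [Finset.range_one, Finset.sum_singleton, cre_apply, Nat.cast_zero, Real.sqrt_zero,
    Complex.ofReal_zero, zero_mul, mul_zero, sub_zero]
  refine h.congr_fun fun n => ?_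
  simp [ann_apply]
  ring

/-- The commutation relation b b* = b* b + 1 in the form of an identity of norms. -/
theorem norm_cre_sq (f : numberDomain) : ‖cre f‖ ^ 2 = ‖ann f‖ ^ 2 + ‖f.1‖ ^ 2 := by
  refine (hasSum_norm_sq (cre f)).unique ?_
  rw [← hasSum_nat_add_iff' 1]
  simp only [Finset.range_one, Finset.sum_singleton, cre_apply, sqrt_factor_sq, Nat.cast_zero,
    zero_mul, sub_zero]
  refine ((hasSum_norm_ann f).add (hasSum_norm_sq f.1)).congr_fun fun n => ?_
  simp
  ring

/-- Cauchy-Schwarz in ⟨f, b*b f⟩ = ‖b f‖². It makes `ann`, and by `norm_cre_sq` also `cre`,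
continuous in the graph norm of `num`. -/
theorem norm_ann_sq_le (f : numberDomain) : ‖ann f‖ ^ 2 ≤ ‖f.1‖ * ‖num f‖ := by
  have h := norm_inner_le_norm (𝕜 := ℂ) f.1 (num f)
  rwa [inner_num, Complex.norm_real, Real.norm_of_nonneg (by positivity)] at h

/-- Convergence in the graph norm of the number operator. -/
theorem tendsto_ann {ι : Type*} {l : Filter ι} {u : ι → numberDomain} {f : numberDomain}
    (h1 : Tendsto (fun i => (u i).1) l (𝓝 f.1)) (h2 : Tendsto (fun i => num (u i)) l (𝓝 (num f))) :
    Tendsto (fun i => ann (u i)) l (𝓝 (ann f)) ∧ Tendsto (fun i => cre (u i)) l (𝓝 (cre f)) := by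
  rw [tendsto_iff_norm_sub_tendsto_zero] at h1 h2
  have ha : Tendsto (fun i => ‖ann (u i - f)‖ ^ 2) l (𝓝 0) := by
    refine squeeze_zero (fun _ => by positivity) (fun i => norm_ann_sq_le (u i - f)) ?_
    simpa [map_sub] using h1.mul h2
  have hc : Tendsto (fun i => ‖cre (u i - f)‖ ^ 2) l (𝓝 0) := by
    simp only [norm_cre_sq]
    simpa using ha.add (h1.pow 2)
  have hsq : ∀ {w : ι → Fock}, Tendsto (fun i => ‖w i‖ ^ 2) l (𝓝 0) →
      Tendsto (fun i => ‖w i‖) l (𝓝 0) := fun {w} hw => by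
    have := (Real.continuous_sqrt.tendsto 0).comp hw
    simpa [Function.comp_def, Real.sqrt_sq] using this
  constructor
  · rw [tendsto_iff_norm_sub_tendsto_zero]
    simpa only [map_sub] using hsq ha
  · rw [tendsto_iff_norm_sub_tendsto_zero]
    simpa only [map_sub] using hsq hc

end numberDomain

/-! ### Finite-photon vectors in the domain -/

theorem toFock_apply (φ : FinVec) (n : ℕ) : toFock φ n = φ n := by
  induction φ using Finsupp.induction_linear with
  | zero => simp
  | add f g hf hg =>
    rw [map_add, lp.coeFn_add, Pi.add_apply, hf, hg, Finsupp.add_apply]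
  | single m c =>
    rw [toFock_single, lp.coeFn_smul, Pi.smul_apply, lp.single_apply]
    by_cases h : m = n
    · subst h; simp
    · simp [Ne.symm h]

theorem toFock_mem (φ : FinVec) : toFock φ ∈ numberDomain := by
  refine memℓp_two_iff.2 (summable_of_ne_finset_zero (s := φ.support) fun n hn => ?_)
  simp [toFock_apply, Finsupp.notMem_support_iff.1 hn]

/-- The inclusion of the finite-photon vectors in the domain of the number operator. -/
def finD : FinVec →ₗ[ℂ] numberDomain := toFock.codRestrict numberDomain toFock_mem

@[simp] theorem coe_finD (φ : FinVec) : (finD φ).1 = toFock φ := rfl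

theorem annih_apply (φ : FinVec) (n : ℕ) :
    annih φ n = (Real.sqrt ((n + 1 : ℕ) : ℝ) : ℂ) * φ (n + 1) := by
  induction φ using Finsupp.induction_linear with
  | zero => simp
  | add f g hf hg => rw [map_add, Finsupp.add_apply, hf, hg, Finsupp.add_apply, mul_add]
  | single m c =>
    rw [annih_single]
    rcases m with _ | m
    · simp
    · by_cases h : m = n
      · subst h; simp [mul_comm]
      · simp [h]

theorem creat_apply (φ : FinVec) (n : ℕ) :
    creat φ n = (Real.sqrt n : ℂ) * φ (n - 1) := by
  induction φ using Finsupp.induction_linear with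
  | zero => simp
  | add f g hf hg => rw [map_add, Finsupp.add_apply, hf, hg, Finsupp.add_apply, mul_add]
  | single m c =>
    rw [creat_single]
    rcases n with _ | n
    · simp
    · by_cases h : m = n
      · subst h; simp [mul_comm]
      · simp [h]

theorem ann_finD (φ : FinVec) : numberDomain.ann (finD φ) = toFock (annih φ) := by
  ext n
  rw [numberDomain.ann_apply, toFock_apply, annih_apply, coe_finD, toFock_apply]

theorem cre_finD (φ : FinVec) : numberDomain.cre (finD φ) = toFock (creat φ) := by
  ext n
  rw [numberDomain.cre_apply, toFock_apply, creat_apply, coe_finD, toFock_apply]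

theorem num_finD (φ : FinVec) : numberDomain.num (finD φ) = toFock (creat (annih φ)) := by
  ext n
  rw [numberDomain.num_apply, toFock_apply, creat_apply, annih_apply, coe_finD, toFock_apply]
  rcases n with _ | n
  · simp
  · rw [Nat.add_sub_cancel, ← mul_assoc, ← Complex.ofReal_mul,
      Real.mul_self_sqrt (Nat.cast_nonneg _)]
    simp

/-- The expansion in number states converges in the graph norm of the number operator. -/
theorem hasSum_coe_finD (f : Fock) :
    HasSum (fun n => (f n • finD (Finsupp.single n 1)).1) f := by
  refine (lp.hasSum_single (p := 2) (by norm_num) f).congr_fun fun n => ?_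
  rw [Submodule.coe_smul, coe_finD, toFock_single, one_smul, ← lp.single_smul]
  simp

theorem hasSum_num_finD (f : numberDomain) :
    HasSum (fun n => numberDomain.num (f.1 n • finD (Finsupp.single n 1))) (numberDomain.num f) := by
  refine (lp.hasSum_single (p := 2) (by norm_num) (numberDomain.num f)).congr_fun fun n => ?_
  ext m
  rw [map_smul, num_finD, annih_single, creat_single, toFock_single, numberDomain.num_apply]
  rcases n with _ | n
  · simp
  · simp only [lp.coeFn_smul, Pi.smul_apply, lp.single_apply, Nat.add_sub_cancel, one_mul,
      smul_eq_mul]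
    rw [← Nat.cast_succ, ← Complex.ofReal_mul, Real.mul_self_sqrt (Nat.cast_nonneg _)]
    by_cases h : m = n + 1
    · subst h; simp; ring
    · simp [h]

/-! ### Exponential vectors -/

/-- This is `summable_weylBound` at m = 0: the product of square roots is √n!, and √n!/n! = 1/√n!.
-/
theorem summable_pow_div_sqrt (a : ℝ) (ha : 0 ≤ a) :
    Summable fun n : ℕ => a ^ n / Real.sqrt n.factorial := by
  have h := summable_weylBound a ha 0
  refine h.congr fun n => ?_
  have e : ∏ i ∈ Finset.range n, Real.sqrt (((0 : ℕ) : ℝ) + i + 1) = Real.sqrt n.factorial := by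
    induction n with
    | zero => simp
    | succ n ih =>
      rw [Finset.prod_range_succ, ih, ← Real.sqrt_mul (by positivity), Nat.factorial_succ]
      push_cast
      ring_nf
  rw [e]
  have h0 : (0 : ℝ) < n.factorial := by positivity
  have h1 : Real.sqrt n.factorial ≠ 0 := (Real.sqrt_pos.2 h0).ne'
  have h2 : (n.factorial : ℝ) = Real.sqrt n.factorial * Real.sqrt n.factorial :=
    (Real.mul_self_sqrt h0.le).symm
  field_simp
  rw [sq, ← h2, mul_comm]

/-- The coefficients of the exponential vectors. -/
def expCoeff (z : ℂ) (n : ℕ) : ℂ := z ^ n / (Real.sqrt n.factorial : ℂ)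

theorem norm_expCoeff_sq (z : ℂ) (n : ℕ) :
    ‖expCoeff z n‖ ^ 2 = (‖z‖ ^ 2) ^ n / n.factorial := by
  rw [expCoeff, norm_div, norm_pow, Complex.norm_real, Real.norm_of_nonneg (Real.sqrt_nonneg _),
    div_pow, Real.sq_sqrt (by positivity)]
  ring

theorem memℓp_expCoeff (z : ℂ) : Memℓp (expCoeff z) 2 := by
  rw [memℓp_two_iff]
  simp only [norm_expCoeff_sq]
  exact Real.summable_pow_div_factorial _

/-- The exponential vector `e(z) = ∑ₙ zⁿ / √n! |n⟩`, a multiple of a coherent state. -/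
def expVec (z : ℂ) : Fock := ⟨expCoeff z, memℓp_expCoeff z⟩

theorem expVec_apply (z : ℂ) (n : ℕ) : expVec z n = expCoeff z n := rfl

theorem expVec_mem (z : ℂ) : expVec z ∈ numberDomain := by
  refine memℓp_two_iff.2 ?_
  refine Summable.of_nonneg_of_le (fun n => by positivity) (fun n => ?_)
    -- The factor 4 absorbs n² through n ≤ 2ⁿ.
    (Real.summable_pow_div_factorial (4 * ‖z‖ ^ 2))
  rw [norm_mul, mul_pow, expVec_apply, norm_expCoeff_sq, mul_pow 4, Complex.norm_natCast,
    mul_div_assoc]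
  gcongr
  have h : (n : ℝ) ≤ 2 ^ n := by exact_mod_cast Nat.lt_two_pow_self.le
  calc (n : ℝ) ^ 2 ≤ (2 ^ n) ^ 2 := by gcongr
    _ = 4 ^ n := by rw [← pow_mul, mul_comm, pow_mul]; norm_num

/-- The exponential vector as an element of the domain of the number operator. -/
def expD (z : ℂ) : numberDomain := ⟨expVec z, expVec_mem z⟩

@[simp] theorem coe_expD (z : ℂ) : (expD z).1 = expVec z := rfl

theorem expCoeff_succ (z : ℂ) (n : ℕ) :
    (Real.sqrt ((n + 1 : ℕ) : ℝ) : ℂ) * expCoeff z (n + 1) = z * expCoeff z n := by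
  have h1 : (Real.sqrt ((n + 1 : ℕ) : ℝ) : ℂ) ≠ 0 := by
    exact_mod_cast (Real.sqrt_pos.2 (by positivity)).ne'
  have h2 : (Real.sqrt n.factorial : ℂ) ≠ 0 := by
    exact_mod_cast (Real.sqrt_pos.2 (by positivity)).ne'
  rw [expCoeff, expCoeff, Nat.factorial_succ, Nat.cast_mul, Real.sqrt_mul (by positivity),
    Complex.ofReal_mul]
  field_simp
  ring

theorem ann_expD (z : ℂ) : numberDomain.ann (expD z) = z • expVec z := by
  ext n
  rw [numberDomain.ann_apply]
  exact expCoeff_succ z n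

/-- From b*b and b e(z) = z e(z). As b* e(z) is the derivative of e at z, the free and damped part
of the drift moves e(z) along the exponential vectors. -/
theorem num_expD (z : ℂ) : numberDomain.num (expD z) = z • numberDomain.cre (expD z) := by
  ext n
  rw [numberDomain.num_apply, lp.coeFn_smul, Pi.smul_apply, numberDomain.cre_apply, smul_eq_mul]
  rcases n with _ | n
  · simp
  · rw [mul_left_comm, Nat.add_sub_cancel]
    simp only [coe_expD, expVec_apply]
    rw [← expCoeff_succ, ← mul_assoc, ← Complex.ofReal_mul, Real.mul_self_sqrt (Nat.cast_nonneg _)]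
    simp

theorem inner_expVec (z w : ℂ) : ⟪expVec z, expVec w⟫ = Complex.exp (conj z * w) := by
  refine (numberDomain.hasSum_inner' (expVec z) (expVec w)).unique ?_
  have h := NormedSpace.expSeries_div_hasSum_exp (conj z * w)
  rw [← Complex.exp_eq_exp_ℂ] at h
  refine h.congr_fun fun n => ?_
  have h2 : (Real.sqrt n.factorial : ℂ) ≠ 0 := by
    exact_mod_cast (Real.sqrt_pos.2 (by positivity)).ne'
  have h3 : (n.factorial : ℂ) = (Real.sqrt n.factorial : ℂ) * (Real.sqrt n.factorial : ℂ) := by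
    rw [← Complex.ofReal_mul, Real.mul_self_sqrt (by positivity)]
    simp
  simp only [expVec_apply, expCoeff, map_div₀, map_pow, Complex.conj_ofReal]
  rw [h3, mul_pow]
  field_simp

theorem norm_expVec_sq (z : ℂ) : ‖expVec z‖ ^ 2 = Real.exp (‖z‖ ^ 2) := by
  have h := inner_expVec z z
  rw [inner_self_eq_norm_sq_to_K, Complex.conj_mul'] at h
  have h2 : ((‖expVec z‖ ^ 2 : ℝ) : ℂ) = ((Real.exp (‖z‖ ^ 2) : ℝ) : ℂ) := by
    push_cast
    exact h
  exact Complex.ofReal_injective h2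

/-- The power series of e is differentiated term by term on a disc around 0 that contains z; the
derivatives of the coefficients are those of b* e(z). -/
theorem hasDerivAt_expVec (z : ℂ) : HasDerivAt expVec (numberDomain.cre (expD z)) z := by
  set b : ℕ → Fock := fun n => ((Real.sqrt n.factorial : ℂ))⁻¹ • lp.single 2 n (1 : ℂ) with hb
  have hbn : ∀ n, ‖b n‖ = (Real.sqrt n.factorial)⁻¹ := fun n => by
    rw [hb, norm_smul, lp.norm_single (by norm_num), norm_inv, Complex.norm_real,
      Real.norm_of_nonneg (Real.sqrt_nonneg _)]
    simp
  have hsum : ∀ w, HasSum (fun n => w ^ n • b n) (expVec w) := fun w => by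
    refine (lp.hasSum_single (p := 2) (by norm_num) (expVec w)).congr_fun fun n => ?_
    rw [hb, smul_smul, ← lp.single_smul, expVec_apply, expCoeff, smul_eq_mul, mul_one, div_eq_mul_inv]
  have hcre : HasSum (fun n : ℕ => ((n : ℂ) * z ^ (n - 1)) • b n) (numberDomain.cre (expD z)) := by
    refine (lp.hasSum_single (p := 2) (by norm_num) _).congr_fun fun n => ?_
    rw [hb, smul_smul, ← lp.single_smul, numberDomain.cre_apply, smul_eq_mul, mul_one]
    congr 1
    rcases n with _ | n
    · simp
    · have h1 : (Real.sqrt ((n + 1 : ℕ) : ℝ) : ℂ) ≠ 0 := by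
        exact_mod_cast (Real.sqrt_pos.2 (by positivity)).ne'
      have h2 : (Real.sqrt n.factorial : ℂ) ≠ 0 := by
        exact_mod_cast (Real.sqrt_pos.2 (by positivity)).ne'
      have h3 : ((n + 1 : ℕ) : ℂ) = (Real.sqrt ((n + 1 : ℕ) : ℝ) : ℂ) *
          (Real.sqrt ((n + 1 : ℕ) : ℝ) : ℂ) := by
        rw [← Complex.ofReal_mul, Real.mul_self_sqrt (by positivity)]
        simp
      rw [coe_expD, expVec_apply, expCoeff, Nat.factorial_succ, Nat.cast_mul (n + 1),
        Real.sqrt_mul (by positivity), Complex.ofReal_mul, Nat.add_sub_cancel, h3]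
      field_simp
  -- The radius is ‖z‖ + 1, and the extra factor 2 absorbs the n produced by differentiation, since
  -- n ≤ 2ⁿ.
  have hbound : Summable fun n : ℕ => ((2 * (‖z‖ + 1)) ^ n) / Real.sqrt n.factorial :=
    summable_pow_div_sqrt _ (by positivity)
  have key := hasDerivAt_tsum_of_isPreconnected (𝕜 := ℂ) (g := fun n w => w ^ n • b n)
    (g' := fun (n : ℕ) w => ((n : ℂ) * w ^ (n - 1)) • b n) hbound (Metric.isOpen_ball (x := (0 : ℂ))
    (ε := ‖z‖ + 1)) (convex_ball _ _).isPreconnected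
    (fun n y _ => (hasDerivAt_pow n y).smul_const (b n)) ?_
    (y₀ := z) (by simp) (hsum z).summable (y := z) (by simp)
  · rw [hcre.tsum_eq] at key
    refine key.congr_of_eventuallyEq (Eventually.of_forall fun w => (hsum w).tsum_eq.symm)
  · intro n y hy
    have hy' : ‖y‖ ≤ ‖z‖ + 1 := by simpa using (Metric.mem_ball.1 hy).le
    rw [norm_smul, norm_mul, norm_pow, hbn, Complex.norm_natCast, div_eq_mul_inv]
    gcongr
    have h : (n : ℝ) ≤ 2 ^ n := by exact_mod_cast Nat.lt_two_pow_self.le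
    rw [mul_pow]
    gcongr
    calc ‖y‖ ^ (n - 1) ≤ (‖z‖ + 1) ^ (n - 1) := by gcongr
      _ ≤ (‖z‖ + 1) ^ n := pow_le_pow_right₀ (by linarith [norm_nonneg z]) (Nat.sub_le n 1)

/-! ### Contraction semigroups: closedness of the generator and uniqueness of orbits. -/

section Abstract

variable {E : Type*} [NormedAddCommGroup E] [NormedSpace ℂ E]

/-- The coefficients of a convergent power series with values in a closed subspace belong to it. -/
theorem coeff_mem_of_hasSum {Γ : Submodule ℂ E} (hΓ : IsClosed (Γ : Set E)) {a : ℕ → E}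
    {f : ℂ → E} (hs : ∀ z, HasSum (fun n => z ^ n • a n) (f z)) (hf : ∀ z, f z ∈ Γ) (n : ℕ) :
    a n ∈ Γ := by
  obtain ⟨C, hC⟩ : ∃ C, ∀ n, ‖a n‖ ≤ C := by
    have h0 := (hs 1).summable.tendsto_atTop_zero
    obtain ⟨C, hC⟩ := h0.norm.bddAbove_range
    refine ⟨C, fun n => ?_⟩
    have := hC ⟨n, rfl⟩
    simpa using this
  have hC0 : 0 ≤ C := (norm_nonneg _).trans (hC 0)
  induction n using Nat.strong_induction_on with
  -- Once the earlier coefficients lie in Γ, so does the remainder after them divided by zᵐ, and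
  -- this tends to a_m as z → 0.
  | _ m ih =>
  set F : ℂ → E := fun z => (z ^ m)⁻¹ • (f z - ∑ i ∈ Finset.range m, z ^ i • a i) with hF
  have hmem : ∀ z, F z ∈ Γ := fun z =>
    Γ.smul_mem _ (Γ.sub_mem (hf z) (Γ.sum_mem fun i hi => Γ.smul_mem _ (ih i (Finset.mem_range.1 hi))))
  have hFs : ∀ z, z ≠ 0 → HasSum (fun n => z ^ n • a (n + m)) (F z) := fun z hz => by
    refine (((hasSum_nat_add_iff' m).2 (hs z)).const_smul (z ^ m)⁻¹).congr_fun fun n => ?_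
    rw [smul_smul, pow_add, mul_comm, mul_assoc, mul_inv_cancel₀ (pow_ne_zero m hz), mul_one]
  have hbound : ∀ z, z ≠ 0 → ‖z‖ ≤ 1 / 2 → ‖F z - a m‖ ≤ ‖z‖ * (C * 2) := fun z hz hz2 => by
    have h1 : HasSum (fun n => z ^ (n + 1) • a (n + 1 + m)) (F z - a m) := by
      simpa using (hasSum_nat_add_iff' 1).2 (hFs z hz)
    rw [← h1.tsum_eq]
    refine tsum_of_norm_bounded (g := fun n => ‖z‖ * (C * (1 / 2) ^ n)) ?_ fun n => ?_
    · have := (hasSum_geometric_two.mul_left C).mul_left ‖z‖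
      exact this
    · rw [norm_smul, norm_pow, pow_succ', mul_assoc, mul_comm C]
      gcongr
      exact hC _
  refine hΓ.mem_of_tendsto (f := F) (b := 𝓝[≠] 0) ?_ (Eventually.of_forall hmem)
  rw [tendsto_iff_norm_sub_tendsto_zero]
  have h3 : Tendsto (fun z : ℂ => ‖z‖ * (C * 2)) (𝓝[≠] 0) (𝓝 0) := by
    have : Tendsto (fun z : ℂ => ‖z‖ * (C * 2)) (𝓝 0) (𝓝 (‖(0 : ℂ)‖ * (C * 2))) :=
      (continuous_norm.mul continuous_const).tendsto 0
    simpa using this.mono_left nhdsWithin_le_nhds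
  refine squeeze_zero' (Eventually.of_forall fun _ => norm_nonneg _) ?_ h3
  have h4 : ∀ᶠ z : ℂ in 𝓝[≠] 0, ‖z‖ ≤ 1 / 2 := by
    refine nhdsWithin_le_nhds ?_
    have := Metric.closedBall_mem_nhds (0 : ℂ) (show (0 : ℝ) < 1 / 2 by norm_num)
    filter_upwards [this] with z hz
    simpa using hz
  filter_upwards [h4, self_mem_nhdsWithin] with z hz hz0
  exact hbound z hz0 hz

/-- Strongly continuous contraction semigroups. -/
structure IsContractionSemigroup (T : ℝ≥0 → (E →ₗ[ℂ] E)) : Prop where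
  zero : T 0 = LinearMap.id
  add : ∀ s t, T (s + t) = T s ∘ₗ T t
  contraction : ∀ t x, ‖T t x‖ ≤ ‖x‖
  continuous : ∀ x, Tendsto (fun t => ‖T t x - x‖) (𝓝 0) (𝓝 0)

/-- `x` is in the domain of the generator, with value `y`. -/
def InGenerator (T : ℝ≥0 → (E →ₗ[ℂ] E)) (x y : E) : Prop :=
  Tendsto (fun t : ℝ≥0 => ‖((t : ℝ) : ℂ)⁻¹ • (T t x - x) - y‖) (𝓝[>] 0) (𝓝 0)

/-- The disjunct t = 0 is needed because no semigroup law is assumed here, and the punctured limit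
says nothing about T 0. -/
theorem inGenerator_iff {T : ℝ≥0 → (E →ₗ[ℂ] E)} {x y : E} : InGenerator T x y ↔
    ∀ ε > 0, ∃ δ > 0, ∀ t : ℝ≥0, (t : ℝ) < δ → ‖T t x - x - ((t : ℝ) : ℂ) • y‖ ≤ ε * t ∨ t = 0 := by
  have key : ∀ t : ℝ≥0, t ≠ 0 → ‖((t : ℝ) : ℂ)⁻¹ • (T t x - x) - y‖ * t =
      ‖T t x - x - ((t : ℝ) : ℂ) • y‖ := fun t ht => by
    have h0 : ((t : ℝ) : ℂ) ≠ 0 := by exact_mod_cast ht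
    have h1 : T t x - x - ((t : ℝ) : ℂ) • y =
        ((t : ℝ) : ℂ) • (((t : ℝ) : ℂ)⁻¹ • (T t x - x) - y) := by
      rw [smul_sub, smul_inv_smul₀ h0]
    rw [h1, norm_smul, Complex.norm_real, Real.norm_of_nonneg (NNReal.coe_nonneg t), mul_comm]
  rw [InGenerator, Metric.tendsto_nhds]
  constructor
  · intro h ε hε
    have h1 := h ε hε
    rw [eventually_nhdsWithin_iff, Metric.eventually_nhds_iff] at h1
    obtain ⟨δ, hδ, h2⟩ := h1
    refine ⟨δ, hδ, fun t ht => ?_⟩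
    rcases eq_or_ne t 0 with rfl | h0
    · exact Or.inr rfl
    · left
      have h3 := h2 (y := t) (by simpa [NNReal.dist_eq] using ht) (pos_iff_ne_zero.2 h0)
      rw [Real.dist_0_eq_abs, abs_of_nonneg (norm_nonneg _)] at h3
      rw [← key t h0]
      exact mul_le_mul_of_nonneg_right h3.le t.2
  · intro h ε hε
    obtain ⟨δ, hδ, h2⟩ := h (ε / 2) (half_pos hε)
    rw [eventually_nhdsWithin_iff, Metric.eventually_nhds_iff]
    refine ⟨δ, hδ, fun t ht h0 => ?_⟩
    have h0' : t ≠ 0 := pos_iff_ne_zero.1 h0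
    have h3 := (h2 t (by simpa [NNReal.dist_eq] using ht)).resolve_right h0'
    rw [← key t h0'] at h3
    have h4 := le_of_mul_le_mul_right h3 (NNReal.coe_pos.2 h0)
    rw [Real.dist_0_eq_abs, abs_of_nonneg (norm_nonneg _)]
    linarith

namespace IsContractionSemigroup

variable {T : ℝ≥0 → (E →ₗ[ℂ] E)}

/-- Telescoping over n steps of length h: each step costs the one-step error, which the contraction
carries along, plus h times the displacement of y along its orbit. -/
theorem norm_sub_nsmul_le (hT : IsContractionSemigroup T) {x y : E} {δ : ℝ} {h : ℝ≥0} (n : ℕ)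
    (hy : ∀ u : ℝ≥0, u ≤ n * h → ‖T u y - y‖ ≤ δ) :
    ‖T (n * h) x - x - ((n * h : ℝ) : ℂ) • y‖ ≤
      n * ‖T h x - x - ((h : ℝ) : ℂ) • y‖ + n * h * δ := by
  induction n with
  | zero => simp [hT.zero]
  | succ n ih =>
    have ih' := ih fun u hu => hy u (hu.trans (by gcongr; simp))
    have e1 : ((n + 1 : ℕ) : ℝ≥0) * h = n * h + h := by push_cast; ring
    have e2 : T ((n + 1 : ℕ) * h) x = T (n * h) (T h x) := by
      rw [e1, hT.add]; rfl
    have e3 : T ((n + 1 : ℕ) * h) x - x - (((n + 1 : ℕ) * h : ℝ) : ℂ) • y =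
        (T (n * h) x - x - ((n * h : ℝ) : ℂ) • y) +
        T (n * h) (T h x - x - ((h : ℝ) : ℂ) • y) + ((h : ℝ) : ℂ) • (T (n * h) y - y) := by
      rw [e2, map_sub, map_sub, map_smul, smul_sub]
      push_cast
      rw [add_mul, add_smul, one_mul]
      abel
    rw [e3]
    have h1 : ‖((h : ℝ) : ℂ) • (T (n * h) y - y)‖ ≤ h * δ := by
      rw [norm_smul, Complex.norm_real, Real.norm_of_nonneg (NNReal.coe_nonneg h)]
      exact mul_le_mul_of_nonneg_left (hy _ (by gcongr; simp)) h.2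
    have h2 := hT.contraction (n * h) (T h x - x - ((h : ℝ) : ℂ) • y)
    have h3 := norm_add₃_le (a := T (n * h) x - x - ((n * h : ℝ) : ℂ) • y)
      (b := T (n * h) (T h x - x - ((h : ℝ) : ℂ) • y)) (c := ((h : ℝ) : ℂ) • (T (n * h) y - y))
    push_cast at h3 ih' ⊢
    linarith

/-- A quantitative form of T_t x - x = ∫₀ᵗ T_u y du without the integral: when the partition is
refined, the one-step errors in `norm_sub_nsmul_le` add up to o(1) and only the displacement of y
remains. -/
theorem norm_sub_le_of_inGenerator (hT : IsContractionSemigroup T) {x y : E} (hxy : InGenerator T x y) {δ : ℝ} {t : ℝ≥0}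
    (hy : ∀ u : ℝ≥0, u ≤ t → ‖T u y - y‖ ≤ δ) :
    ‖T t x - x - ((t : ℝ) : ℂ) • y‖ ≤ t * δ := by
  rcases eq_or_ne t 0 with rfl | ht
  · simp [hT.zero]
  refine le_of_forall_pos_le_add fun ε hε => ?_
  have htp : (0 : ℝ) < t := by exact_mod_cast pos_iff_ne_zero.2 ht
  -- With tolerance ε/t per unit time, n steps of length t/n cost ε altogether.
  obtain ⟨d, hd, h1⟩ := inGenerator_iff.1 hxy (ε / t) (by positivity)
  obtain ⟨n, hn⟩ := exists_nat_gt ((t : ℝ) / d)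
  have hn0 : (0 : ℝ) < n := lt_trans (by positivity) hn
  have hn0' : (n : ℝ≥0) ≠ 0 := by exact_mod_cast hn0.ne'
  have e1 : (n : ℝ≥0) * (t / n) = t := mul_div_cancel₀ t hn0'
  have h2 := hT.norm_sub_nsmul_le (x := x) (y := y) (δ := δ) (h := t / n) n (by rwa [e1])
  have e2 : (n : ℝ) * ((t / n : ℝ≥0) : ℝ) = t := by exact_mod_cast congrArg NNReal.toReal e1
  have hlt : ((t / n : ℝ≥0) : ℝ) < d := by
    push_cast
    rw [div_lt_iff₀ hn0]
    rwa [div_lt_iff₀ hd, mul_comm] at hn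
  have h3 := (h1 (t / n) hlt).resolve_right (div_ne_zero ht hn0')
  rw [e1, e2] at h2
  have h4 : (n : ℝ) * (ε / t * ((t / n : ℝ≥0) : ℝ)) = ε := by
    rw [mul_left_comm, e2]
    field_simp
  have h5 := mul_le_mul_of_nonneg_left h3 hn0.le
  linarith

/-- The graph of the generator. -/
def graph (_hT : IsContractionSemigroup T) : Submodule ℂ (E × E) where
  carrier := {p | InGenerator T p.1 p.2}
  zero_mem' := by simp [InGenerator]
  add_mem' := by
    rintro ⟨x, y⟩ ⟨x', y'⟩ h h'
    refine squeeze_zero (fun _ => norm_nonneg _) (fun t => ?_) (by simpa using Tendsto.add h h')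
    refine le_trans (le_of_eq ?_) (norm_add_le _ _)
    congr 1
    simp only [Prod.mk_add_mk, map_add, smul_sub, smul_add]
    abel
  smul_mem' := by
    rintro c ⟨x, y⟩ h
    have h2 := Tendsto.const_mul ‖c‖ h
    rw [mul_zero] at h2
    refine h2.congr fun t => ?_
    rw [← norm_smul]
    congr 1
    simp only [Prod.smul_mk, map_smul, smul_sub, smul_comm c]

theorem inGenerator_smul (hT : IsContractionSemigroup T) (c : ℂ) {x y : E}
    (h : InGenerator T x y) : InGenerator T (c • x) (c • y) :=
  hT.graph.smul_mem c (x := (x, y)) h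

/-- The estimate in `norm_sub_le_of_inGenerator` sees x only through T_t x - x - t y, and its right
side depends on the orbit of y alone. It is therefore uniform along a convergent sequence in the
graph and passes to the limit. -/
theorem isClosed_graph (hT : IsContractionSemigroup T) : IsClosed (hT.graph : Set (E × E)) := by
  refine IsSeqClosed.isClosed fun p q hp hpq => ?_
  obtain ⟨x, y⟩ := q
  have hx : Tendsto (fun n => (p n).1) atTop (𝓝 x) := (continuous_fst.tendsto _).comp hpq
  have hy : Tendsto (fun n => (p n).2) atTop (𝓝 y) := (continuous_snd.tendsto _).comp hpq
  refine inGenerator_iff.2 fun ε hε => ?_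
  have h1 := (Metric.tendsto_nhds.1 (hT.continuous y)) ε hε
  rw [Metric.eventually_nhds_iff] at h1
  obtain ⟨d, hd, h2⟩ := h1
  refine ⟨d, hd, fun t ht => Or.inl ?_⟩
  have hTt : Tendsto (fun n => T t (p n).1) atTop (𝓝 (T t x)) :=
    ((T t).mkContinuous 1 fun v => by rw [one_mul]; exact hT.contraction t v).continuous.tendsto x
      |>.comp hx
  have hL := ((hTt.sub hx).sub (hy.const_smul ((t : ℝ) : ℂ))).norm
  -- Replacing the orbit of the n-th second component by that of y costs twice their distance, by
  -- contractivity.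
  have hR : Tendsto (fun n => (t : ℝ) * (ε + 2 * ‖(p n).2 - y‖)) atTop (𝓝 (t * (ε + 2 * 0))) :=
    ((tendsto_iff_norm_sub_tendsto_zero.1 hy).const_mul 2 |>.const_add ε).const_mul _
  rw [mul_zero, add_zero, mul_comm (t : ℝ)] at hR
  refine le_of_tendsto_of_tendsto' hL hR fun n => ?_
  refine hT.norm_sub_le_of_inGenerator (hp n) fun u hu => ?_
  have h3 := h2 (y := u) (by
    simp only [NNReal.dist_eq, NNReal.coe_zero, sub_zero, NNReal.abs_eq]
    exact lt_of_le_of_lt (by exact_mod_cast hu) ht)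
  rw [Real.dist_0_eq_abs, abs_of_nonneg (norm_nonneg _)] at h3
  have e : T u (p n).2 - (p n).2 = T u ((p n).2 - y) + (T u y - y) - ((p n).2 - y) := by
    rw [map_sub]; abel
  rw [e]
  have h4 := hT.contraction u ((p n).2 - y)
  have h5 := norm_sub_le (T u ((p n).2 - y) + (T u y - y)) ((p n).2 - y)
  have h6 := norm_add_le (T u ((p n).2 - y)) (T u y - y)
  linarith

/-- A differentiable curve that solves the evolution equation is an orbit of the semigroup. -/
theorem eq_of_hasDerivAt (hT : IsContractionSemigroup T) {u u' : ℝ → E} (hu : ∀ t, HasDerivAt u (u' t) t)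
    (hg : ∀ t, InGenerator T (u t) (u' t)) (t : ℝ≥0) : T t (u 0) = u t := by
  have hc : Continuous u := continuous_iff_continuousAt.2 fun t => (hu t).continuousAt
  -- The curve f joins T_t u(0) to u(t); it is constant because the two contributions to its
  -- derivative cancel.
  set f : ℝ → E := fun s => T (t - s).toNNReal (u s) with hf
  -- Pulling out the common factor T_{t-s'} leaves the error of a single short evolution, so
  -- contractivity suffices for both continuity and the derivative.
  have hadd : ∀ s s' : ℝ, s ≤ s' → s' ≤ t →
      f s' - f s = T (t - s').toNNReal (u s' - T (s' - s).toNNReal (u s)) := fun s s' h h' => by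
    have e : (t - s).toNNReal = (t - s').toNNReal + (s' - s).toNNReal := by
      rw [← Real.toNNReal_add (by linarith) (by linarith)]
      congr 1
      ring
    simp only [hf]
    rw [e, hT.add, map_sub]
    rfl
  have hle : ∀ s s' : ℝ, s ≤ s' → s' ≤ t →
      ‖f s' - f s‖ ≤ ‖u s' - T (s' - s).toNNReal (u s)‖ := fun s s' h h' => by
    rw [hadd s s' h h']
    exact hT.contraction _ _
  have hnn : ∀ x : ℝ, Tendsto (fun s : ℝ => |s - x|.toNNReal) (𝓝 x) (𝓝 0) := fun x => by
    have h1 : Continuous fun s : ℝ => |s - x|.toNNReal :=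
      continuous_real_toNNReal.comp (continuous_abs.comp (continuous_id.sub continuous_const))
    simpa using h1.tendsto x
  have hcont : ContinuousOn f (Set.Icc 0 t) := by
    intro x hx
    rw [ContinuousWithinAt, tendsto_iff_norm_sub_tendsto_zero]
    have h1 : Tendsto (fun s => 3 * ‖u s - u x‖ + ‖T |s - x|.toNNReal (u x) - u x‖)
        (𝓝[Set.Icc 0 (t : ℝ)] x) (𝓝 (3 * 0 + 0)) := by
      refine Tendsto.mono_left ?_ nhdsWithin_le_nhds
      exact ((tendsto_iff_norm_sub_tendsto_zero.1 (hc.tendsto x)).const_mul 3).add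
        ((hT.continuous (u x)).comp (hnn x))
    rw [mul_zero, add_zero] at h1
    refine squeeze_zero' (Eventually.of_forall fun _ => norm_nonneg _) ?_ h1
    filter_upwards [self_mem_nhdsWithin] with s hs
    rcases le_total s x with h | h
    · rw [norm_sub_rev]
      refine (hle s x h hx.2).trans ?_
      rw [abs_sub_comm, abs_of_nonneg (sub_nonneg.2 h)]
      have e : u x - T (x - s).toNNReal (u s) =
          -(T (x - s).toNNReal (u s - u x)) - (T (x - s).toNNReal (u x) - u x) := by
        rw [map_sub]; abel
      rw [e]
      have h4 := hT.contraction (x - s).toNNReal (u s - u x)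
      have h5 := norm_sub_le (-(T (x - s).toNNReal (u s - u x))) (T (x - s).toNNReal (u x) - u x)
      rw [norm_neg] at h5
      linarith [norm_nonneg (u s - u x)]
    · refine (hle x s h hs.2).trans ?_
      rw [abs_of_nonneg (sub_nonneg.2 h)]
      have e : u s - T (s - x).toNNReal (u x) = (u s - u x) - (T (s - x).toNNReal (u x) - u x) := by
        abel
      rw [e]
      have h5 := norm_sub_le (u s - u x) (T (s - x).toNNReal (u x) - u x)
      linarith [norm_nonneg (u s - u x)]
  have hderiv : ∀ x ∈ Set.Ico 0 (t : ℝ), HasDerivWithinAt f 0 (Set.Ici x) x := by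
    intro x hx
    rw [hasDerivWithinAt_iff_isLittleO, Asymptotics.isLittleO_iff]
    intro c hc
    have h1 := (hu x).isLittleO.def (half_pos hc)
    obtain ⟨d, hd, h2⟩ := inGenerator_iff.1 (hg x) (c / 2) (half_pos hc)
    have h3 : ∀ᶠ s in 𝓝 x, s < x + d := eventually_lt_nhds (by linarith)
    have h4 : ∀ᶠ s : ℝ in 𝓝 x, s < t := eventually_lt_nhds hx.2
    filter_upwards [nhdsWithin_le_nhds h1, nhdsWithin_le_nhds h3, nhdsWithin_le_nhds h4,
      self_mem_nhdsWithin] with s hs1 hs3 hs4 hs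
    have hxs : 0 ≤ s - x := sub_nonneg.2 hs
    rw [smul_zero, sub_zero]
    refine (hle x s hs hs4.le).trans ?_
    rw [Real.norm_of_nonneg hxs] at hs1 ⊢
    have h5 := h2 (s - x).toNNReal (by rw [Real.coe_toNNReal _ hxs]; linarith)
    rw [Real.coe_toNNReal _ hxs] at h5
    have e : u s - T (s - x).toNNReal (u x) = (u s - u x - (s - x) • u' x) -
        (T (s - x).toNNReal (u x) - u x - ((s - x : ℝ) : ℂ) • u' x) := by
      rw [Complex.coe_smul]
      abel
    rw [e]
    refine (norm_sub_le _ _).trans ?_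
    rcases h5 with h5 | h5
    · linarith
    · have : s = x := le_antisymm (by simpa using h5) hs
      subst this
      simp [hT.zero]
  have h := constant_of_has_deriv_right_zero hcont hderiv t ⟨t.2, le_rfl⟩
  simp only [hf, sub_self, Real.toNNReal_zero, hT.zero, sub_zero, Real.toNNReal_coe] at h
  exact h.symm

end IsContractionSemigroup

end Abstract

/-! ### The cavity with atoms, as blocks indexed by configurations. -/

section Compound

variable {N : ℕ}

@[simp] theorem incl_apply (s : Config N) (f : Fock) (s' : Config N) :
    incl s f s' = (Pi.single s f : Config N → Fock) s' := rfl

@[simp] theorem comps_apply (s : Config N) (x : Space N) : comps s x = x s := rfl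

theorem inner_incl_right (s : Config N) (f : Fock) (x : Space N) : ⟪x, incl s f⟫ = ⟪x s, f⟫ := by
  rw [PiLp.inner_apply, Finset.sum_eq_single s]
  · simp
  · intro s' _ hs
    simp [hs]
  · simp

theorem adjoint_comps (s : Config N) : ContinuousLinearMap.adjoint (comps s) = incl s := by
  ext1 f
  refine ext_inner_left ℂ fun x => ?_
  rw [ContinuousLinearMap.adjoint_inner_right, inner_incl_right, comps_apply]

theorem adjoint_incl (s : Config N) : ContinuousLinearMap.adjoint (incl s) = comps s := by
  rw [← adjoint_comps, ContinuousLinearMap.adjoint_adjoint]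

/-- Vectors in the domain of the number operator, for the cavity and `N` atoms. -/
abbrev CoreD (N : ℕ) : Type := Config N → numberDomain

/-- The block diagonal operator with the given blocks. -/
def assemble (S : Config N → numberDomain →ₗ[ℂ] Fock) : CoreD N →ₗ[ℂ] Space N :=
  (WithLp.linearEquiv 2 ℂ (Config N → Fock)).symm.toLinearMap ∘ₗ
    LinearMap.pi fun s => S s ∘ₗ LinearMap.proj s

theorem assemble_apply (S : Config N → numberDomain →ₗ[ℂ] Fock) (φ : CoreD N) (s : Config N) :
    assemble S φ s = S s (φ s) := rfl

theorem assemble_single (S : Config N → numberDomain →ₗ[ℂ] Fock) (s : Config N)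
    (f : numberDomain) : assemble S (Pi.single s f) = incl s (S s f) := by
  ext1 s'
  rw [assemble_apply, incl_apply]
  by_cases h : s' = s
  · subst h; simp
  · simp [h]

/-- The inclusion of `CoreD N` in the Hilbert space. -/
def coreIncl (N : ℕ) : CoreD N →ₗ[ℂ] Space N := assemble fun _ => numberDomain.subtype

theorem coreIncl_injective : Function.Injective (coreIncl N) := fun φ ψ h => by
  funext s
  exact Subtype.ext (congrFun (congrArg WithLp.ofLp h) s)

/-- The finite-photon vectors in `CoreD N`. -/
def finV (N : ℕ) : Core N →ₗ[ℂ] CoreD N := finD.compLeft (Config N)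

theorem finV_apply (φ : Core N) (s : Config N) : finV N φ s = finD (φ s) := rfl

theorem coreIncl_finV (φ : Core N) : coreIncl N (finV N φ) = toSpace N φ := rfl

/-- Allowing a semilinear map lets one induction serve both slots of a sesquilinear form. -/
theorem map_finV_mem {E : Type*} [AddCommGroup E] [Module ℂ E] {σ : ℂ →+* ℂ} (Γ : Submodule ℂ E)
    (L : CoreD N →ₛₗ[σ] E)
    (h : ∀ s n, L (Pi.single s (finD (Finsupp.single n 1))) ∈ Γ) (φ : Core N) :
    L (finV N φ) ∈ Γ := by
  have h1 : ∀ (s : Config N) (f : FinVec), L (Pi.single s (finD f)) ∈ Γ := by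
    intro s f
    induction f using Finsupp.induction_linear with
    | zero => simp
    | add f g hf hg =>
      rw [map_add, Pi.single_add, map_add]
      exact Γ.add_mem hf hg
    | single n c =>
      have : Finsupp.single n c = c • Finsupp.single n (1 : ℂ) := by simp
      rw [this, map_smul, Pi.single_smul, LinearMap.map_smulₛₗ]
      exact Γ.smul_mem _ (h s n)
  rw [← Finset.univ_sum_single (finV N φ), map_sum]
  exact Γ.sum_mem fun s _ => h1 s _

theorem denseRange_toSpace : DenseRange (toSpace N) := by
  have h1 : DenseRange (Pi.map fun (_ : Config N) => (toFock : FinVec → Fock)) :=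
    DenseRange.piMap fun _ => denseRange_toFock
  have h2 : DenseRange (fun x : Config N → Fock => (WithLp.toLp 2 x : Space N)) :=
    (WithLp.toLp_surjective 2).denseRange
  exact h2.comp h1 (PiLp.continuous_toLp 2 _)

end Compound

section HasSum

variable (f : numberDomain)

theorem hasSum_ann_finD :
    HasSum (fun n => numberDomain.ann (f.1 n • finD (Finsupp.single n 1))) (numberDomain.ann f) ∧
    HasSum (fun n => numberDomain.cre (f.1 n • finD (Finsupp.single n 1))) (numberDomain.cre f) := by
  have h1 := hasSum_coe_finD f.1
  have h2 := hasSum_num_finD f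
  unfold HasSum at h1 h2 ⊢
  have h3 := numberDomain.tendsto_ann (f := f)
    (u := fun S : Finset ℕ => ∑ n ∈ S, f.1 n • finD (Finsupp.single n 1))
    (h1.congr fun S => by simp) (h2.congr fun S => by rw [map_sum])
  simpa only [map_sum] using h3

end HasSum

/-! ### Drift and jump operators; transfer of the graph between number-state and coherent dyads. -/

namespace Model

variable (M : Model) {N : ℕ}

/-- The strength of the drive of the cavity by the atom `k` in the configuration `s`. -/
def drive (k : ℕ) (s : Config N) : ℝ :=
  ∑ j : Fin N, if (j : ℕ) = k then (if s j = 1 then M.lam else 0) else 0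

/-- The energy of the atoms in the configuration `s`. -/
def atomEnergy (s : Config N) : ℝ := ∑ j : Fin N, if s j = 1 then M.E else 0

/-- The blocks of the drift `-i H - (σ/2) b* b`. -/
def driftAt (k : ℕ) (s : Config N) : numberDomain →ₗ[ℂ] Fock :=
  (-M.μ) • numberDomain.num - (Complex.I * M.atomEnergy s) • numberDomain.subtype -
    (Complex.I * M.drive k s) • (numberDomain.cre + numberDomain.ann)

/-- The drift `-i H - (σ/2) b* b`. -/
def drift (N k : ℕ) : CoreD N →ₗ[ℂ] Space N := assemble (M.driftAt k)

/-- The jump operator `√σ b`. -/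
def jump (N : ℕ) : CoreD N →ₗ[ℂ] Space N :=
  assemble fun _ => (Real.sqrt M.σ : ℂ) • numberDomain.ann

theorem μ_re : M.μ.re = M.σ / 2 := by
  have : (M.σ : ℂ) / 2 = ((M.σ / 2 : ℝ) : ℂ) := by push_cast; rfl
  rw [μ, this]
  simp

theorem μ_re_pos : 0 < M.μ.re := by
  rw [μ_re]
  exact half_pos M.σ_pos

theorem μ_ne_zero : M.μ ≠ 0 := fun h => by
  have := M.μ_re_pos
  rw [h] at this
  simp at this

theorem sqrt_σ_mul : (Real.sqrt M.σ : ℂ) * (Real.sqrt M.σ : ℂ) = M.σ := by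
  rw [← Complex.ofReal_mul, Real.mul_self_sqrt M.σ_pos.le]

/-- The Hamiltonian part is symmetric and contributes only an imaginary number; the damping (σ/2)
b*b balances the jump term exactly. -/
theorem re_inner_driftAt (k : ℕ) (s : Config N) (f : numberDomain) :
    2 * (⟪f.1, M.driftAt k s f⟫).re + M.σ * ‖numberDomain.ann f‖ ^ 2 = 0 := by
  have h1 : ⟪f.1, numberDomain.cre f⟫ + ⟪f.1, numberDomain.ann f⟫ =
      ((2 * (⟪f.1, numberDomain.cre f⟫).re : ℝ) : ℂ) := by
    rw [← inner_conj_symm f.1 (numberDomain.ann f), ← numberDomain.inner_cre, Complex.add_conj]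
  have h2 : ⟪f.1, M.driftAt k s f⟫ = (-M.μ) * ((‖numberDomain.ann f‖ ^ 2 : ℝ) : ℂ) -
      Complex.I * ((M.atomEnergy s * ‖f.1‖ ^ 2 : ℝ) : ℂ) -
      Complex.I * ((M.drive k s * (2 * (⟪f.1, numberDomain.cre f⟫).re) : ℝ) : ℂ) := by
    have h3 : ⟪f.1, f.1⟫ = ((‖f.1‖ ^ 2 : ℝ) : ℂ) := by
      rw [inner_self_eq_norm_sq_to_K]; simp
    simp only [driftAt, LinearMap.sub_apply, LinearMap.smul_apply, LinearMap.add_apply,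
      inner_sub_right, inner_smul_right, inner_add_right, Submodule.subtype_apply,
      numberDomain.inner_num, h1, h3]
    push_cast
    ring
  rw [h2, Complex.sub_re, Complex.sub_re, Complex.re_mul_ofReal, Complex.I_mul_re, Complex.I_mul_re,
    Complex.ofReal_im, Complex.ofReal_im, Complex.neg_re, μ_re]
  ring

theorem dissipative (k : ℕ) (φ : CoreD N) :
    2 * (⟪coreIncl N φ, M.drift N k φ⟫).re + ‖M.jump N φ‖ ^ 2 ≤ 0 := by
  refine le_of_eq ?_
  rw [PiLp.inner_apply, PiLp.norm_sq_eq_of_L2, Complex.re_sum, Finset.mul_sum,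
    ← Finset.sum_add_distrib]
  refine Finset.sum_eq_zero fun s _ => ?_
  rw [← M.re_inner_driftAt k s (φ s)]
  congr 1
  simp only [jump, assemble_apply, LinearMap.smul_apply, norm_smul, mul_pow, Complex.norm_real,
    Real.norm_of_nonneg (Real.sqrt_nonneg _), Real.sq_sqrt M.σ_pos.le]

/-- The Lindblad generator on dyads of vectors in the domain of the number operator. -/
def lindD (N k : ℕ) : CoreD N →ₗ[ℂ] CoreD N →ₗ⋆[ℂ] TC (Space N) :=
  lindForm (coreIncl N) (M.drift N k) (M.jump N)

theorem atomOp_number (j : Fin N) (φ : Core N) (s : Config N) :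
    atomOp j atomNumber φ s = if s j = 1 then φ s else 0 := by
  have h : ∀ a i : Fin 2, atomNumber a i = if a = 1 ∧ i = 1 then 1 else 0 := by
    intro a i
    fin_cases a <;> fin_cases i <;>
      simp [atomNumber, atomAnnih, Matrix.mul_apply, Fin.sum_univ_two, Matrix.conjTranspose_apply]
  simp only [atomOp, LinearMap.coe_mk, AddHom.coe_mk, h]
  by_cases hs : s j = 1
  · simp only [hs, true_and, if_true]
    rw [Finset.sum_eq_single 1]
    · rw [← hs]; simp
    · intro b _ hb; simp [hb]
    · simp
  · simp [hs]

theorem hamiltonian_apply (k : ℕ) (φ : Core N) (s : Config N) :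
    M.hamiltonian N k φ s = (M.ε : ℂ) • creat (annih (φ s)) + (M.atomEnergy s : ℂ) • φ s +
      (M.drive k s : ℂ) • (creat (φ s) + annih (φ s)) := by
  have h1 : ∀ L : Fin N → Core N →ₗ[ℂ] Core N, (∑ j, L j) φ s = ∑ j, L j φ s := fun L => by
    rw [LinearMap.sum_apply, Finset.sum_apply]
  have h2 : ∀ j : Fin N, (creatS N + annihS N) (atomOp j atomNumber φ) s =
      if s j = 1 then creat (φ s) + annih (φ s) else 0 := fun j => by
    change creat (atomOp j atomNumber φ s) + annih (atomOp j atomNumber φ s) = _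
    rw [atomOp_number]
    split_ifs <;> simp
  simp only [hamiltonian, LinearMap.add_apply, Pi.add_apply, h1]
  congr 1
  · congr 1
    rw [atomEnergy, Complex.ofReal_sum, Finset.sum_smul]
    refine Finset.sum_congr rfl fun j _ => ?_
    simp only [LinearMap.smul_apply, Pi.smul_apply, atomOp_number]
    split_ifs <;> simp
  · rw [drive, Complex.ofReal_sum, Finset.sum_smul]
    refine Finset.sum_congr rfl fun j _ => ?_
    by_cases hj : (j : ℕ) = k
    · simp only [hj, if_true, LinearMap.smul_apply, Pi.smul_apply, LinearMap.comp_apply, h2]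
      split_ifs <;> simp
    · simp [hj]

theorem drift_finV (k : ℕ) (φ : Core N) :
    M.drift N k (finV N φ) = toSpace N ((-Complex.I) • M.hamiltonian N k φ -
      ((M.σ : ℂ) / 2) • creatS N (annihS N φ)) := by
  ext1 s
  have h : (creatS N (annihS N φ)) s = creat (annih (φ s)) := rfl
  simp only [drift, assemble_apply, toSpace, Pi.sub_apply, Pi.smul_apply, hamiltonian_apply, h,
    driftAt, finV_apply, LinearMap.sub_apply, LinearMap.smul_apply, LinearMap.add_apply,
    Submodule.subtype_apply, coe_finD, num_finD, cre_finD, ann_finD, map_sub, map_add, map_smul,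
    smul_add, μ]
  module

theorem jump_finV (φ : Core N) :
    M.jump N (finV N φ) = toSpace N ((Real.sqrt M.σ : ℂ) • annihS N φ) := by
  ext1 s
  have h : (annihS N φ) s = annih (φ s) := rfl
  simp only [jump, assemble_apply, toSpace, Pi.smul_apply, h, finV_apply, LinearMap.smul_apply,
    ann_finD, map_smul]

theorem toSpace_sub (φ ψ : Core N) : toSpace N (φ - ψ) = toSpace N φ - toSpace N ψ := by
  simp only [← coreIncl_finV, map_sub]

theorem toSpace_smul (c : ℂ) (φ : Core N) : toSpace N (c • φ) = c • toSpace N φ := by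
  simp only [← coreIncl_finV, map_smul]

/-- Ties the drift and jump form, for which dissipativity is proved, to the generator as it is
written in the model. -/
theorem op_lindD_finV (k : ℕ) (φ ψ : Core N) :
    TC.op (M.lindD N k (finV N φ) (finV N ψ)) = M.lindblad N k φ ψ := by
  simp only [lindD, lindForm_apply, map_add, TC.op_rankOne, drift_finV, jump_finV, coreIncl_finV,
    lindblad, dyad, toSpace_sub, toSpace_smul, map_sub, sub_apply, map_smul,
    smul_apply, map_smulₛₗ, smul_smul, Complex.conj_ofReal, map_neg,
    Complex.conj_I, map_div₀, Complex.conj_ofNat, sqrt_σ_mul]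
  module

/-- A dyad together with the value of the Lindblad generator on it. -/
def graphForm (N k : ℕ) : CoreD N →ₗ[ℂ] CoreD N →ₗ⋆[ℂ] TC (Space N) × TC (Space N) :=
  LinearMap.mk₂'ₛₗ (RingHom.id ℂ) (starRingEnd ℂ)
    (fun φ ψ => (dyadForm (coreIncl N) φ ψ, M.lindD N k φ ψ))
    (fun φ φ' ψ => by simp only [map_add, LinearMap.add_apply, Prod.mk_add_mk])
    (fun c φ ψ => by simp only [map_smul, LinearMap.smul_apply, Prod.smul_mk]; rfl)
    (fun φ ψ ψ' => by simp only [map_add, Prod.mk_add_mk])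
    (fun c φ ψ => by simp only [LinearMap.map_smulₛₗ, Prod.smul_mk])

theorem hasSum_driftAt (k : ℕ) (s : Config N) (f : numberDomain) :
    HasSum (fun n => M.driftAt k s (f.1 n • finD (Finsupp.single n 1))) (M.driftAt k s f) := by
  have h := (((hasSum_num_finD f).const_smul (-M.μ)).sub
    ((hasSum_coe_finD f.1).const_smul (Complex.I * M.atomEnergy s))).sub
    (((hasSum_ann_finD f).2.add (hasSum_ann_finD f).1).const_smul (Complex.I * M.drive k s))
  exact h

theorem hasSum_coreIncl (s : Config N) (f : numberDomain) :
    HasSum (fun n => coreIncl N (Pi.single s (f.1 n • finD (Finsupp.single n 1))))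
      (coreIncl N (Pi.single s f)) := by
  simp only [coreIncl, assemble_single]
  exact (hasSum_coe_finD f.1).mapL (incl s)

theorem hasSum_drift (k : ℕ) (s : Config N) (f : numberDomain) :
    HasSum (fun n => M.drift N k (Pi.single s (f.1 n • finD (Finsupp.single n 1))))
      (M.drift N k (Pi.single s f)) := by
  simp only [drift, assemble_single]
  exact (M.hasSum_driftAt k s f).mapL (incl s)

theorem hasSum_jump (s : Config N) (f : numberDomain) :
    HasSum (fun n => M.jump N (Pi.single s (f.1 n • finD (Finsupp.single n 1))))
      (M.jump N (Pi.single s f)) := by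
  simp only [jump, assemble_single]
  exact ((hasSum_ann_finD f).1.const_smul (Real.sqrt M.σ : ℂ)).mapL (incl s)

/-- The generator is unbounded, yet dyad and generator value converge together: the number-state
expansion converges in the graph norm of the number operator, which controls drift and jump. -/
theorem hasSum_graphForm_left (k : ℕ) (s : Config N) (f : numberDomain) (ψ : CoreD N) :
    HasSum (fun n => M.graphForm N k (Pi.single s (f.1 n • finD (Finsupp.single n 1))) ψ)
      (M.graphForm N k (Pi.single s f) ψ) := by
  have h : ∀ y : Space N, ∀ {x : ℕ → Space N} {x₀ : Space N}, HasSum x x₀ →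
      HasSum (fun n => TC.rankOne (x n) y) (TC.rankOne x₀ y) := fun y _ _ hx =>
    hx.mapL (TC.rankOneL.flip y)
  exact (h _ (hasSum_coreIncl s f)).prodMk
    (((h _ (M.hasSum_drift k s f)).add (h _ (hasSum_coreIncl s f))).add (h _ (M.hasSum_jump s f)))

theorem hasSum_graphForm_right (k : ℕ) (s : Config N) (f : numberDomain) (ψ : CoreD N) :
    HasSum (fun n => M.graphForm N k ψ (Pi.single s (f.1 n • finD (Finsupp.single n 1))))
      (M.graphForm N k ψ (Pi.single s f)) := by
  have h : ∀ y : Space N, ∀ {x : ℕ → Space N} {x₀ : Space N}, HasSum x x₀ →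
      HasSum (fun n => TC.rankOne y (x n)) (TC.rankOne y x₀) := fun y _ _ hx =>
    hx.mapL (TC.rankOneL y)
  exact (h _ (hasSum_coreIncl s f)).prodMk
    (((h _ (hasSum_coreIncl s f)).add (h _ (M.hasSum_drift k s f))).add (h _ (M.hasSum_jump s f)))

/-- The exponential vector `e(z) ⊗ |s⟩`. -/
def cohV (s : Config N) (z : ℂ) : CoreD N := Pi.single s (expD z)

/-- A closed subspace that contains the graph of the generator over the coherent dyads contains it
over the finite-photon dyads. -/
theorem graphForm_finV_mem {k : ℕ} {Γ : Submodule ℂ (TC (Space N) × TC (Space N))}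
    (hΓ : IsClosed (Γ : Set (TC (Space N) × TC (Space N))))
    (h : ∀ s z s' w, M.graphForm N k (cohV s z) (cohV s' w) ∈ Γ) (φ ψ : Core N) :
    M.graphForm N k (finV N φ) (finV N ψ) ∈ Γ := by
  have hne : ∀ n : ℕ, (Real.sqrt n.factorial : ℂ)⁻¹ ≠ 0 := fun n => by
    refine inv_ne_zero ?_
    exact_mod_cast (Real.sqrt_pos.2 (by positivity)).ne'
  have h1 : ∀ s n s' w,
      M.graphForm N k (Pi.single s (finD (Finsupp.single n 1))) (cohV s' w) ∈ Γ := by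
    intro s n s' w
    -- As a power series in z, the n-th coefficient is the number-state value divided by √n!.
    have h2 := coeff_mem_of_hasSum hΓ (a := fun n => (Real.sqrt n.factorial : ℂ)⁻¹ •
      M.graphForm N k (Pi.single s (finD (Finsupp.single n 1))) (cohV s' w))
      (f := fun z => M.graphForm N k (cohV s z) (cohV s' w)) (fun z => ?_) (fun z => h s z s' w) n
    · exact (Γ.smul_mem_iff (hne n)).1 h2
    · refine (M.hasSum_graphForm_left k s (expD z) (cohV s' w)).congr_fun fun n => ?_
      rw [Pi.single_smul, map_smul, LinearMap.smul_apply, smul_smul, coe_expD, expVec_apply,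
        expCoeff, div_eq_mul_inv]
  have h3 : ∀ s n s' n', M.graphForm N k (Pi.single s (finD (Finsupp.single n 1)))
      (Pi.single s' (finD (Finsupp.single n' 1))) ∈ Γ := by
    intro s n s' n'
    -- The form is antilinear in the second slot, so it is w̄ in which it is a power series.
    have h2 := coeff_mem_of_hasSum hΓ (a := fun n' => (Real.sqrt n'.factorial : ℂ)⁻¹ •
      M.graphForm N k (Pi.single s (finD (Finsupp.single n 1)))
        (Pi.single s' (finD (Finsupp.single n' 1))))
      (f := fun z => M.graphForm N k (Pi.single s (finD (Finsupp.single n 1))) (cohV s' (conj z)))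
      (fun z => ?_) (fun z => h1 s n s' (conj z)) n'
    · exact (Γ.smul_mem_iff (hne n')).1 h2
    · refine (M.hasSum_graphForm_right k s' (expD (conj z)) _).congr_fun fun n => ?_
      rw [Pi.single_smul, LinearMap.map_smulₛₗ, smul_smul, coe_expD, expVec_apply,
        expCoeff, div_eq_mul_inv, map_mul, map_pow, map_inv₀, Complex.conj_ofReal,
        Complex.conj_conj]
  have h4 : ∀ s n, M.graphForm N k (Pi.single s (finD (Finsupp.single n 1))) (finV N ψ) ∈ Γ :=
    fun s n => map_finV_mem Γ (M.graphForm N k (Pi.single s (finD (Finsupp.single n 1))))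
      (fun s' n' => h3 s n s' n') ψ
  exact map_finV_mem Γ ((M.graphForm N k).flip (finV N ψ)) h4 φ

/-- A closed subspace that contains the graph of the generator over the finite-photon dyads contains
it over the coherent dyads. -/
theorem graphForm_cohV_mem {k : ℕ} {Γ : Submodule ℂ (TC (Space N) × TC (Space N))}
    (hΓ : IsClosed (Γ : Set (TC (Space N) × TC (Space N))))
    (h : ∀ φ ψ : Core N, M.graphForm N k (finV N φ) (finV N ψ) ∈ Γ) (s : Config N) (z : ℂ)
    (s' : Config N) (w : ℂ) : M.graphForm N k (cohV s z) (cohV s' w) ∈ Γ := by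
  have hfin : ∀ (s : Config N) (f : FinVec), (Pi.single s (finD f) : CoreD N) =
      finV N (Pi.single s f) := fun s f => by
    funext s'
    by_cases hs : s' = s
    · subst hs; simp [finV_apply]
    · simp [finV_apply, hs]
  have hmem : ∀ {g : ℕ → TC (Space N) × TC (Space N)} {a}, HasSum g a → (∀ n, g n ∈ Γ) → a ∈ Γ :=
    fun hg hn => hΓ.mem_of_tendsto hg (Eventually.of_forall fun S => Γ.sum_mem fun n _ => hn n)
  refine hmem (M.hasSum_graphForm_left k s (expD z) (cohV s' w)) fun n => ?_
  refine hmem (M.hasSum_graphForm_right k s' (expD w) _) fun n' => ?_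
  rw [← map_smul, ← map_smul, hfin, hfin]
  exact h _ _

end Model

namespace Model

variable (M : Model) {N : ℕ}

/-! ## Coherent dyads -/

/-- The amplitude at time `t` of a driven and damped coherent state. -/
def amp (l : ℝ) (t : ℝ) (z : ℂ) : ℂ :=
  Complex.exp (-M.μ * t) * z - Complex.I * l / M.μ * (1 - Complex.exp (-M.μ * t))

theorem amp_zero (l : ℝ) (z : ℂ) : M.amp l 0 z = z := by simp [amp]

theorem amp_add (l : ℝ) (s t : ℝ) (z : ℂ) : M.amp l (s + t) z = M.amp l s (M.amp l t z) := by
  simp only [amp, Complex.ofReal_add, mul_add, Complex.exp_add]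
  ring

theorem hasDerivAt_amp (l : ℝ) (t : ℝ) (z : ℂ) :
    HasDerivAt (fun t : ℝ => M.amp l t z) (-M.μ * M.amp l t z - Complex.I * l) t := by
  have h1 : HasDerivAt (fun t : ℝ => Complex.exp (-M.μ * t)) (Complex.exp (-M.μ * t) * (-M.μ)) t := by
    have := ((Complex.ofRealCLM.hasDerivAt (x := t)).const_mul (-M.μ)).cexp
    simpa using this
  have h2 := (h1.mul_const z).sub ((h1.const_sub 1).const_mul (Complex.I * l / M.μ))
  refine h2.congr_deriv ?_
  have := M.μ_ne_zero
  simp only [amp]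
  field_simp
  ring

theorem continuous_amp (l : ℝ) (z : ℂ) : Continuous fun t : ℝ => M.amp l t z :=
  continuous_iff_continuousAt.2 fun t => (M.hasDerivAt_amp l t z).continuousAt

/-- The labels of the coherent dyads `|e(z), s⟩⟨e(w), s'|`. -/
abbrev Label (N : ℕ) : Type := (Config N × ℂ) × (Config N × ℂ)

/-- The motion of the coherent dyads. -/
def flow (k : ℕ) (t : ℝ) (i : Label N) : Label N :=
  ((i.1.1, M.amp (M.drive k i.1.1) t i.1.2), (i.2.1, M.amp (M.drive k i.2.1) t i.2.2))

theorem flow_zero (k : ℕ) (i : Label N) : M.flow k 0 i = i := by simp [flow, amp_zero]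

theorem flow_add (k : ℕ) (s t : ℝ) (i : Label N) :
    M.flow k (s + t) i = M.flow k s (M.flow k t i) := by
  simp [flow, amp_add]

/-- The logarithmic derivative of the weight of a coherent dyad. -/
def rate (k : ℕ) (i : Label N) : ℂ :=
  M.σ * i.1.2 * conj i.2.2 - Complex.I * (M.atomEnergy i.1.1 + M.drive k i.1.1 * i.1.2) +
    Complex.I * (M.atomEnergy i.2.1 + M.drive k i.2.1 * conj i.2.2)

theorem continuous_rate (k : ℕ) (i : Label N) : Continuous fun t => M.rate k (M.flow k t i) := by
  have h1 := M.continuous_amp (M.drive k i.1.1) i.1.2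
  have h2 := Complex.continuous_conj.comp (M.continuous_amp (M.drive k i.2.1) i.2.2)
  simp only [rate, flow]
  exact ((continuous_const.mul h1).mul h2).sub
    (continuous_const.mul (continuous_const.add (continuous_const.mul h1))) |>.add
    (continuous_const.mul (continuous_const.add (continuous_const.mul h2)))

/-- The weight acquired by a coherent dyad. -/
def weight (k : ℕ) (t : ℝ) (i : Label N) : ℂ :=
  Complex.exp (∫ u in (0 : ℝ)..t, M.rate k (M.flow k u i))

theorem weight_zero (k : ℕ) (i : Label N) : M.weight k 0 i = 1 := by simp [weight]

/-- Cocycle identity over the flow; with `flow_add` it becomes the semigroup law on coherent dyads.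
-/
theorem weight_add (k : ℕ) (s t : ℝ) (i : Label N) :
    M.weight k (s + t) i = M.weight k t i * M.weight k s (M.flow k t i) := by
  have hi : ∀ a b : ℝ, IntervalIntegrable (fun u => M.rate k (M.flow k u i)) MeasureTheory.volume a b :=
    fun a b => (M.continuous_rate k i).intervalIntegrable a b
  rw [weight, weight, weight, ← Complex.exp_add,
    ← intervalIntegral.integral_add_adjacent_intervals (hi 0 t) (hi t (s + t))]
  congr 2
  have h := intervalIntegral.integral_comp_add_right (fun u => M.rate k (M.flow k u i))
    (a := 0) (b := s) t
  rw [zero_add] at h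
  rw [← h]
  simp only [flow_add]

theorem hasDerivAt_weight (k : ℕ) (t : ℝ) (i : Label N) :
    HasDerivAt (fun t => M.weight k t i) (M.weight k t i * M.rate k (M.flow k t i)) t := by
  have hc := M.continuous_rate k i
  exact (intervalIntegral.integral_hasDerivAt_right (hc.intervalIntegrable 0 t)
    (hc.stronglyMeasurableAtFilter _ _) hc.continuousAt).cexp

/-- The coherent dyad `|e(z), s⟩⟨e(w), s'|`. -/
def cohDyad (i : Label N) : TC (Space N) :=
  dyadForm (coreIncl N) (cohV i.1.1 i.1.2) (cohV i.2.1 i.2.2)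

theorem coreIncl_cohV (s : Config N) (z : ℂ) : coreIncl N (cohV s z) = incl s (expVec z) :=
  assemble_single _ _ _

theorem cohDyad_eq (i : Label N) :
    cohDyad i = TC.rankOne (incl i.1.1 (expVec i.1.2)) (incl i.2.1 (expVec i.2.2)) := by
  rw [cohDyad, dyadForm_apply, coreIncl_cohV, coreIncl_cohV]

/-- The Lindblad generator on a coherent dyad. -/
def cohLind (k : ℕ) (i : Label N) : TC (Space N) :=
  M.lindD N k (cohV i.1.1 i.1.2) (cohV i.2.1 i.2.2)

/-- The coefficient of b* e(z) is the velocity of the amplitude in `hasDerivAt_amp`; the multiple of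
e(z) that remains is absorbed by the weight. -/
theorem drift_cohV (k : ℕ) (s : Config N) (z : ℂ) : M.drift N k (cohV s z) =
    (-M.μ * z - Complex.I * M.drive k s) • incl s (numberDomain.cre (expD z)) -
      (Complex.I * (M.atomEnergy s + M.drive k s * z)) • incl s (expVec z) := by
  rw [drift, cohV, assemble_single]
  simp only [driftAt, LinearMap.sub_apply, LinearMap.smul_apply, LinearMap.add_apply, num_expD,
    ann_expD, Submodule.subtype_apply, coe_expD, map_sub, map_add, map_smul]
  module

theorem jump_cohV (s : Config N) (z : ℂ) : M.jump N (cohV s z) =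
    ((Real.sqrt M.σ : ℂ) * z) • incl s (expVec z) := by
  rw [jump, cohV, assemble_single]
  simp only [LinearMap.smul_apply, ann_expD, map_smul, smul_smul]

theorem hasDerivAt_incl_expVec (s : Config N) {a : ℝ → ℂ} {a' : ℂ} {t : ℝ}
    (ha : HasDerivAt a a' t) : HasDerivAt (fun t => incl s (expVec (a t)))
      (a' • incl s (numberDomain.cre (expD (a t)))) t := by
  have h1 := (hasDerivAt_expVec (a t)).scomp t ha
  have h2 := ((incl s).restrictScalars ℝ).hasFDerivAt.comp_hasDerivAt t h1
  refine h2.congr_deriv ?_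
  simp

/-- The coherent dyads solve the master equation. -/
theorem hasDerivAt_cohDyad (k : ℕ) (t : ℝ) (i : Label N) :
    HasDerivAt (fun t => M.weight k t i • cohDyad (M.flow k t i))
      (M.weight k t i • M.cohLind k (M.flow k t i)) t := by
  have h1 := hasDerivAt_incl_expVec i.1.1 (M.hasDerivAt_amp (M.drive k i.1.1) t i.1.2)
  have h2 := hasDerivAt_incl_expVec i.2.1 (M.hasDerivAt_amp (M.drive k i.2.1) t i.2.2)
  have h3 := TC.rankOneL.hasDerivAt_of_bilinear (fun _ => h1) (fun _ => h2)
  have h4 := (M.hasDerivAt_weight k t i).smul h3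
  simp only [cohDyad_eq]
  refine h4.congr_deriv ?_
  simp only [TC.rankOneL_apply, cohLind, lindD, lindForm_apply, drift_cohV, jump_cohV,
    coreIncl_cohV, flow, rate]
  set z := M.amp (M.drive k i.1.1) t i.1.2
  set w := M.amp (M.drive k i.2.1) t i.2.2
  have hl : ∀ (a b : ℂ) (x x' y : Space N), TC.rankOne (a • x - b • x') y =
      a • TC.rankOne x y - b • TC.rankOne x' y := fun a b x x' y => by
    rw [sub_eq_add_neg, ← neg_smul, TC.rankOne_add_left, TC.rankOne_smul_left,
      TC.rankOne_smul_left, neg_smul, ← sub_eq_add_neg]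
  have hr : ∀ (a b : ℂ) (x x' y : Space N), TC.rankOne y (a • x - b • x') =
      conj a • TC.rankOne y x - conj b • TC.rankOne y x' := fun a b x x' y => by
    rw [sub_eq_add_neg, ← neg_smul, TC.rankOne_add_right, TC.rankOne_smul_right,
      TC.rankOne_smul_right, map_neg, neg_smul, ← sub_eq_add_neg]
  rw [hl, hr, TC.rankOne_smul_left, TC.rankOne_smul_left, TC.rankOne_smul_right,
    TC.rankOne_smul_right]
  simp only [map_mul, map_sub, map_neg, map_add, Complex.conj_I, Complex.conj_ofReal, smul_add,
    smul_sub, smul_smul]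
  rw [show M.weight k t i * ((Real.sqrt M.σ : ℂ) * z * ((Real.sqrt M.σ : ℂ) * conj w)) =
    M.weight k t i * (((Real.sqrt M.σ : ℂ) * (Real.sqrt M.σ : ℂ)) * z * conj w) by ring, sqrt_σ_mul]
  module

/-! ## The semigroup -/

/-- Linear combinations of coherent dyads. -/
def cohSum (N : ℕ) : (Label N →₀ ℂ) →ₗ[ℂ] TC (Space N) := Finsupp.linearCombination ℂ cohDyad

/-- The evolution of linear combinations of coherent dyads. -/
def cohEvol (k : ℕ) (t : ℝ) : (Label N →₀ ℂ) →ₗ[ℂ] TC (Space N) :=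
  Finsupp.linearCombination ℂ fun i => M.weight k t i • cohDyad (M.flow k t i)

theorem cohSum_single (i : Label N) (c : ℂ) : cohSum N (Finsupp.single i c) = c • cohDyad i := by
  simp [cohSum]

theorem cohEvol_single (k : ℕ) (t : ℝ) (i : Label N) (c : ℂ) :
    M.cohEvol k t (Finsupp.single i c) = c • M.weight k t i • cohDyad (M.flow k t i) := by
  simp [cohEvol]

theorem cohEvol_zero (k : ℕ) : M.cohEvol (N := N) k 0 = cohSum N := by
  ext i
  simp [cohEvol, cohSum, weight_zero, flow_zero]

/-- A finite combination of moving coherent dyads is a differentiable solution curve on which the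
generator is dissipative. The bound also shows that the evolution depends only on the operator and
not on its representation by coherent dyads, so that it can be extended. -/
theorem norm_cohEvol_le (k : ℕ) {t : ℝ} (ht : 0 ≤ t) (c : Label N →₀ ℂ) :
    ‖M.cohEvol k t c‖ ≤ ‖cohSum N c‖ := by
  rw [← M.cohEvol_zero k]
  refine norm_le_of_dissipative (u := fun t => M.cohEvol k t c)
    (u' := fun t => ∑ i ∈ c.support, c i • M.weight k t i • M.cohLind k (M.flow k t i)) ht
    (fun t => ?_) fun t h hh => ?_
  · simp only [cohEvol, Finsupp.linearCombination_apply, Finsupp.sum]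
    exact HasDerivAt.fun_sum fun i _ => (M.hasDerivAt_cohDyad k t i).const_smul (c i)
  -- Coefficients and weights are put into the left vectors, which brings the combination to the
  -- form of the dissipativity lemma.
  · have h1 := norm_sum_dyadForm_le (ι := coreIncl N) (G := M.drift N k) (K := M.jump N)
      coreIncl_injective (M.dissipative k) c.support
      (fun i => (c i * M.weight k t i) • cohV (M.flow k t i).1.1 (M.flow k t i).1.2)
      (fun i => cohV (M.flow k t i).2.1 (M.flow k t i).2.2) hh
    simp only [map_smul, LinearMap.smul_apply, mul_smul, Complex.coe_smul] at h1
    exact h1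

theorem denseRange_cohSum (M : Model) : DenseRange (cohSum N) := by
  set R := (LinearMap.range (cohSum N)).topologicalClosure with hR
  have hRc : IsClosed (R : Set (TC (Space N))) := Submodule.isClosed_topologicalClosure _
  have hmem : ∀ i : Label N, cohDyad i ∈ R := fun i =>
    Submodule.le_topologicalClosure _ ⟨Finsupp.single i 1, by rw [cohSum_single, one_smul]⟩
  have h1 : ∀ φ ψ : Core N, TC.rankOne (toSpace N φ) (toSpace N ψ) ∈ R := fun φ ψ => by
    -- Taking all of the second factor reduces the transfer of graphs to a statement about dyads
    -- only.
    have := M.graphForm_finV_mem (k := 0) (Γ := R.prod ⊤) (hRc.prod isClosed_univ)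
      (fun s z s' w => ⟨hmem ((s, z), (s', w)), trivial⟩) φ ψ
    exact this.1
  have h2 := TC.dense_span_rankOne (denseRange_toSpace (N := N))
  have h3 : Submodule.span ℂ {A : TC (Space N) | ∃ x ∈ Set.range (toSpace N),
      ∃ y ∈ Set.range (toSpace N), A = TC.rankOne x y} ≤ R := by
    rw [Submodule.span_le]
    rintro A ⟨_, ⟨φ, rfl⟩, _, ⟨ψ, rfl⟩, rfl⟩
    exact h1 φ ψ
  intro x
  have h4 : x ∈ closure (R : Set (TC (Space N))) := closure_mono h3 (h2 x)
  rw [hRc.closure_eq] at h4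
  exact h4

/-- The semigroup generated by the Lindblad generator. -/
def evol (N k : ℕ) (t : ℝ≥0) : TC (Space N) →L[ℂ] TC (Space N) :=
  (M.cohEvol k t).extendOfNorm (cohSum N)

theorem evol_cohSum (k : ℕ) (t : ℝ≥0) (c : Label N →₀ ℂ) :
    M.evol N k t (cohSum N c) = M.cohEvol k t c :=
  LinearMap.extendOfNorm_eq M.denseRange_cohSum
    ⟨1, fun c => by rw [one_mul]; exact M.norm_cohEvol_le k t.2 c⟩ c

theorem norm_evol_le (k : ℕ) (t : ℝ≥0) (A : TC (Space N)) : ‖M.evol N k t A‖ ≤ ‖A‖ := by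
  have := LinearMap.norm_extendOfNorm_apply_le (f := M.cohEvol k t) (e := cohSum N)
    M.denseRange_cohSum 1 (fun c => by rw [one_mul]; exact M.norm_cohEvol_le k t.2 c) A
  rwa [one_mul] at this

theorem evol_cohDyad (k : ℕ) (t : ℝ≥0) (i : Label N) :
    M.evol N k t (cohDyad i) = M.weight k t i • cohDyad (M.flow k t i) := by
  have h := M.evol_cohSum k t (Finsupp.single i 1)
  rwa [cohSum_single, cohEvol_single, one_smul, one_smul] at h

/-- Bounded operators that agree on the coherent dyads are equal. -/
theorem ext_cohDyad (M : Model) {E : Type*} [NormedAddCommGroup E] [NormedSpace ℂ E]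
    {S T : TC (Space N) →L[ℂ] E} (h : ∀ i, S (cohDyad i) = T (cohDyad i)) : S = T := by
  have h1 : S.toLinearMap ∘ₗ cohSum N = T.toLinearMap ∘ₗ cohSum N := by
    refine Finsupp.lhom_ext fun i c => ?_
    simp [cohSum_single, h]
  refine ContinuousLinearMap.coeFn_injective (M.denseRange_cohSum.equalizer S.continuous T.continuous ?_)
  funext c
  exact congrArg (fun L => L c) h1

/-- The algebraic laws are checked on coherent dyads. Strong continuity is clear on their span and
extends by contractivity and density. -/
theorem isContractionSemigroup_evol (k : ℕ) :
    IsContractionSemigroup fun t => (M.evol N k t).toLinearMap where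
  zero := by
    have : M.evol N k 0 = ContinuousLinearMap.id ℂ _ := M.ext_cohDyad fun i => by
      rw [evol_cohDyad, NNReal.coe_zero, weight_zero, flow_zero, one_smul]; rfl
    rw [this]; rfl
  add s t := by
    have : M.evol N k (s + t) = M.evol N k s ∘L M.evol N k t := M.ext_cohDyad fun i => by
      rw [ContinuousLinearMap.comp_apply, evol_cohDyad, evol_cohDyad, map_smul, evol_cohDyad,
        smul_smul, NNReal.coe_add, weight_add, flow_add]
    rw [this]; rfl
  contraction t A := M.norm_evol_le k t A
  continuous A := by
    have hc : ∀ c : Label N →₀ ℂ,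
        Tendsto (fun t : ℝ≥0 => ‖M.evol N k t (cohSum N c) - cohSum N c‖) (𝓝 0) (𝓝 0) := by
      intro c
      rw [← tendsto_iff_norm_sub_tendsto_zero]
      simp only [evol_cohSum]
      have h1 : Continuous fun t : ℝ≥0 => M.cohEvol k t c := by
        simp only [cohEvol, Finsupp.linearCombination_apply, Finsupp.sum]
        exact continuous_finsetSum _ fun i _ => ((continuous_iff_continuousAt.2 fun t =>
          (M.hasDerivAt_cohDyad k t i).continuousAt).comp NNReal.continuous_coe).const_smul (c i)
      have h2 := h1.tendsto 0
      rwa [NNReal.coe_zero, cohEvol_zero] at h2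
    rw [Metric.tendsto_nhds]
    intro ε hε
    obtain ⟨c, hc2⟩ := Metric.denseRange_iff.1 (M.denseRange_cohSum (N := N)) A (ε / 4) (by positivity)
    filter_upwards [Metric.tendsto_nhds.1 (hc c) (ε / 4) (by positivity)] with t ht
    rw [Real.dist_0_eq_abs, abs_of_nonneg (norm_nonneg _)] at ht ⊢
    rw [dist_eq_norm] at hc2
    have e : (M.evol N k t).toLinearMap A - A = M.evol N k t (A - cohSum N c) +
        (M.evol N k t (cohSum N c) - cohSum N c) - (A - cohSum N c) := by
      rw [map_sub, ContinuousLinearMap.coe_coe]; abel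
    rw [e]
    have h4 := M.norm_evol_le k t (A - cohSum N c)
    have h5 := norm_sub_le (M.evol N k t (A - cohSum N c) +
      (M.evol N k t (cohSum N c) - cohSum N c)) (A - cohSum N c)
    have h6 := norm_add_le (M.evol N k t (A - cohSum N c)) (M.evol N k t (cohSum N c) - cohSum N c)
    linarith

theorem inGenerator_evol_cohDyad (k : ℕ) (i : Label N) :
    InGenerator (fun t => (M.evol N k t).toLinearMap) (cohDyad i) (M.cohLind k i) := by
  rw [inGenerator_iff]
  intro ε hε
  have h1 := (M.hasDerivAt_cohDyad k 0 i).isLittleO.def hε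
  rw [Metric.eventually_nhds_iff] at h1
  obtain ⟨δ, hδ, h2⟩ := h1
  refine ⟨δ, hδ, fun t ht => Or.inl ?_⟩
  have h3 := h2 (y := t) (by simpa using ht)
  rw [sub_zero, weight_zero, flow_zero, one_smul, one_smul] at h3
  rw [ContinuousLinearMap.coe_coe, evol_cohDyad, Complex.coe_smul]
  simpa using h3

/-- Lindblad semigroups, in terms of the Banach space of trace-class operators. -/
theorem isLindbladSemigroup_iff (k : ℕ)
    (T : ℝ≥0 → (traceClass (Space N) →ₗ[ℂ] traceClass (Space N))) :
    M.IsLindbladSemigroup N k T ↔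
      IsContractionSemigroup (E := TC (Space N)) T ∧ ∀ φ ψ : Core N,
        InGenerator (E := TC (Space N)) T (dyadForm (coreIncl N) (finV N φ) (finV N ψ))
          (M.lindD N k (finV N φ) (finV N ψ)) := by
  have key : ∀ φ ψ : Core N, InGenerator (E := TC (Space N)) T
      (dyadForm (coreIncl N) (finV N φ) (finV N ψ)) (M.lindD N k (finV N φ) (finV N ψ)) ↔
      Tendsto (fun t : ℝ≥0 => traceNorm (((t : ℝ) : ℂ)⁻¹ •
        ((T t ⟨dyad φ ψ, rankOne_mem_traceClass _ _⟩).1 - dyad φ ψ) - M.lindblad N k φ ψ))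
        (𝓝[>] 0) (𝓝 0) := fun φ ψ => by
    rw [← op_lindD_finV]
    rfl
  constructor
  · intro h
    exact ⟨⟨h.zero, h.add, h.contraction, h.continuous⟩, fun φ ψ => (key φ ψ).2 (h.generator φ ψ)⟩
  · rintro ⟨h, hg⟩
    exact ⟨h.zero, h.add, h.contraction, h.continuous, fun φ ψ => (key φ ψ).1 (hg φ ψ)⟩

/-- The generator is known on coherent dyads by differentiating the explicit solution; closedness of
its graph gives the number-state dyads. -/
theorem isLindbladSemigroup_evol (k : ℕ) :
    M.IsLindbladSemigroup N k fun t => (M.evol N k t).toLinearMap := by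
  have h := M.isContractionSemigroup_evol (N := N) k
  refine (M.isLindbladSemigroup_iff k _).2 ⟨h, fun φ ψ => ?_⟩
  exact M.graphForm_finV_mem (Γ := h.graph) h.isClosed_graph
    (fun s z s' w => M.inGenerator_evol_cohDyad k ((s, z), (s', w))) φ ψ

/-- The transfer in the opposite direction: the generator of T is known on coherent dyads as well,
so the explicit coherent curves are orbits of T, and these dyads span a dense subspace. -/
theorem eq_evol_of_inGenerator {k : ℕ} {T : ℝ≥0 → (TC (Space N) →ₗ[ℂ] TC (Space N))}
    (h : IsContractionSemigroup T) (hg : ∀ φ ψ : Core N, InGenerator T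
      (dyadForm (coreIncl N) (finV N φ) (finV N ψ)) (M.lindD N k (finV N φ) (finV N ψ))) :
    T = fun t => (M.evol N k t).toLinearMap := by
  have h1 : ∀ i : Label N, InGenerator T (cohDyad i) (M.cohLind k i) := fun i =>
    M.graphForm_cohV_mem (Γ := h.graph) h.isClosed_graph hg _ _ _ _
  funext t
  have h2 : (T t).mkContinuous 1 (fun A => by rw [one_mul]; exact h.contraction t A) =
      M.evol N k t := M.ext_cohDyad fun i => by
    have h3 := h.eq_of_hasDerivAt (u := fun t => M.weight k t i • cohDyad (M.flow k t i))
      (u' := fun t => M.weight k t i • M.cohLind k (M.flow k t i))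
      (fun t => M.hasDerivAt_cohDyad k t i)
      (fun t => h.inGenerator_smul (M.weight k t i) (h1 (M.flow k t i))) t
    rw [weight_zero, flow_zero, one_smul] at h3
    rw [evol_cohDyad]
    exact h3
  exact congrArg ContinuousLinearMap.toLinearMap h2

theorem eq_evol {k : ℕ} {T : ℝ≥0 → (traceClass (Space N) →ₗ[ℂ] traceClass (Space N))}
    (hT : M.IsLindbladSemigroup N k T) : T = fun t => (M.evol N k t).toLinearMap := by
  obtain ⟨h, hg⟩ := (M.isLindbladSemigroup_iff k T).1 hT
  exact M.eq_evol_of_inGenerator h hg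

theorem existsUnique_isLindbladSemigroup (N k : ℕ) : ∃! T, M.IsLindbladSemigroup N k T :=
  ⟨_, M.isLindbladSemigroup_evol k, fun _ hT => M.eq_evol hT⟩

/-- Identifies the semigroup picked by `Classical.epsilon` with the explicit one, on which all later
computations rest. -/
theorem semigroup_eq_evol (N k : ℕ) :
    M.semigroup N k = fun t => (M.evol N k t).toLinearMap :=
  M.eq_evol (Classical.epsilon_spec (M.existsUnique_isLindbladSemigroup N k).exists)

end Model

/-! ### Diagonal blocks and the reduced evolution of the cavity. -/

section Blocks

open Model

variable {N : ℕ}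

/-- `ρ ↦ ρ ⊗ |s⟩⟨s|`. -/
def blockL (s : Config N) : TC Fock →L[ℂ] TC (Space N) := TC.sandwichL (incl s) (comps s)

/-- The compression to the block of the configuration `s`. -/
def unblockL (s : Config N) : TC (Space N) →L[ℂ] TC Fock := TC.sandwichL (comps s) (incl s)

theorem comps_incl (s s' : Config N) (f : Fock) : comps s (incl s' f) = if s = s' then f else 0 := by
  rw [comps_apply, incl_apply]
  by_cases h : s = s'
  · subst h; simp
  · simp [h]

theorem unblockL_blockL (s s' : Config N) (A : TC Fock) :
    unblockL s (blockL s' A) = if s = s' then A else 0 := by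
  refine TC.op_injective ?_
  ext1 f
  have h : TC.op (unblockL s (blockL s' A)) f = comps s (incl s' (TC.op A (comps s' (incl s f)))) :=
    rfl
  rw [h, comps_incl, comps_incl]
  by_cases hs : s = s'
  · subst hs; simp
  · simp [hs]

/-- The normalized coherent dyad `exp(-z w̄) |e(z)⟩⟨e(w)|`. -/
def normDyad (z w : ℂ) : TC Fock :=
  Complex.exp (-(z * conj w)) • TC.rankOne (expVec z) (expVec w)

theorem blockL_rankOne (s : Config N) (x y : Fock) :
    blockL s (TC.rankOne x y) = TC.rankOne (incl s x) (incl s y) := by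
  rw [blockL, TC.sandwichL_rankOne, adjoint_comps]

theorem blockL_normDyad (s : Config N) (z w : ℂ) :
    blockL s (normDyad z w) = Complex.exp (-(z * conj w)) • cohDyad ((s, z), (s, w)) := by
  rw [normDyad, map_smul, blockL_rankOne, cohDyad_eq]

theorem unblockL_cohDyad (s : Config N) (i : Label N) (h1 : i.1.1 = s) (h2 : i.2.1 = s) :
    unblockL s (cohDyad i) = TC.rankOne (expVec i.1.2) (expVec i.2.2) := by
  rw [cohDyad_eq, unblockL, TC.sandwichL_rankOne, adjoint_incl, h1, h2, comps_incl, comps_incl]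
  simp

end Blocks

namespace Model

variable (M : Model) {N : ℕ}

theorem ext_normDyad (M : Model) {E : Type*} [NormedAddCommGroup E] [NormedSpace ℂ E]
    {S T : TC Fock →L[ℂ] E} (h : ∀ z w, S (normDyad z w) = T (normDyad z w)) : S = T := by
  -- Without atoms there is one configuration, so `Space 0` is a copy of the Fock space and the
  -- density of coherent dyads carries over to it.
  let s : Config 0 := Fin.elim0
  have h1 : S ∘L unblockL s = T ∘L unblockL s := M.ext_cohDyad fun i => by
    have h2 := h i.1.2 i.2.2
    rw [normDyad, map_smul, map_smul] at h2
    rw [ContinuousLinearMap.comp_apply, ContinuousLinearMap.comp_apply,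
      unblockL_cohDyad s i (Subsingleton.elim _ _) (Subsingleton.elim _ _)]
    exact smul_right_injective _ (Complex.exp_ne_zero _) h2
  ext1 A
  have h3 := congrArg (fun L => L (blockL s A)) h1
  simpa [unblockL_blockL] using h3

/-- The strength of the drive by an atom in the basis state `b`. -/
def driveOf (b : Fin 2) : ℝ := if b = 1 then M.lam else 0

/-- The basis state of the atom in the cavity; an absent atom acts like one in its ground state. -/
def occupant (k : ℕ) (s : Config N) : Fin 2 := if h : k < N then s ⟨k, h⟩ else 0

theorem drive_eq (k : ℕ) (s : Config N) : M.drive k s = M.driveOf (occupant k s) := by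
  rw [drive, driveOf, occupant]
  by_cases h : k < N
  · rw [dif_pos h, Finset.sum_eq_single ⟨k, h⟩]
    · simp
    · intro j _ hj
      rw [if_neg]
      exact fun hk => hj (Fin.ext hk)
    · simp
  · rw [dif_neg h, Finset.sum_eq_zero]
    · simp
    · intro j _
      rw [if_neg]
      have := j.2
      omega

/-- For equal configurations the atomic energies cancel, and since σ = μ + μ̄ the rate is the
derivative of -a ā', where a and a' are the two moving amplitudes. This is conservation of the trace
of |e(z)⟩⟨e(w)|, which equals exp(z w̄), and it is why `normDyad` acquires no weight. -/
theorem weight_diag (k : ℕ) (t : ℝ) (s : Config N) (z w : ℂ) :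
    M.weight k t ((s, z), (s, w)) = Complex.exp (z * conj w -
      M.amp (M.drive k s) t z * conj (M.amp (M.drive k s) t w)) := by
  have h : ∀ u : ℝ, HasDerivAt (fun u : ℝ => -(M.amp (M.drive k s) u z *
      conj (M.amp (M.drive k s) u w))) (M.rate k (M.flow k u ((s, z), (s, w)))) u := fun u => by
    have h1 := M.hasDerivAt_amp (M.drive k s) u z
    have h2 := (M.hasDerivAt_amp (M.drive k s) u w).star
    refine (h1.mul h2).neg.congr_deriv ?_
    have h3 : (M.σ : ℂ) = M.μ + conj M.μ := by
      rw [Complex.add_conj, μ_re]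
      push_cast
      ring
    simp only [rate, flow, ← starRingEnd_apply, map_sub, map_mul, map_neg, Complex.conj_I,
      Complex.conj_ofReal, h3]
    ring
  rw [weight, intervalIntegral.integral_eq_sub_of_hasDerivAt (fun u _ => h u)
    ((M.continuous_rate k _).intervalIntegrable _ _), amp_zero, amp_zero]
  congr 1
  ring

/-- The evolution of the cavity while it is driven by an atom in the basis state `b`. -/
def chan (b : Fin 2) (t : ℝ≥0) : TC Fock →L[ℂ] TC Fock :=
  unblockL (fun _ : Fin 1 => b) ∘L M.evol 1 0 t ∘L blockL (fun _ : Fin 1 => b)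

theorem evol_blockL_normDyad (k : ℕ) (t : ℝ≥0) (s : Config N) (z w : ℂ) :
    M.evol N k t (blockL s (normDyad z w)) = blockL s (normDyad
      (M.amp (M.driveOf (occupant k s)) t z) (M.amp (M.driveOf (occupant k s)) t w)) := by
  rw [blockL_normDyad, blockL_normDyad, map_smul, evol_cohDyad, weight_diag, smul_smul,
    ← Complex.exp_add]
  simp only [flow, drive_eq]
  congr 2
  ring

theorem chan_normDyad (b : Fin 2) (t : ℝ≥0) (z w : ℂ) :
    M.chan b t (normDyad z w) =
      normDyad (M.amp (M.driveOf b) t z) (M.amp (M.driveOf b) t w) := by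
  rw [chan, ContinuousLinearMap.comp_apply, ContinuousLinearMap.comp_apply, evol_blockL_normDyad,
    unblockL_blockL, if_pos rfl]
  rfl

/-- A diagonal block stays in its configuration and feels only the atom in the cavity; this reduces
the dynamics to a random choice between two channels. -/
theorem evol_blockL (k : ℕ) (t : ℝ≥0) (s : Config N) (A : TC Fock) :
    M.evol N k t (blockL s A) = blockL s (M.chan (occupant k s) t A) := by
  have h : M.evol N k t ∘L blockL s = blockL s ∘L M.chan (occupant k s) t :=
    M.ext_normDyad fun z w => by
      rw [ContinuousLinearMap.comp_apply, ContinuousLinearMap.comp_apply, evol_blockL_normDyad,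
        chan_normDyad]
  exact congrArg (fun L => L A) h

theorem chan_zero (b : Fin 2) : M.chan b 0 = ContinuousLinearMap.id ℂ _ :=
  M.ext_normDyad fun z w => by
    rw [chan_normDyad, NNReal.coe_zero, amp_zero, amp_zero]; rfl

/-! ## The state of the atoms -/

/-- The populations of the basis states of an atom. -/
def pop (b : Fin 2) : ℝ := if b = 1 then M.p else 1 - M.p

theorem atomNumber_eq : atomNumber = !![0, 0; 0, 1] := by
  ext i j
  fin_cases i <;> fin_cases j <;>
    simp [atomNumber, atomAnnih, Matrix.mul_apply, Fin.sum_univ_two, Matrix.conjTranspose_apply]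

theorem r_one_one : M.r 1 1 = M.p := by
  have h1 : (0 : ℂ) ≤ M.r 1 1 := M.r_posSemidef.diag_nonneg
  have h2 : M.p = (M.r 1 1).re := by
    simp [p, atomNumber_eq, Matrix.trace, Matrix.vecMul, dotProduct, Fin.sum_univ_two]
  rw [h2]
  exact Complex.eq_re_of_ofReal_le (r := 0) (by simpa using h1)

theorem r_zero_zero : M.r 0 0 = ((1 - M.p : ℝ) : ℂ) := by
  have h := M.r_trace
  rw [Matrix.trace, Fin.sum_univ_two, Matrix.diag_apply, Matrix.diag_apply, r_one_one] at h
  push_cast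
  linear_combination h

/-- Commuting with diag(0, 1) annihilates the off-diagonal entries; this is what gauge invariance is
for. -/
theorem r_offdiag : M.r 0 1 = 0 ∧ M.r 1 0 = 0 := by
  have h := M.r_gauge.eq
  rw [atomNumber_eq] at h
  have h1 := congrFun (congrFun h 0) 1
  have h2 := congrFun (congrFun h 1) 0
  simp [Matrix.mul_apply, Fin.sum_univ_two] at h1 h2
  exact ⟨h1, h2.symm⟩

theorem r_apply (a b : Fin 2) : M.r a b = if a = b then (M.pop a : ℂ) else 0 := by
  fin_cases a <;> fin_cases b <;>
    simp [pop, r_one_one, r_zero_zero, M.r_offdiag.1, M.r_offdiag.2]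

theorem pop_nonneg (b : Fin 2) : 0 ≤ M.pop b := by
  have h : (0 : ℂ) ≤ M.r b b := M.r_posSemidef.diag_nonneg
  rw [r_apply, if_pos rfl] at h
  exact_mod_cast h

theorem sum_pop : ∑ b, (M.pop b : ℂ) = 1 := by
  simp [Fin.sum_univ_two, pop]

/-- The probability of a configuration of the atoms. -/
def prob (s : Config N) : ℂ := ∏ j, (M.pop (s j) : ℂ)

theorem sum_prob (N : ℕ) : ∑ s : Config N, M.prob s = 1 := by
  have h := Finset.prod_univ_sum (fun _ : Fin N => (Finset.univ : Finset (Fin 2)))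
    (fun _ b => (M.pop b : ℂ))
  rw [Fintype.piFinset_univ] at h
  simp only [prob]
  rw [← h]
  simp only [sum_pop, Finset.prod_const_one]

theorem beam_apply (s s' : Config N) : M.beam N s s' = if s = s' then M.prob s else 0 := by
  rw [beam]
  by_cases h : s = s'
  · subst h
    simp [r_apply, prob]
  · rw [if_neg h]
    obtain ⟨j, hj⟩ := Function.ne_iff.1 h
    exact Finset.prod_eq_zero (Finset.mem_univ j) (by rw [r_apply, if_neg hj])

theorem tensorAtoms_beam (ρ : TC Fock) :
    (tensorAtoms (M.beam N) ρ : TC (Space N)) = ∑ s, M.prob s • blockL s ρ := by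
  have h : tensorAtoms (M.beam N) = ∑ s : Config N, M.prob s • sandwich (incl s) (comps s) := by
    rw [tensorAtoms]
    refine Finset.sum_congr rfl fun s _ => ?_
    rw [Finset.sum_eq_single s]
    · rw [beam_apply, if_pos rfl]
    · intro s' _ hs
      rw [beam_apply, if_neg hs.symm, zero_smul]
    · exact fun h => absurd (Finset.mem_univ s) h
  rw [h]
  exact LinearMap.sum_apply _ _ _

theorem traceAtoms_eq (A : TC (Space N)) :
    (traceAtoms N A : TC Fock) = ∑ s, unblockL s A :=
  LinearMap.sum_apply _ _ _

theorem traceAtoms_sum_blockL (X : Config N → TC Fock) (c : Config N → ℂ) :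
    (traceAtoms N (∑ s, c s • blockL s (X s) : TC (Space N)) : TC Fock) = ∑ s, c s • X s := by
  rw [traceAtoms_eq]
  simp only [map_sum, map_smul, unblockL_blockL, smul_ite, smul_zero]
  refine Finset.sum_congr rfl fun s _ => ?_
  simp
  rfl

/-- The evolution of the cavity for a fixed configuration of the atoms. -/
def path (s : Config N) (ρ : TC Fock) : ℕ → TC Fock
  | 0 => ρ
  | n + 1 => M.chan (occupant n s) M.τ.toNNReal (path s ρ n)

theorem stateAtStep_eq (ρ : TC Fock) (n : ℕ) :
    (M.stateAtStep N ρ n : TC (Space N)) = ∑ s, M.prob s • blockL s (M.path s ρ n) := by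
  induction n with
  | zero => exact M.tensorAtoms_beam ρ
  | succ n ih =>
    have h : (M.stateAtStep N ρ (n + 1) : TC (Space N)) =
        M.evol N n M.τ.toNNReal (M.stateAtStep N ρ n : TC (Space N)) :=
      congrArg (fun T => T M.τ.toNNReal (M.stateAtStep N ρ n)) (M.semigroup_eq_evol N n)
    rw [h, ih, map_sum]
    refine Finset.sum_congr rfl fun s _ => ?_
    rw [map_smul, evol_blockL, path]

theorem cavityStateOf_eq_sum (N : ℕ) (t : ℝ) (ρ : TC Fock) :
    (M.cavityStateOf N t ρ : TC Fock) = ∑ s : Config N, M.prob s •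
      M.chan (occupant ⌊t / M.τ⌋₊ s) (t - ⌊t / M.τ⌋₊ * M.τ).toNNReal (M.path s ρ ⌊t / M.τ⌋₊) := by
  have h : (M.state N t ρ : TC (Space N)) = M.evol N ⌊t / M.τ⌋₊ (t - ⌊t / M.τ⌋₊ * M.τ).toNNReal
      (M.stateAtStep N ρ ⌊t / M.τ⌋₊ : TC (Space N)) :=
    congrArg (fun T => T (t - ⌊t / M.τ⌋₊ * M.τ).toNNReal (M.stateAtStep N ρ ⌊t / M.τ⌋₊))
      (M.semigroup_eq_evol N ⌊t / M.τ⌋₊)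
  rw [stateAtStep_eq, map_sum] at h
  simp only [map_smul, evol_blockL] at h
  exact (congrArg (traceAtoms N) h).trans (traceAtoms_sum_blockL _ _)

/-- The averaged evolution of the cavity. -/
def step (t : ℝ≥0) : TC Fock →L[ℂ] TC Fock := ∑ b, (M.pop b : ℂ) • M.chan b t

theorem step_apply (t : ℝ≥0) (A : TC Fock) :
    M.step t A = ∑ b, (M.pop b : ℂ) • M.chan b t A := by
  simp [step]

/-- Exchanging the j-th entry of s with b is an involution of the pairs (s, b); each configuration
is then counted once for each of the two values of b. -/
theorem sum_sum_update {E : Type*} [AddCommMonoid E] (j : Fin N) (F : Config N → E) :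
    ∑ s, ∑ b, F (Function.update s j b) = 2 • ∑ s, F s := by
  have e : Function.Involutive fun q : Config N × Fin 2 => (Function.update q.1 j q.2, q.1 j) := by
    rintro ⟨s, b⟩
    simp
  calc ∑ s, ∑ b, F (Function.update s j b)
      = ∑ q : Config N × Fin 2, F (e.toPerm _ q).1 :=
        (Fintype.sum_prod_type fun q : Config N × Fin 2 => F (Function.update q.1 j q.2)).symm
    _ = ∑ q : Config N × Fin 2, F q.1 := Equiv.sum_comp (e.toPerm _) fun q => F q.1
    _ = 2 • ∑ s, F s := by
      rw [Fintype.sum_prod_type, Finset.smul_sum]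
      simp

theorem prob_update (s : Config N) (j : Fin N) (b : Fin 2) :
    M.prob (Function.update s j b) = M.pop b * ∏ i ∈ Finset.univ.erase j, (M.pop (s i) : ℂ) := by
  rw [prob, ← Finset.mul_prod_erase Finset.univ _ (Finset.mem_univ j)]
  congr 1
  · simp
  · refine Finset.prod_congr rfl fun i hi => ?_
    rw [Function.update_of_ne (Finset.ne_of_mem_erase hi)]

/-- Averaging over the state of an atom that has not interacted yet. -/
theorem sum_prob_chan (j : Fin N) (t : ℝ≥0) {X : Config N → TC Fock}
    (hX : ∀ s b, X (Function.update s j b) = X s) :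
    ∑ s, M.prob s • M.chan (s j) t (X s) = ∑ s, M.prob s • M.step t (X s) := by
  have h2 : (2 : ℂ) ≠ 0 := two_ne_zero
  -- After doubling, both sides can be resampled at atom j; the rest of the summand does not depend
  -- on that atom, so its populations factor out.
  refine smul_right_injective _ h2 ?_
  have hs : ∀ A : TC Fock, (2 : ℂ) • A = 2 • A := fun A => by
    rw [two_smul, two_nsmul]
  simp only [hs]
  rw [← sum_sum_update j, ← sum_sum_update j]
  refine Finset.sum_congr rfl fun s _ => ?_
  simp only [hX, prob_update, Function.update_self, ← Finset.sum_smul, ← Finset.sum_mul, sum_pop,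
    one_mul]
  rw [step_apply, Finset.smul_sum]
  refine Finset.sum_congr rfl fun b _ => ?_
  rw [smul_smul, mul_comm]

/-- The first n passages involve only the atoms with index below n. -/
theorem path_update (s : Config N) (ρ : TC Fock) (j : Fin N) (b : Fin 2) (n : ℕ) (hn : n ≤ j) :
    M.path (Function.update s j b) ρ n = M.path s ρ n := by
  induction n with
  | zero => rfl
  | succ n ih =>
    rw [path, path, ih (by omega)]
    have h : occupant n (Function.update s j b) = occupant n s := by
      have := j.2
      have hnN : n < N := by omega
      rw [occupant, occupant, dif_pos hnN, dif_pos hnN, Function.update_of_ne]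
      intro h
      have := congrArg Fin.val h
      simp at this
      omega
    rw [h]

theorem sum_prob_occupant (ρ : TC Fock) {n : ℕ} (hn : n < N) (t : ℝ≥0) :
    ∑ s : Config N, M.prob s • M.chan (occupant n s) t (M.path s ρ n) =
      M.step t (∑ s : Config N, M.prob s • M.path s ρ n) := by
  have h := M.sum_prob_chan (⟨n, hn⟩ : Fin N) t (X := fun s => M.path s ρ n)
    fun s b => M.path_update s ρ ⟨n, hn⟩ b n le_rfl
  simp only [map_sum, map_smul]
  rw [← h]
  refine Finset.sum_congr rfl fun s _ => ?_
  rw [occupant, dif_pos hn]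

theorem sum_prob_path (ρ : TC Fock) (n : ℕ) (hn : n ≤ N) :
    ∑ s : Config N, M.prob s • M.path s ρ n = (M.step M.τ.toNNReal)^[n] ρ := by
  induction n with
  | zero =>
    simp only [path, Function.iterate_zero, id]
    rw [← Finset.sum_smul, sum_prob, one_smul]
  | succ n ih =>
    rw [Function.iterate_succ_apply', ← ih (by omega), ← M.sum_prob_occupant ρ (by omega)]
    rfl

/-- The state of the cavity is obtained by iterating the averaged evolution. -/
theorem cavityStateOf_eq (N : ℕ) (t : ℝ) (ρ : TC Fock) (h : ⌊t / M.τ⌋₊ < N) :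
    (M.cavityStateOf N t ρ : TC Fock) = M.step (t - ⌊t / M.τ⌋₊ * M.τ).toNNReal
      ((M.step M.τ.toNNReal)^[⌊t / M.τ⌋₊] ρ) := by
  rw [cavityStateOf_eq_sum, M.sum_prob_occupant ρ h, M.sum_prob_path ρ _ h.le]

theorem discreteEvolution_eq (ρ : TC Fock) :
    (M.discreteEvolution ρ : TC Fock) = M.step M.τ.toNNReal ρ := by
  have h := M.stateAtStep_eq (N := 1) ρ 1
  have h2 : (M.discreteEvolution ρ : TC Fock) =
      traceAtoms 1 (M.stateAtStep 1 ρ 1 : TC (Space 1)) := rfl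
  rw [h2, h, traceAtoms_sum_blockL]
  exact M.sum_prob_path ρ 1 le_rfl

theorem step_zero : M.step 0 = ContinuousLinearMap.id ℂ _ := by
  simp only [step, chan_zero]
  rw [← Finset.sum_smul, sum_pop, one_smul]

theorem step_normDyad (t : ℝ≥0) (z w : ℂ) : M.step t (normDyad z w) = ∑ b, (M.pop b : ℂ) •
    normDyad (M.amp (M.driveOf b) t z) (M.amp (M.driveOf b) t w) := by
  simp only [step_apply, chan_normDyad]

end Model

/-! ## Weyl operators on the exponential vectors -/

/-- The field operator `α b - ᾱ b*` on the domain of the number operator. -/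
def fieldD (α : ℂ) : numberDomain →ₗ[ℂ] Fock :=
  α • numberDomain.ann - conj α • numberDomain.cre

/-- Skew-symmetry of the field operator with one argument in the larger domain, which contains the
exponential vectors. -/
theorem inner_toFock_fieldD (α : ℂ) (φ : FinVec) (f : numberDomain) :
    ⟪toFock φ, fieldD α f⟫ = -⟪toFock (weylGen α φ), f.1⟫ := by
  have h1 : ⟪toFock φ, numberDomain.cre f⟫ = ⟪toFock (annih φ), f.1⟫ := by
    rw [← ann_finD, ← numberDomain.inner_cre, coe_finD]
  have h2 : ⟪toFock φ, numberDomain.ann f⟫ = ⟪toFock (creat φ), f.1⟫ := by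
    rw [← cre_finD, ← inner_conj_symm, ← inner_conj_symm (numberDomain.cre (finD φ)),
      numberDomain.inner_cre, coe_finD]
  simp only [fieldD, weylGen, LinearMap.sub_apply, LinearMap.smul_apply, inner_sub_right,
    inner_smul_right, h1, h2, map_sub, map_smul, inner_sub_left, inner_smul_left, Complex.conj_conj]
  ring

/-- The Taylor coefficients of `x ↦ W(x α) φ`. -/
def weylCoeff (α : ℂ) (φ : FinVec) (k : ℕ) : Fock :=
  (k.factorial : ℂ)⁻¹ • toFock ((weylGen α ^ k) φ)

theorem weylGen_real_smul (x : ℝ) (α : ℂ) : weylGen (x * α) = (x : ℂ) • weylGen α := by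
  simp only [weylGen, map_mul, Complex.conj_ofReal]
  module

theorem real_smul_fock (x : ℝ) (v : Fock) : x • v = (x : ℂ) • v :=
  lp.ext (funext fun n => (Complex.real_smul (x := x) (z := v n)))

theorem weylCoeff_real_smul (x : ℝ) (α : ℂ) (φ : FinVec) (k : ℕ) :
    weylCoeff (x * α) φ k = x ^ k • weylCoeff α φ k := by
  rw [weylCoeff, weylCoeff, weylGen_real_smul, smul_pow, LinearMap.smul_apply, map_smul, smul_comm,
    real_smul_fock, Complex.ofReal_pow]

theorem hasSum_weylCoeff (α : ℂ) (x : ℝ) (φ : FinVec) :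
    HasSum (fun k => x ^ k • weylCoeff α φ k) (weyl (x * α) (toFock φ)) := by
  rw [weyl_toFock]
  have h := (summable_weyl (x * α) φ).of_norm.hasSum
  refine h.congr_fun fun k => ?_
  exact (weylCoeff_real_smul x α φ k).symm

theorem succ_smul_weylCoeff (α : ℂ) (φ : FinVec) (k : ℕ) :
    ((k + 1 : ℕ) : ℝ) • weylCoeff α φ (k + 1) = weylCoeff α (weylGen α φ) k := by
  rw [weylCoeff, weylCoeff, pow_succ, Module.End.mul_apply, real_smul_fock, smul_smul,
    Nat.factorial_succ]
  congr 1
  have h1 : ((k + 1 : ℕ) : ℂ) ≠ 0 := by exact_mod_cast Nat.succ_ne_zero k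
  rw [Nat.cast_mul, mul_inv, Complex.ofReal_natCast, mul_inv_cancel_left₀ h1]

theorem hasDerivAt_weyl (α : ℂ) (φ : FinVec) (x : ℝ) :
    HasDerivAt (fun x : ℝ => weyl (x * α) (toFock φ)) (weyl (x * α) (toFock (weylGen α φ))) x := by
  have hs : HasSum (fun k : ℕ => ((k : ℝ) * x ^ (k - 1)) • weylCoeff α φ k)
      (weyl (x * α) (toFock (weylGen α φ))) := by
    rw [← hasSum_nat_add_iff' 1]
    simp only [Finset.range_one, Finset.sum_singleton, Nat.cast_zero, zero_mul, zero_smul, sub_zero,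
      Nat.add_sub_cancel]
    refine (hasSum_weylCoeff α x (weylGen α φ)).congr_fun fun k => ?_
    rw [← succ_smul_weylCoeff, smul_smul, mul_comm]
  -- The majorant is the Weyl series at the parameter 2(|x| + 1)α: |x| + 1 is the radius and 2
  -- absorbs the factor k from differentiation.
  have hb : Summable fun k : ℕ => (2 * (|x| + 1)) ^ k * ‖weylCoeff α φ k‖ := by
    have h := summable_weyl (((2 * (|x| + 1) : ℝ) : ℂ) * α) φ
    refine h.congr fun k => ?_
    rw [← weylCoeff, weylCoeff_real_smul, norm_smul, Real.norm_of_nonneg (by positivity)]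
  have key := hasDerivAt_tsum_of_isPreconnected (𝕜 := ℝ) (g := fun k y => y ^ k • weylCoeff α φ k)
    (g' := fun (k : ℕ) y => ((k : ℝ) * y ^ (k - 1)) • weylCoeff α φ k) hb
    (Metric.isOpen_ball (x := (0 : ℝ)) (ε := |x| + 1)) (convex_ball _ _).isPreconnected
    (fun n y _ => (hasDerivAt_pow n y).smul_const _) ?_
    (y₀ := x) (by simp) (hasSum_weylCoeff α x φ).summable (y := x) (by simp)
  · rw [hs.tsum_eq] at key
    exact key.congr_of_eventuallyEq
      (Eventually.of_forall fun w => (hasSum_weylCoeff α w φ).tsum_eq.symm)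
  · intro n y hy
    have hy' : |y| ≤ |x| + 1 := by simpa using (Metric.mem_ball.1 hy).le
    rw [norm_smul, norm_mul, norm_pow, Real.norm_eq_abs, Real.norm_eq_abs, Nat.abs_cast]
    gcongr
    have h : (n : ℝ) ≤ 2 ^ n := by exact_mod_cast Nat.lt_two_pow_self.le
    rw [mul_pow]
    gcongr
    calc |y| ^ (n - 1) ≤ (|x| + 1) ^ (n - 1) := by gcongr
      _ ≤ (|x| + 1) ^ n := pow_le_pow_right₀ (by linarith [abs_nonneg x]) (Nat.sub_le n 1)

/-- The field operator is moved across the exponential series term by term, so W(xα)φ need not be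
shown to lie in its domain. -/
theorem inner_weyl_fieldD (α : ℂ) (x : ℝ) (φ : FinVec) (f : numberDomain) :
    ⟪weyl (x * α) (toFock φ), fieldD α f⟫ = -⟪weyl (x * α) (toFock (weylGen α φ)), f.1⟫ := by
  have hs : ∀ (φ : FinVec) (y : Fock), HasSum (fun k => ⟪x ^ k • weylCoeff α φ k, y⟫)
      ⟪weyl (x * α) (toFock φ), y⟫ := fun φ y => by
    have h := (hasSum_weylCoeff α x φ).mapL (innerSL ℂ y)
    have h2 := h.mapL (Complex.conjCLE : ℂ →L[ℝ] ℂ)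
    refine (by simpa only [ContinuousLinearEquiv.coe_coe, innerSL_apply_apply, Complex.conjCLE_apply,
      inner_conj_symm] using h2)
  refine (hs φ _).unique ((hs (weylGen α φ) f.1).neg.congr_fun fun k => ?_)
  have e : weylGen α ((weylGen α ^ k) φ) = (weylGen α ^ k) (weylGen α φ) := by
    rw [← Module.End.mul_apply, ← Module.End.mul_apply, ← pow_succ, ← pow_succ']
  simp only [weylCoeff, real_smul_fock, inner_smul_left, inner_toFock_fieldD, e, mul_neg]

/-- The expected value of `W(α) e(z)`. -/
def displaced (α z : ℂ) (x : ℝ) : Fock :=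
  Complex.exp (-(x ^ 2 * (α * conj α)) / 2 + x * (α * z)) • expVec (z - x * conj α)

theorem hasDerivAt_displaced (α z : ℂ) (x : ℝ) :
    HasDerivAt (displaced α z) (fieldD α
      (Complex.exp (-(x ^ 2 * (α * conj α)) / 2 + x * (α * z)) • expD (z - x * conj α))) x := by
  have h0 : HasDerivAt (fun x : ℝ => (x : ℂ)) 1 x := Complex.ofRealCLM.hasDerivAt
  have h1 : HasDerivAt (fun x : ℝ => z - (x : ℂ) * conj α) (-(1 * conj α)) x :=
    (h0.mul_const (conj α)).const_sub z
  have h2 := (hasDerivAt_expVec (z - x * conj α)).scomp x h1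
  have h3 := ((((h0.pow 2).mul_const (α * conj α)).neg.div_const 2).add
    (h0.mul_const (α * z))).cexp
  refine (h3.smul h2).congr_deriv ?_
  simp only [fieldD, LinearMap.sub_apply, LinearMap.smul_apply, map_smul, ann_expD,
    Function.comp_apply, Pi.add_apply, Pi.neg_apply, Pi.pow_apply]
  push_cast
  module

/-- W(xα)φ and the displaced exponential vector both solve u' = (αb - ᾱb*)u; by skew-symmetry their
inner product is constant in x. -/
theorem inner_weyl_displaced (α z : ℂ) (φ : FinVec) :
    ⟪weyl α (toFock φ), displaced α z 1⟫ = ⟪toFock φ, expVec z⟫ := by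
  set F : ℝ → ℂ := fun x => ⟪weyl (x * α) (toFock φ), displaced α z x⟫ with hF
  have hd : ∀ x, HasDerivAt F 0 x := fun x => by
    have h := (hasDerivAt_weyl α φ x).inner ℂ (hasDerivAt_displaced α z x)
    refine h.congr_deriv ?_
    rw [inner_weyl_fieldD]
    exact neg_add_cancel _
  have h := is_const_of_deriv_eq_zero (fun x => (hd x).differentiableAt) (fun x => (hd x).deriv) 1 0
  have h0 : weyl 0 (toFock φ) = toFock φ := by
    have h1 := (hasSum_weylCoeff 0 0 φ).unique (hasSum_single 0 fun n hn => by simp [hn])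
    simpa [weylCoeff] using h1
  have h4 : displaced α z 0 = expVec z := by simp [displaced]
  simp only [hF, Complex.ofReal_one, one_mul, Complex.ofReal_zero, zero_mul, h4, h0] at h
  exact h

theorem norm_weyl (α : ℂ) (f : Fock) : ‖weyl α f‖ = ‖f‖ := by
  refine congrFun (denseRange_toFock.equalizer (weyl α).continuous.norm continuous_norm ?_) f
  funext φ
  change ‖weyl α (toFock φ)‖ = ‖toFock φ‖
  rw [weyl_toFock]
  exact norm_weylSeries α φ

/-- Weyl operators displace the exponential vectors. -/
theorem weyl_expVec (α z : ℂ) : weyl α (expVec z) =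
    Complex.exp (-(α * conj α) / 2 + α * z) • expVec (z - conj α) := by
  have hv : displaced α z 1 = Complex.exp (-(α * conj α) / 2 + α * z) • expVec (z - conj α) := by
    simp [displaced]
  rw [← hv]
  have h1 : ∀ f : Fock, ⟪weyl α f, displaced α z 1⟫ = ⟪f, expVec z⟫ := fun f =>
    congrFun (denseRange_toFock.equalizer ((weyl α).continuous.inner continuous_const)
      (continuous_id.inner continuous_const)
      (funext fun φ => inner_weyl_displaced α z φ)) f
  have h2 : ‖displaced α z 1‖ ^ 2 = ‖expVec z‖ ^ 2 := by
    rw [hv, norm_smul, mul_pow, norm_expVec_sq, norm_expVec_sq, Complex.norm_exp, ← Real.exp_nat_mul,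
      ← Real.exp_add]
    congr 1
    rw [← Complex.normSq_eq_norm_sq, ← Complex.normSq_eq_norm_sq, Complex.normSq_sub,
      Complex.conj_conj, Complex.mul_conj, Complex.normSq_conj, mul_comm z α]
    have : (-(Complex.normSq α : ℂ) / 2 + α * z).re = -Complex.normSq α / 2 + (α * z).re := by
      rw [Complex.add_re]
      congr 1
      have : (-(Complex.normSq α : ℂ) / 2) = ((-Complex.normSq α / 2 : ℝ) : ℂ) := by push_cast; rfl
      rw [this, Complex.ofReal_re]
    rw [this]
    push_cast
    ring
  -- The weak identity at f = e(z) fixes the cross term, and the two vectors have equal norms, so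
  -- the square expands to zero; surjectivity of W(α) is not needed.
  have h3 : ‖weyl α (expVec z) - displaced α z 1‖ ^ 2 = 0 := by
    rw [norm_sub_sq (𝕜 := ℂ), h1, norm_weyl, h2, inner_self_eq_norm_sq]
    ring
  exact sub_eq_zero.1 (norm_eq_zero.1 (pow_eq_zero_iff two_ne_zero |>.1 h3))

/-- The normalization cancels the product z w̄, which leaves an exponent affine in z and w̄. An
affine motion of the labels therefore turns W(α) into a multiple of another Weyl operator. -/
theorem trace_weyl_normDyad (α z w : ℂ) : TC.traceL (TC.mulL (weyl α) (normDyad z w)) =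
    Complex.exp (-(α * conj α) / 2 + α * z - conj α * conj w) := by
  rw [normDyad, map_smul, map_smul, TC.mulL_rankOne, TC.traceL_rankOne, weyl_expVec,
    inner_smul_right, inner_expVec, smul_eq_mul, ← Complex.exp_add, ← Complex.exp_add]
  congr 1
  ring

/-! ## Duality -/

theorem eq_of_trace_mulL {A B : Fock →L[ℂ] Fock}
    (h : ∀ ρ, TC.traceL (TC.mulL A ρ) = TC.traceL (TC.mulL B ρ)) : A = B := by
  ext1 x
  refine ext_inner_left ℂ fun y => ?_
  simpa only [TC.mulL_rankOne, TC.traceL_rankOne] using h (TC.rankOne x y)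

/-- The sesquilinear form of the dual operator. -/
def dualForm (Φ : TC Fock →L[ℂ] TC Fock) (B : Fock →L[ℂ] Fock) : Fock →L⋆[ℂ] Fock →L[ℂ] ℂ :=
  LinearMap.mkContinuous₂
    (LinearMap.mk₂'ₛₗ (starRingEnd ℂ) (RingHom.id ℂ)
      (fun x y => TC.traceL (TC.mulL B (Φ (TC.rankOne y x))))
      (fun x x' y => by simp only [TC.rankOne_add_right, map_add])
      (fun c x y => by simp only [TC.rankOne_smul_right, map_smul])
      (fun x y y' => by simp only [TC.rankOne_add_left, map_add])
      (fun c x y => by simp only [TC.rankOne_smul_left, map_smul, RingHom.id_apply]))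
    (‖B‖ * ‖Φ‖) fun x y => by
      refine (TC.norm_traceL_mulL_le B _).trans ?_
      rw [mul_assoc, mul_assoc]
      refine mul_le_mul_of_nonneg_left ?_ (norm_nonneg B)
      refine (Φ.le_opNorm _).trans (mul_le_mul_of_nonneg_left ?_ (norm_nonneg Φ))
      rw [mul_comm]
      exact TC.norm_rankOne_le y x

/-- The dual of a bounded map on the trace-class operators. -/
def dual (Φ : TC Fock →L[ℂ] TC Fock) (B : Fock →L[ℂ] Fock) : Fock →L[ℂ] Fock :=
  ContinuousLinearMap.adjoint (InnerProductSpace.continuousLinearMapOfBilin (dualForm Φ B))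

theorem trace_dual (M : Model) (Φ : TC Fock →L[ℂ] TC Fock) (B : Fock →L[ℂ] Fock) (ρ : TC Fock) :
    TC.traceL (TC.mulL (dual Φ B) ρ) = TC.traceL (TC.mulL B (Φ ρ)) := by
  have h1 : ∀ x y, TC.traceL (TC.mulL (dual Φ B) (TC.rankOne y x)) =
      TC.traceL (TC.mulL B (Φ (TC.rankOne y x))) := fun x y => by
    rw [TC.mulL_rankOne, TC.traceL_rankOne, dual, ContinuousLinearMap.adjoint_inner_right,
      InnerProductSpace.continuousLinearMapOfBilin_apply]
    rfl
  have h : TC.traceL ∘L TC.mulL (dual Φ B) = TC.traceL ∘L TC.mulL B ∘L Φ :=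
    M.ext_normDyad fun z w => by
      have h2 := h1 (expVec w) (expVec z)
      simp only [ContinuousLinearMap.comp_apply, normDyad, map_smul, h2]
  exact congrArg (fun L => L ρ) h

theorem dual_smul (M : Model) (Φ : TC Fock →L[ℂ] TC Fock) (c : ℂ) (B : Fock →L[ℂ] Fock) :
    dual Φ (c • B) = c • dual Φ B := by
  have h : ∀ (A : Fock →L[ℂ] Fock) (ρ : TC Fock), TC.mulL (c • A) ρ = c • TC.mulL A ρ :=
    fun A ρ => TC.op_injective (by simp [TC.op_mulL])
  refine eq_of_trace_mulL fun ρ => ?_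
  rw [trace_dual M, h, h, map_smul, map_smul, trace_dual M]

namespace Model

variable (M : Model)

theorem toNNReal_τ : ((M.τ.toNNReal : ℝ≥0) : ℝ) = M.τ := Real.coe_toNNReal _ M.τ_pos.le

theorem exp_mul_conj_exp (n : ℕ) :
    Complex.exp (-n * M.μ * M.τ) * conj (Complex.exp (-n * M.μ * M.τ)) =
      ((Real.exp (-n * M.σ * M.τ) : ℝ) : ℂ) := by
  have h3 : (M.σ : ℂ) = M.μ + conj M.μ := by
    rw [Complex.add_conj, μ_re]
    push_cast
    ring
  rw [← Complex.exp_conj, ← Complex.exp_add, Complex.ofReal_exp]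
  congr 1
  push_cast
  rw [h3]
  simp only [map_mul, map_neg, map_natCast, Complex.conj_ofReal]
  ring

/-- The factor by which the dual of the discrete evolution multiplies a Weyl operator. -/
theorem dual_step_weyl (α : ℂ) : dual (M.step M.τ.toNNReal) (weyl α) =
    (Complex.exp (-(1 - Real.exp (-M.σ * M.τ)) * ‖α‖ ^ 2 / 2) * M.factor 0 α) •
      weyl (Complex.exp (-M.μ * M.τ) * α) := by
  refine eq_of_trace_mulL fun ρ => ?_
  rw [trace_dual M]
  have h : TC.traceL ∘L TC.mulL (weyl α) ∘L M.step M.τ.toNNReal =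
      TC.traceL ∘L TC.mulL ((Complex.exp (-(1 - Real.exp (-M.σ * M.τ)) * ‖α‖ ^ 2 / 2) *
        M.factor 0 α) • weyl (Complex.exp (-M.μ * M.τ) * α)) := by
    refine M.ext_normDyad fun z w => ?_
    have hc : ∀ (c : ℂ) (A : Fock →L[ℂ] Fock) (ρ : TC Fock), TC.mulL (c • A) ρ = c • TC.mulL A ρ :=
      fun c A ρ => TC.op_injective (by simp [TC.op_mulL])
    have e1 := M.exp_mul_conj_exp 1
    simp only [Nat.cast_one, neg_mul, one_mul] at e1
    have e2 : conj (Complex.exp (-M.μ * M.τ)) = Complex.exp (-conj M.μ * M.τ) := by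
      rw [← Complex.exp_conj]
      simp
    have e3 : ((‖α‖ : ℂ)) ^ 2 = α * conj α := by rw [Complex.mul_conj']
    have e5 : Complex.exp (-M.μ * M.τ) * Complex.exp (-conj M.μ * M.τ) =
        ((Real.exp (-M.σ * M.τ) : ℝ) : ℂ) := by
      rw [← e2]
      simpa using e1
    -- One identity for every drive l: averaging the cases l = 0 and l = λ with weights 1 - p and p
    -- produces the factor of index 0.
    have key : ∀ l : ℝ, Complex.exp (-(α * conj α) / 2 + α * M.amp l M.τ z -
        conj α * conj (M.amp l M.τ w)) =
        Complex.exp (-(1 - Real.exp (-M.σ * M.τ)) * ‖α‖ ^ 2 / 2) * Complex.exp (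
          -(Complex.I * l / M.μ) * (1 - Complex.exp (-M.μ * M.τ)) * α -
          (Complex.I * l / conj M.μ) * (1 - Complex.exp (-conj M.μ * M.τ)) * conj α) *
        Complex.exp (-(Complex.exp (-M.μ * M.τ) * α * conj (Complex.exp (-M.μ * M.τ) * α)) / 2 +
          Complex.exp (-M.μ * M.τ) * α * z -
          conj (Complex.exp (-M.μ * M.τ) * α) * conj w) := fun l => by
      have e4 : conj (M.amp l M.τ w) = Complex.exp (-conj M.μ * M.τ) * conj w +
          Complex.I * l / conj M.μ * (1 - Complex.exp (-conj M.μ * M.τ)) := by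
        simp only [amp, map_sub, map_mul, map_div₀, Complex.conj_I, Complex.conj_ofReal, e2,
          map_one]
        ring
      rw [← Complex.exp_add, ← Complex.exp_add, e3, e4, map_mul, e2, ← e5, amp]
      congr 1
      ring
    have h0 := key 0
    have h1 := key M.lam
    simp only [Complex.ofReal_zero, mul_zero, zero_div, neg_zero, zero_mul, sub_zero,
      Complex.exp_zero, mul_one] at h0
    simp only [ContinuousLinearMap.comp_apply, step_normDyad, map_add, map_smul, hc,
      trace_weyl_normDyad, Fin.sum_univ_two, pop, driveOf, smul_eq_mul, factor, toNNReal_τ,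
      zero_ne_one, if_false, if_true]
    rw [h0, h1]
    simp only [Nat.cast_zero, neg_zero, zero_mul, Complex.exp_zero, mul_one]
    push_cast
    ring
  exact congrArg (fun L => L ρ) h

/-- One more passage shifts the index; by iteration the factor of index 0 builds the whole product.
-/
theorem factor_exp_mul (k : ℕ) (α : ℂ) :
    M.factor k (Complex.exp (-M.μ * M.τ) * α) = M.factor (k + 1) α := by
  have e2 : conj (Complex.exp (-M.μ * M.τ)) = Complex.exp (-conj M.μ * M.τ) := by
    rw [← Complex.exp_conj]
    simp
  have e3 : ∀ ν : ℂ, Complex.exp (-(k + 1 : ℕ) * ν * M.τ) =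
      Complex.exp (-k * ν * M.τ) * Complex.exp (-ν * M.τ) := fun ν => by
    rw [← Complex.exp_add]
    congr 1
    push_cast
    ring
  simp only [factor, map_mul, e2, e3]
  congr 3
  ring

theorem dual_iterate_weyl (n : ℕ) (α : ℂ) : (dual (M.step M.τ.toNNReal))^[n] (weyl α) =
    (Complex.exp (-(1 - Real.exp (-n * M.σ * M.τ)) * ‖α‖ ^ 2 / 2) *
      ∏ k ∈ Finset.range n, M.factor k α) • weyl (Complex.exp (-n * M.μ * M.τ) * α) := by
  have hs : ∀ (n : ℕ) (c : ℂ) (B : Fock →L[ℂ] Fock), (dual (M.step M.τ.toNNReal))^[n] (c • B) =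
      c • (dual (M.step M.τ.toNNReal))^[n] B := fun n c => by
    induction n with
    | zero => intro B; rfl
    | succ n ih => intro B; rw [Function.iterate_succ_apply, dual_smul M, ih,
        Function.iterate_succ_apply]
  induction n generalizing α with
  | zero => simp
  | succ n ih =>
    rw [Function.iterate_succ_apply, dual_step_weyl, hs, ih, smul_smul]
    simp only [factor_exp_mul]
    have e1 : ((‖Complex.exp (-M.μ * M.τ) * α‖ : ℂ)) ^ 2 =
        ((Real.exp (-M.σ * M.τ) : ℝ) : ℂ) * ‖α‖ ^ 2 := by
      have := M.exp_mul_conj_exp 1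
      simp only [Nat.cast_one, neg_mul, one_mul] at this
      rw [norm_mul, Complex.ofReal_mul, mul_pow, ← Complex.mul_conj', neg_mul, this, neg_mul]
    have e2 : Real.exp (-(n + 1 : ℕ) * M.σ * M.τ) =
        Real.exp (-n * M.σ * M.τ) * Real.exp (-M.σ * M.τ) := by
      rw [← Real.exp_add]
      congr 1
      push_cast
      ring
    have e3 : Complex.exp (-n * M.μ * M.τ) * (Complex.exp (-M.μ * M.τ) * α) =
        Complex.exp (-(n + 1 : ℕ) * M.μ * M.τ) * α := by
      rw [← mul_assoc, ← Complex.exp_add]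
      refine congrArg (fun x => Complex.exp x * α) ?_
      push_cast
      ring
    -- With q = exp(-στ) this is (1 - q) + (1 - qⁿ)q = 1 - qⁿ⁺¹.
    have e4 : Complex.exp (-(1 - Real.exp (-M.σ * M.τ)) * ‖α‖ ^ 2 / 2) *
        Complex.exp (-(1 - Real.exp (-n * M.σ * M.τ)) *
          ‖Complex.exp (-M.μ * M.τ) * α‖ ^ 2 / 2) =
        Complex.exp (-(1 - Real.exp (-(n + 1 : ℕ) * M.σ * M.τ)) * ‖α‖ ^ 2 / 2) := by
      rw [← Complex.exp_add, e1, e2]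
      refine congrArg Complex.exp ?_
      rw [Complex.ofReal_mul]
      ring
    rw [e3, Finset.prod_range_succ' _ n, ← e4]
    refine congrArg (fun c : ℂ => c • _) ?_
    ring

/-- The dual of the discrete evolution and its powers on the Weyl operators. -/
theorem exists_dual : ∃ Ψ : (Fock →L[ℂ] Fock) → (Fock →L[ℂ] Fock), IsDual M.discreteEvolution Ψ ∧
    ∀ (n : ℕ) (α : ℂ), Ψ^[n] (weyl α) =
      (Complex.exp (-(1 - Real.exp (-n * M.σ * M.τ)) * ‖α‖ ^ 2 / 2) *
        ∏ k ∈ Finset.range n, M.factor k α) • weyl (Complex.exp (-n * M.μ * M.τ) * α) := by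
  refine ⟨dual (M.step M.τ.toNNReal), fun B ρ => ?_, M.dual_iterate_weyl⟩
  have h := trace_dual M (M.step M.τ.toNNReal) B ρ
  exact h.trans (congrArg (fun A => TC.traceL (TC.mulL B A)) (M.discreteEvolution_eq ρ).symm)

theorem trace_weyl_iterate_step (n : ℕ) (α : ℂ) (ρ : TC Fock) :
    TC.traceL (TC.mulL (weyl α) ((M.step M.τ.toNNReal)^[n] ρ)) =
      Complex.exp (-(1 - Real.exp (-n * M.σ * M.τ)) * ‖α‖ ^ 2 / 2) *
        (∏ k ∈ Finset.range n, M.factor k α) *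
          TC.traceL (TC.mulL (weyl (Complex.exp (-n * M.μ * M.τ) * α)) ρ) := by
  have h : ∀ (n : ℕ) (B : Fock →L[ℂ] Fock) (ρ : TC Fock),
      TC.traceL (TC.mulL B ((M.step M.τ.toNNReal)^[n] ρ)) =
        TC.traceL (TC.mulL ((dual (M.step M.τ.toNNReal))^[n] B) ρ) := fun n => by
    induction n with
    | zero => intro B ρ; rfl
    | succ n ih =>
      intro B ρ
      rw [Function.iterate_succ_apply', ← trace_dual M, ih, Function.iterate_succ_apply]
  have hc : ∀ (c : ℂ) (A : Fock →L[ℂ] Fock) (ρ : TC Fock), TC.mulL (c • A) ρ = c • TC.mulL A ρ :=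
    fun c A ρ => TC.op_injective (by simp [TC.op_mulL])
  rw [h, dual_iterate_weyl, hc, map_smul, smul_eq_mul]

end Model

/-! ## Convergence to the limiting state -/

theorem norm_incl_le {N : ℕ} (s : Config N) : ‖incl s‖ ≤ 1 := by
  refine ContinuousLinearMap.opNorm_le_bound _ zero_le_one fun f => ?_
  have h : ‖incl s f‖ ^ 2 = ‖f‖ ^ 2 := by
    rw [← inner_self_eq_norm_sq (𝕜 := ℂ), inner_incl_right, ← comps_apply, comps_incl, if_pos rfl,
      inner_self_eq_norm_sq]
  rw [one_mul]
  exact (pow_le_pow_iff_left₀ (norm_nonneg _) (norm_nonneg _) two_ne_zero).1 h.le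

theorem norm_comps_le {N : ℕ} (s : Config N) : ‖comps s‖ ≤ 1 := by
  rw [← LinearIsometryEquiv.norm_map ContinuousLinearMap.adjoint, adjoint_comps]
  exact norm_incl_le s

theorem norm_sandwichL_apply_le {H K : Type*} [NormedAddCommGroup H] [InnerProductSpace ℂ H]
    [CompleteSpace H] [NormedAddCommGroup K] [InnerProductSpace ℂ K] [CompleteSpace K]
    {S : H →L[ℂ] K} {R : K →L[ℂ] H} (hS : ‖S‖ ≤ 1) (hR : ‖R‖ ≤ 1) (A : TC H) :
    ‖TC.sandwichL S R A‖ ≤ ‖A‖ := by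
  have h := TC.norm_sandwich_le S R A
  refine h.trans (mul_le_of_le_one_left (norm_nonneg _) ?_)
  exact mul_le_one₀ hS (norm_nonneg _) hR

theorem contDiff_rankOne {H E : Type*} [NormedAddCommGroup H] [InnerProductSpace ℂ H]
    [CompleteSpace H] [NormedAddCommGroup E] [NormedSpace ℝ E] {f g : E → H} (hf : ContDiff ℝ 1 f)
    (hg : ContDiff ℝ 1 g) : ContDiff ℝ 1 fun p => TC.rankOne (f p) (g p) :=
  ((ContinuousLinearMap.contDiff (TC.rankOneL (H := H))).comp hf).clm_apply hg

theorem contDiff_rankOne_expVec :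
    ContDiff ℝ 1 fun p : ℂ × ℂ => TC.rankOne (expVec p.1) (expVec p.2) := by
  have h0 : Differentiable ℂ expVec := fun z => (hasDerivAt_expVec z).differentiableAt
  have h1 := (h0.contDiff (n := 1)).restrict_scalars ℝ
  exact contDiff_rankOne (h1.comp contDiff_fst) (h1.comp contDiff_snd)

/-- The dyads depend on their labels in a real C¹ way for the trace norm, so convergence of labels
becomes convergence of states. -/
theorem locallyLipschitz_normDyad : LocallyLipschitz fun p : ℂ × ℂ => normDyad p.1 p.2 := by
  have h6 : ContDiff ℝ 1 fun p : ℂ × ℂ => conj p.2 := Complex.conjCLE.contDiff.comp 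
    contDiff_snd
  have h7 := (((contDiff_fst (E := ℂ)).mul h6).neg.cexp).smul contDiff_rankOne_expVec
  exact h7.locallyLipschitz

theorem mem_of_normDyad_mem (M : Model) {Γ : Submodule ℂ (TC Fock)}
    (hc : IsClosed (Γ : Set (TC Fock))) (h : ∀ z w, normDyad z w ∈ Γ) (A : TC Fock) : A ∈ Γ := by
  -- The quotient map by the closed subspace vanishes on all normalized dyads, hence everywhere.
  have h1 : Γ.mkQL = 0 := M.ext_normDyad fun z w => by
    simpa using h z w
  have h2 := congrArg (fun L => L A) h1
  simpa using h2

theorem traceL_normDyad (z w : ℂ) : TC.traceL (normDyad z w) = 1 := by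
  rw [normDyad, map_smul, TC.traceL_rankOne, inner_expVec, smul_eq_mul, ← Complex.exp_add,
    mul_comm (conj w), neg_add_cancel, Complex.exp_zero]

namespace Model

variable (M : Model)

theorem norm_chan_le (b : Fin 2) (t : ℝ≥0) (A : TC Fock) : ‖M.chan b t A‖ ≤ ‖A‖ :=
  (norm_sandwichL_apply_le (norm_comps_le _) (norm_incl_le _) _).trans
    ((M.norm_evol_le _ t _).trans
      (norm_sandwichL_apply_le (norm_incl_le _) (norm_comps_le _) _))

theorem norm_sum_pop_smul_le {E : Type*} [NormedAddCommGroup E] [NormedSpace ℂ E] {X : Fin 2 → E}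
    {c : ℝ} (h : ∀ b, ‖X b‖ ≤ c) : ‖∑ b, (M.pop b : ℂ) • X b‖ ≤ c := by
  have h1 : ∑ b, M.pop b = 1 := by exact_mod_cast M.sum_pop
  calc ‖∑ b, (M.pop b : ℂ) • X b‖ ≤ ∑ b, M.pop b * c := norm_sum_le_of_le _ fun b _ => by
        rw [norm_smul, Complex.norm_real, Real.norm_of_nonneg (M.pop_nonneg b)]
        exact mul_le_mul_of_nonneg_left (h b) (M.pop_nonneg b)
    _ = c := by rw [← Finset.sum_mul, h1, one_mul]

theorem norm_step_le (t : ℝ≥0) (A : TC Fock) : ‖M.step t A‖ ≤ ‖A‖ := by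
  rw [step_apply]
  exact M.norm_sum_pop_smul_le fun b => M.norm_chan_le b t A

/-- The passage of one atom. -/
def pass : TC Fock →L[ℂ] TC Fock := M.step M.τ.toNNReal

theorem norm_pass_pow_le (n : ℕ) (A : TC Fock) : ‖(M.pass ^ n) A‖ ≤ ‖A‖ := by
  induction n generalizing A with
  | zero => simp
  | succ n ih =>
    rw [pow_succ, mul_apply_eq_comp]
    exact (ih _).trans (M.norm_step_le _ A)

/-- The rate at which an atom contracts the amplitudes. -/
def decay : ℝ := Real.exp (-M.σ * M.τ / 2)

theorem decay_pos : 0 < M.decay := Real.exp_pos _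

theorem decay_lt_one : M.decay < 1 :=
  Real.exp_lt_one_iff.2 (by linarith [mul_pos M.σ_pos M.τ_pos])

theorem norm_exp_μ_τ : ‖Complex.exp (-M.μ * M.τ)‖ = M.decay := by
  rw [Complex.norm_exp, decay, Complex.re_mul_ofReal, Complex.neg_re, μ_re]
  congr 1
  ring

/-- The displacement of the amplitudes by an atom in the basis state `b`. -/
def shift (b : Fin 2) : ℂ := M.amp (M.driveOf b) M.τ 0

theorem amp_eq_add_shift (b : Fin 2) (z : ℂ) :
    M.amp (M.driveOf b) M.τ z = Complex.exp (-M.μ * M.τ) * z + M.shift b := by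
  simp only [shift, amp]
  ring

/-- The map of the labels of the coherent dyads by an atom in the basis state `b`. -/
def passLabel (b : Fin 2) (i : ℂ × ℂ) : ℂ × ℂ :=
  Complex.exp (-M.μ * M.τ) • i + (M.shift b, M.shift b)

theorem pass_normDyad (i : ℂ × ℂ) : M.pass (normDyad i.1 i.2) = ∑ b, (M.pop b : ℂ) •
    normDyad (M.passLabel b i).1 (M.passLabel b i).2 := by
  simp only [pass, step_normDyad, toNNReal_τ, amp_eq_add_shift]
  rfl

theorem norm_passLabel_sub (b : Fin 2) (i j : ℂ × ℂ) :
    ‖M.passLabel b i - M.passLabel b j‖ = M.decay * ‖i - j‖ := by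
  rw [passLabel, passLabel, add_sub_add_right_eq_sub, ← smul_sub, norm_smul, norm_exp_μ_τ]

/-- On a large invariant ball the passage of an atom contracts the differences of dyads. -/
theorem exists_pass_contraction (B₀ : ℝ) : ∃ B ≥ B₀, ∃ K : ℝ, 0 ≤ K ∧ 0 ≤ B ∧
    (∀ b, ∀ i : ℂ × ℂ, ‖i‖ ≤ B → ‖M.passLabel b i‖ ≤ B) ∧
    ∀ (n : ℕ) (i j : ℂ × ℂ), ‖i‖ ≤ B → ‖j‖ ≤ B →
      ‖(M.pass ^ n) (normDyad i.1 i.2 - normDyad j.1 j.2)‖ ≤ K * M.decay ^ n * ‖i - j‖ := by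
  have hq : 0 < 1 - M.decay := sub_pos.2 M.decay_lt_one
  set S := ∑ b, ‖M.shift b‖ with hS
  have hS0 : 0 ≤ S := Finset.sum_nonneg fun b _ => norm_nonneg _
  -- The radius B ≥ S/(1 - q), with q the decay factor, gives qB + S ≤ B, so the ball is invariant
  -- under the label maps; on this compact ball a single Lipschitz constant serves for all n.
  set B := max B₀ (S / (1 - M.decay)) with hB
  have hB0 : 0 ≤ B := (div_nonneg hS0 hq.le).trans (le_max_right _ _)
  have hSB : S ≤ (1 - M.decay) * B := by
    rw [← div_le_iff₀' hq]
    exact le_max_right _ _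
  have hinv : ∀ b, ∀ i : ℂ × ℂ, ‖i‖ ≤ B → ‖M.passLabel b i‖ ≤ B := fun b i hi => by
    have h1 : ‖M.shift b‖ ≤ S :=
      Finset.single_le_sum (f := fun b => ‖M.shift b‖) (fun b _ => norm_nonneg _)
        (Finset.mem_univ b)
    have h2 : ‖(M.shift b, M.shift b)‖ = ‖M.shift b‖ := by rw [Prod.norm_mk, max_self]
    have h3 : ‖M.passLabel b i‖ ≤ M.decay * ‖i‖ + ‖M.shift b‖ := by
      rw [passLabel, ← h2, ← norm_exp_μ_τ, ← norm_smul]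
      exact norm_add_le _ _
    nlinarith [mul_le_mul_of_nonneg_left hi M.decay_pos.le]
  obtain ⟨K, hK⟩ := (locallyLipschitz_normDyad.locallyLipschitzOn).exists_lipschitzOnWith_of_compact
    (isCompact_closedBall (0 : ℂ × ℂ) B)
  refine ⟨B, le_max_left _ _, K, K.2, hB0, hinv, fun n => ?_⟩
  induction n with
  | zero =>
    intro i j hi hj
    rw [pow_zero, pow_zero, mul_one]
    exact hK.norm_sub_le (mem_closedBall_zero_iff.2 hi) (mem_closedBall_zero_iff.2 hj)
  | succ n ih =>
    intro i j hi hj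
    rw [pow_succ, mul_apply_eq_comp, map_sub, pass_normDyad, pass_normDyad,
      ← Finset.sum_sub_distrib]
    simp only [← smul_sub, map_sum, map_smul]
    refine M.norm_sum_pop_smul_le fun b => ?_
    refine (ih _ _ (hinv b i hi) (hinv b j hj)).trans (le_of_eq ?_)
    rw [norm_passLabel_sub]
    ring

/-- Consecutive states differ by an average of n-fold passages of `normDyad i - normDyad 0 0`, where
i is a label reached from 0 by one atom; their norms decay geometrically. -/
theorem cauchySeq_pass_pow : CauchySeq fun n => (M.pass ^ n) (normDyad 0 0) := by
  obtain ⟨B, -, K, hK, hB, hinv, h⟩ := M.exists_pass_contraction 0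
  refine cauchySeq_of_le_geometric M.decay (K * B) M.decay_lt_one fun n => ?_
  have h0 : ‖(0 : ℂ × ℂ)‖ ≤ B := by rwa [norm_zero]
  rw [dist_comm, dist_eq_norm, pow_succ, mul_apply_eq_comp, ← map_sub]
  have h1 : M.pass (normDyad 0 0) - normDyad 0 0 = ∑ b, (M.pop b : ℂ) •
      (normDyad (M.passLabel b 0).1 (M.passLabel b 0).2 - normDyad 0 0) := by
    simp only [smul_sub, Finset.sum_sub_distrib, ← Finset.sum_smul, sum_pop, one_smul]
    rw [← M.pass_normDyad 0]
    rfl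
  rw [h1]
  simp only [map_sum, map_smul]
  refine M.norm_sum_pop_smul_le fun b => ?_
  refine (h n _ 0 (hinv b 0 h0) h0).trans ?_
  rw [sub_zero, mul_right_comm]
  have := M.decay_pos.le
  gcongr
  exact hinv b 0 h0

/-- The limiting state. -/
def limitState : TC Fock := limUnder atTop fun n => (M.pass ^ n) (normDyad 0 0)

theorem tendsto_limitState :
    Tendsto (fun n => (M.pass ^ n) (normDyad 0 0)) atTop (𝓝 M.limitState) :=
  M.cauchySeq_pass_pow.tendsto_limUnder

theorem pass_limitState : M.pass M.limitState = M.limitState := by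
  have h1 := (M.pass.continuous.tendsto _).comp M.tendsto_limitState
  refine tendsto_nhds_unique h1 ?_
  refine ((tendsto_add_atTop_iff_nat 1).2 M.tendsto_limitState).congr fun n => ?_
  rw [pow_succ']
  rfl

/-- The operators with this property form a subspace, closed because the passages are uniformly
contractive. It contains every normalized dyad, since such a dyad merges with the vacuum dyad. -/
theorem tendsto_pass_pow (A : TC Fock) :
    Tendsto (fun n => (M.pass ^ n) A) atTop (𝓝 (TC.traceL A • M.limitState)) := by
  let Γ : Submodule ℂ (TC Fock) :=
    { carrier := {A | Tendsto (fun n => (M.pass ^ n) A) atTop (𝓝 (TC.traceL A • M.limitState))}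
      zero_mem' := by simp
      add_mem' := fun {A B} hA hB => by
        simpa only [Set.mem_ofPred_eq, map_add, add_smul] using hA.add hB
      smul_mem' := fun c A hA => by
        simpa only [Set.mem_ofPred_eq, map_smul, smul_eq_mul, mul_smul] using hA.const_smul c }
  refine mem_of_normDyad_mem M (Γ := Γ) ?_ (fun z w => ?_) A
  · refine isClosed_of_closure_subset fun A hA => ?_
    refine Metric.tendsto_atTop.2 fun ε hε => ?_
    set T := ‖TC.traceL‖ * ‖M.limitState‖ with hT
    have hT0 : 0 ≤ T := by positivity
    obtain ⟨A', hA', hd⟩ := Metric.mem_closure_iff.1 hA (ε / (2 * (1 + T))) (by positivity)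
    obtain ⟨n₀, hn⟩ := Metric.tendsto_atTop.1 hA' (ε / 2) (half_pos hε)
    refine ⟨n₀, fun n hn' => ?_⟩
    have h1 := hn n hn'
    rw [dist_eq_norm] at h1 hd ⊢
    have h2 : (M.pass ^ n) A - TC.traceL A • M.limitState = (M.pass ^ n) (A - A') -
        TC.traceL (A - A') • M.limitState +
        ((M.pass ^ n) A' - TC.traceL A' • M.limitState) := by
      simp only [map_sub, sub_smul]
      abel
    have h3 : ‖TC.traceL (A - A') • M.limitState‖ ≤ T * ‖A - A'‖ := by
      rw [norm_smul, hT, mul_right_comm]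
      exact mul_le_mul_of_nonneg_right (TC.traceL.le_opNorm _) (norm_nonneg _)
    have h4 := M.norm_pass_pow_le n (A - A')
    rw [lt_div_iff₀ (by positivity)] at hd
    rw [h2]
    have h5 := norm_add_le ((M.pass ^ n) (A - A') - TC.traceL (A - A') • M.limitState)
      ((M.pass ^ n) A' - TC.traceL A' • M.limitState)
    have h6 := norm_sub_le ((M.pass ^ n) (A - A')) (TC.traceL (A - A') • M.limitState)
    nlinarith
  · change Tendsto _ _ _
    rw [traceL_normDyad, one_smul]
    obtain ⟨B, hB, K, hK, hB0, -, h⟩ := M.exists_pass_contraction ‖(z, w)‖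
    have h1 : Tendsto (fun n => (M.pass ^ n) (normDyad z w - normDyad 0 0)) atTop (𝓝 0) := by
      refine squeeze_zero_norm (fun n => h n (z, w) 0 hB (by rwa [norm_zero])) ?_
      have := (tendsto_pow_atTop_nhds_zero_of_lt_one M.decay_pos.le M.decay_lt_one).const_mul K
      simpa using this.mul_const ‖(z, w) - 0‖
    simpa using h1.add M.tendsto_limitState

theorem traceL_pass (A : TC Fock) : TC.traceL (M.pass A) = TC.traceL A := by
  have h : TC.traceL ∘L M.pass = TC.traceL := M.ext_normDyad fun z w => by
    rw [ContinuousLinearMap.comp_apply, M.pass_normDyad (z, w)]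
    simp only [map_sum, map_smul, traceL_normDyad, smul_eq_mul, mul_one, sum_pop]
  exact congrArg (fun L => L A) h

/-- Equal labels remain equal, so the vacuum evolves as a mixture of coherent projections; no
general statement about positivity of the channels is required. -/
theorem isPositive_pass_pow (n : ℕ) (z : ℂ) : (TC.op ((M.pass ^ n) (normDyad z z))).IsPositive := by
  induction n generalizing z with
  | zero =>
    have h : Complex.exp (-(z * conj z)) = ((Real.exp (-Complex.normSq z) : ℝ) : ℂ) := by
      rw [Complex.mul_conj, Complex.ofReal_exp, Complex.ofReal_neg]
    rw [pow_zero, one_apply_eq_self, normDyad, map_smul, h]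
    refine (InnerProductSpace.isPositive_rankOne_self (expVec z)).smul_of_nonneg ?_
    exact_mod_cast (Real.exp_pos _).le
  | succ n ih =>
    rw [pow_succ, mul_apply_eq_comp, M.pass_normDyad (z, z)]
    simp only [map_sum, map_smul]
    refine Finset.sum_induction _ _ (fun _ _ => ContinuousLinearMap.IsPositive.add)
      ContinuousLinearMap.isPositive_zero fun b _ => ?_
    refine (ih _).smul_of_nonneg ?_
    exact_mod_cast M.pop_nonneg b

theorem traceL_pass_pow (n : ℕ) (A : TC Fock) : TC.traceL ((M.pass ^ n) A) = TC.traceL A := by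
  induction n generalizing A with
  | zero => rfl
  | succ n ih => rw [pow_succ, mul_apply_eq_comp, ih, traceL_pass]

theorem isDensity_limitState : IsDensity M.limitState := by
  constructor
  · have h : Tendsto (fun n => TC.op ((M.pass ^ n) (normDyad 0 0))) atTop
        (𝓝 (TC.op M.limitState)) := (TC.opL.continuous.tendsto _).comp M.tendsto_limitState
    have h1 : ∀ x, Tendsto (fun n => ⟪TC.op ((M.pass ^ n) (normDyad 0 0)) x, x⟫) atTop
        (𝓝 ⟪TC.op M.limitState x, x⟫) := fun x =>
      ((ContinuousLinearMap.apply ℂ Fock x).continuous.tendsto _ |>.comp h).inner tendsto_const_nhds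
    have h2 := fun n => (ContinuousLinearMap.isPositive_iff_complex _).1 (M.isPositive_pass_pow n 0)
    refine (ContinuousLinearMap.isPositive_iff_complex _).2 fun x => ?_
    have h3 := (Complex.continuous_re.tendsto _).comp (h1 x)
    exact ⟨tendsto_nhds_unique ((Complex.continuous_ofReal.tendsto _).comp h3)
      ((h1 x).congr fun n => (h2 n x).1.symm), ge_of_tendsto' h3 fun n => (h2 n x).2⟩
  · have h := (TC.traceL.continuous.tendsto _).comp M.tendsto_limitState
    refine tendsto_nhds_unique h ?_
    refine tendsto_const_nhds.congr fun n => ?_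
    rw [Function.comp_apply, traceL_pass_pow, traceL_normDyad]

end Model

/-! ## The cavity state and its characteristic function -/

namespace Model

variable (M : Model)

theorem cavityState_eq (t : ℝ) (ρ : TC Fock) : (M.cavityState t ρ : TC Fock) =
    M.step (t - ⌊t / M.τ⌋₊ * M.τ).toNNReal ((M.pass ^ ⌊t / M.τ⌋₊) ρ) := by
  rw [FunLike.coe_pow_eq_iterate]
  exact M.cavityStateOf_eq _ t ρ (Nat.lt_succ_self _)

theorem cavityStateOf_eq_cavityState (N : ℕ) (t : ℝ) (ρ : traceClass Fock) (h : ⌊t / M.τ⌋₊ < N) :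
    M.cavityStateOf N t ρ = M.cavityState t ρ :=
  (M.cavityStateOf_eq N t ρ h).trans (M.cavityStateOf_eq _ t ρ (Nat.lt_succ_self _)).symm

theorem omega_eq (t : ℝ) (ρ : TC Fock) (A : Fock →L[ℂ] Fock) : M.omega t ρ A =
    TC.traceL (TC.mulL A (M.step (t - ⌊t / M.τ⌋₊ * M.τ).toNNReal
      ((M.pass ^ ⌊t / M.τ⌋₊) ρ))) :=
  congrArg (fun B => TC.traceL (TC.mulL A B)) (M.cavityState_eq t ρ)

theorem omega_nat_mul (n : ℕ) (ρ : TC Fock) (A : Fock →L[ℂ] Fock) : M.omega (n * M.τ) ρ A =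
    TC.traceL (TC.mulL A ((M.pass ^ n) ρ)) := by
  rw [omega_eq, mul_div_cancel_right₀ _ M.τ_pos.ne', Nat.floor_natCast, sub_self, Real.toNNReal_zero,
    step_zero, ContinuousLinearMap.id_apply]

theorem traceL_of_isDensity {ρ : TC Fock} (h : IsDensity ρ) : TC.traceL ρ = 1 := h.2

theorem tendsto_pass_pow_of_isDensity {ρ : TC Fock} (h : IsDensity ρ) :
    Tendsto (fun n => (M.pass ^ n) ρ) atTop (𝓝 M.limitState) := by
  simpa only [traceL_of_isDensity h, one_smul] using M.tendsto_pass_pow ρ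

theorem tendsto_omega_nat {ρ : TC Fock} (h : IsDensity ρ) (A : Fock →L[ℂ] Fock) :
    Tendsto (fun n : ℕ => M.omega (n * M.τ) ρ A) atTop
      (𝓝 (TC.traceL (TC.mulL A M.limitState))) := by
  simp only [omega_nat_mul]
  exact ((TC.traceL ∘L TC.mulL A).continuous.tendsto _).comp (M.tendsto_pass_pow_of_isDensity h)

theorem pass_pow_limitState (n : ℕ) : (M.pass ^ n) M.limitState = M.limitState := by
  rw [FunLike.coe_pow_eq_iterate]
  exact Function.iterate_fixed M.pass_limitState n

theorem cavityState_add_τ {t : ℝ} (ht : 0 ≤ t) :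
    M.cavityState (t + M.τ) M.limitState = M.cavityState t M.limitState := by
  have h1 : ⌊(t + M.τ) / M.τ⌋₊ = ⌊t / M.τ⌋₊ + 1 := by
    rw [add_div, div_self M.τ_pos.ne', Nat.floor_add_one (div_nonneg ht M.τ_pos.le)]
  have h2 : t + M.τ - ((⌊t / M.τ⌋₊ + 1 : ℕ) : ℝ) * M.τ = t - ⌊t / M.τ⌋₊ * M.τ := by
    push_cast
    ring
  refine (M.cavityState_eq _ _).trans (Eq.trans ?_ (M.cavityState_eq _ _).symm)
  rw [h1, h2, pass_pow_limitState, pass_pow_limitState]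

/-- The evolution within a period is a contraction, so the estimate at the last multiple of τ is
uniform in the elapsed fraction of the period. -/
theorem tendsto_omega_sub {ρ : TC Fock} (h : IsDensity ρ) (A : Fock →L[ℂ] Fock) :
    Tendsto (fun t : ℝ => M.omega t ρ A - M.omega t M.limitState A) atTop (𝓝 0) := by
  have h1 : Tendsto (fun t : ℝ => ⌊t / M.τ⌋₊) atTop atTop :=
    tendsto_nat_floor_atTop.comp (tendsto_id.atTop_div_const M.τ_pos)
  have h2 := ((M.tendsto_pass_pow_of_isDensity h).comp h1).sub_const M.limitState |>.norm.const_mul ‖A‖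
  rw [sub_self, norm_zero, mul_zero] at h2
  refine squeeze_zero_norm (fun t => ?_) h2
  rw [omega_eq, omega_eq, ← map_sub, ← map_sub, ← map_sub, pass_pow_limitState]
  refine (TC.norm_traceL_mulL_le _ _).trans ?_
  gcongr
  exact M.norm_step_le _ _

/-- The exponent in the factors of the characteristic function. -/
def factorExponent (α : ℂ) : ℂ × ℂ :=
  (-(Complex.I * M.lam / M.μ) * (1 - Complex.exp (-M.μ * M.τ)) * α,
    (Complex.I * M.lam / conj M.μ) * (1 - Complex.exp (-conj M.μ * M.τ)) * conj α)

theorem factor_sub_one (k : ℕ) (α : ℂ) : M.factor k α - 1 = M.p * (Complex.exp (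
    Complex.exp (-M.μ * M.τ) ^ k * (M.factorExponent α).1 -
      Complex.exp (-conj M.μ * M.τ) ^ k * (M.factorExponent α).2) - 1) := by
  have h : ∀ ν : ℂ, Complex.exp (-ν * M.τ) ^ k = Complex.exp (-k * ν * M.τ) := fun ν => by
    rw [← Complex.exp_nat_mul]
    congr 1
    ring
  rw [h, h, factor, factorExponent]
  ring_nf

/-- The exponents decay like exp(-kστ/2), and |exp u - 1| ≤ 2|u| as soon as |u| ≤ 1. -/
theorem summable_factor (α : ℂ) : Summable fun k : ℕ => ‖M.factor k α - 1‖ := by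
  have hd : ‖Complex.exp (-conj M.μ * M.τ)‖ = M.decay := by
    have h : conj (Complex.exp (-M.μ * M.τ)) = Complex.exp (-conj M.μ * M.τ) := by
      rw [← Complex.exp_conj]
      simp
    rw [← h, Complex.norm_conj, norm_exp_μ_τ]
  set u : ℕ → ℂ := fun k => Complex.exp (-M.μ * M.τ) ^ k * (M.factorExponent α).1 -
    Complex.exp (-conj M.μ * M.τ) ^ k * (M.factorExponent α).2 with hu
  have h1 : ∀ k, ‖u k‖ ≤ M.decay ^ k * (‖(M.factorExponent α).1‖ + ‖(M.factorExponent α).2‖) :=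
    fun k => by
      refine (norm_sub_le _ _).trans (le_of_eq ?_)
      rw [norm_mul, norm_mul, norm_pow, norm_pow, norm_exp_μ_τ, hd, mul_add]
  have h2 : Summable fun k : ℕ =>
      M.decay ^ k * (‖(M.factorExponent α).1‖ + ‖(M.factorExponent α).2‖) :=
    (summable_geometric_of_lt_one M.decay_pos.le M.decay_lt_one).mul_right _
  have h3 : ∀ᶠ k in atTop, ‖u k‖ ≤ 1 :=
    (squeeze_zero (fun k => norm_nonneg (u k)) h1 h2.tendsto_atTop_zero).eventually_le_const
      zero_lt_one
  refine Summable.of_norm_bounded_eventually_nat (h2.mul_left (|M.p| * 2)) ?_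
  filter_upwards [h3] with k hk
  rw [norm_norm, factor_sub_one, norm_mul, Complex.norm_real, Real.norm_eq_abs, mul_assoc]
  gcongr
  exact (Complex.norm_exp_sub_one_le hk).trans (by linarith [h1 k])

theorem multipliable_factor (α : ℂ) : Multipliable fun k : ℕ => M.factor k α := by
  simpa using multipliable_one_add_of_summable (M.summable_factor α)

/-- The characteristic function of the limiting state. -/
theorem trace_weyl_limitState (α : ℂ) : TC.traceL (TC.mulL (weyl α) M.limitState) =
    Complex.exp (-‖α‖ ^ 2 / 2) * ∏' k : ℕ, M.factor k α := by
  have h1 := ((TC.traceL ∘L TC.mulL (weyl α)).continuous.tendsto _).comp M.tendsto_limitState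
  refine tendsto_nhds_unique h1
    (((M.multipliable_factor α).hasProd.tendsto_prod_nat.const_mul _).congr fun n => ?_)
  have h2 : (M.pass ^ n) (normDyad 0 0) = (M.step M.τ.toNNReal)^[n] (normDyad 0 0) := by
    rw [FunLike.coe_pow_eq_iterate]
    rfl
  rw [Function.comp_apply, ContinuousLinearMap.comp_apply, h2, trace_weyl_iterate_step]
  have e1 := M.exp_mul_conj_exp n
  have e2 : α * conj α = (‖α‖ : ℂ) ^ 2 := Complex.mul_conj' α
  have e3 : Complex.exp (-n * M.μ * M.τ) * α * conj (Complex.exp (-n * M.μ * M.τ) * α) =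
      ((Real.exp (-n * M.σ * M.τ) : ℝ) : ℂ) * ‖α‖ ^ 2 := by
    rw [← e1, ← e2, map_mul]
    ring
  -- For the vacuum the Gaussian exp(-exp(-nστ)|α|²/2) completes the prefactor to exp(-|α|²/2) for
  -- every n, so only the product is left to converge.
  rw [trace_weyl_normDyad, map_zero, mul_zero, mul_zero, add_zero, sub_zero, e3, mul_right_comm,
    ← Complex.exp_add]
  refine congrArg (fun x => Complex.exp x * _) ?_
  ring

end Model

end Cavity

end

theorem theorem4p4p1 (M : Cavity.Model) :
    -- the dynamics is well posed, and the cavity state does not depend on the length of the beam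
    (∀ N k : ℕ, ∃! T, M.IsLindbladSemigroup N k T) ∧
    (∀ (N : ℕ) (t : ℝ) (ρ : traceClass Fock), 0 ≤ t → ⌊t / M.τ⌋₊ < N →
      M.cavityStateOf N t ρ = M.cavityState t ρ) ∧
    -- the powers of the dual of the discrete evolution operator on the Weyl operators
    (∃ Ψ : (Fock →L[ℂ] Fock) → (Fock →L[ℂ] Fock), IsDual M.discreteEvolution Ψ ∧
      ∀ (n : ℕ) (α : ℂ),
        Ψ^[n] (weyl α) =
          (Complex.exp (-(1 - Real.exp (-n * M.σ * M.τ)) * ‖α‖ ^ 2 / 2) *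
            ∏ k ∈ Finset.range n, M.factor k α) •
              weyl (Complex.exp (-n * M.μ * M.τ) * α)) ∧
    -- the limiting cavity state
    (∃ ρlim : traceClass Fock, IsDensity ρlim ∧
      (∀ ρ : traceClass Fock, IsDensity ρ → ∀ A : Fock →L[ℂ] Fock,
        Tendsto (fun n : ℕ => M.omega (n * M.τ) ρ A) atTop (𝓝 (trace (A ∘L ρlim.1)))) ∧
      (∀ α : ℂ,
        Summable (fun k : ℕ => ‖M.factor k α - 1‖) ∧
        Multipliable (fun k : ℕ => M.factor k α) ∧
        trace (weyl α ∘L ρlim.1) = Complex.exp (-‖α‖ ^ 2 / 2) * ∏' k : ℕ, M.factor k α) ∧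
      -- between the times `n τ` the cavity state is asymptotically `τ`-periodic
      (∀ t : ℝ, 0 ≤ t → M.cavityState (t + M.τ) ρlim = M.cavityState t ρlim) ∧
      (∀ ρ : traceClass Fock, IsDensity ρ → ∀ A : Fock →L[ℂ] Fock,
        Tendsto (fun t : ℝ => M.omega t ρ A - M.omega t ρlim A) atTop (𝓝 0))) :=

  ⟨M.existsUnique_isLindbladSemigroup, fun N t ρ _ h => M.cavityStateOf_eq_cavityState N t ρ h,
    M.exists_dual, M.limitState, M.isDensity_limitState, fun _ hρ A => M.tendsto_omega_nat hρ A,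
    fun α => ⟨M.summable_factor α, M.multipliable_factor α, M.trace_weyl_limitState α⟩,
    fun _ ht => M.cavityState_add_τ ht, fun _ hρ A => M.tendsto_omega_sub hρ A⟩
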